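/- **Setting.** Consider a Markov decision process with measurable state space $\mathcal S$, open action set $\mathcal A\subseteq\mathbb R^m$, initial law $d_0$, discount $\gamma\in[0,1)$, transition law $P(\cdot\mid s,a)$ and random rewards with $|r|\le R_{\max}$ and mean $r(s,a)$. The policy is reparameterized: $a=f_\theta(s,\epsilon)\in\mathcal A$ with $\theta\in\mathbb R^d$ and $\epsilon\sim p$, where $f$ is jointly measurable and differentiable in $\theta$. Let $P_\theta$ be the state transition kernel under $f_\theta$. For an initial law $\mu$ let $\nu^\mu_\theta=\sum_{t\ge0}\gamma^t\mu P_\theta^t$, and let $\nu_\theta=(1-\gamma)\nu_\theta^{d_0}$ be the normalized discounted visitation distribution. Let $d_\theta$ be the stationary distribution, i.e. the setwise limit of $\frac1T\sum_{t=0}^T d_0P_\theta^t$, which is assumed to exist and to be a probability measure for every $\theta$. Let $V^{f_\theta},Q^{f_\theta}$ be the value functions, $J(\theta)=(1-\gamma)\mathbb E_{s\sim d_0}V^{f_\theta}(s)$, and $$\nabla J(\theta)=\mathbb E_{s\sim\nu_\theta,\epsilon\sim p}\big[\nabla_\theta f_\theta(s,\epsilon)\,\nabla_aQ^{f_\theta}(s,a)|_{a=f_\theta(s,\epsilon)}\big].$$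 Norms of vectors are Euclidean, those of matrices are operator norms, and $\|\mu-\nu\|_{TV}=\int|\mu(ds)-\nu(ds)|$. **Assumptions.** There are positive constants $L_f,L_\psi,\lambda_\Psi,L_P,L_r,L_Q,C_\phi,\lambda_A$ such that for all $\theta,\theta_1,\theta_2\in\mathbb R^d$, all $s,\epsilon$ and all $a_1,a_2\in\mathcal A$: 1. $\|f_{\theta_1}(s,\epsilon)-f_{\theta_2}(s,\epsilon)\|\le L_f\|\theta_1-\theta_2\|$; $\|\nabla_\theta f_{\theta_1}(s,\epsilon)-\nabla_\theta f_{\theta_2}(s,\epsilon)\|\le L_\psi\|\theta_1-\theta_2\|$; all eigenvalues of $\Psi_\theta=\mathbb E_{\nu_\theta,p}[\nabla_\theta f_\theta\nabla_\theta f_\theta^T]$ are at least $\lambda_\Psi$. 2. $\|P(\cdot|s,a_1)-P(\cdot|s,a_2)\|_{TV}\le L_P\|a_1-a_2\|$ and $|r(s,a_1)-r(s,a_2)|\le L_r\|a_1-a_2\|$. 3. $Q^{f_\theta}(s,\cdot)$ is differentiable on $\mathcal A$ and $\|\nabla_aQ^{f_\theta}(s,a_1)-\nabla_aQ^{f_\theta}(s,a_2)\|\le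 L_Q\|a_1-a_2\|$. 4. $\phi:\mathcal S\times\mathcal A\to\mathbb R^d$ is measurable with $\|\phi\|\le C_\phi$. With $x=(s,f_\theta(s,\epsilon))$, $x'=(s',f_\theta(s',\epsilon'))$, where $s\sim d_\theta$, $(s',r)$ is the sampled next state and reward, and $\epsilon,\epsilon'\sim p$ are independent, the matrices $A_\theta=\mathbb E[\phi(x)(\gamma\phi(x')-\phi(x))^T]$ and $D_\theta=\mathbb E[\phi(x)\phi(x)^T]$ are non-singular, and every complex eigenvalue of $A_\theta$ has modulus at least $\lambda_A$. **Notation.** $w^*_\theta$ is the TD fixed point, $A_\theta w^*_\theta+b_\theta=0$ with $b_\theta=\mathbb E[r\,\phi(x)]$; $w^*_{\xi_\theta}$ is the minimizer over $w$ of $\mathbb E_{\nu_\theta,p}\|\nabla_\theta f_\theta(s,\epsilon)^Tw-\nabla_aQ^{f_\theta}(s,a)|_{a=f_\theta(s,\epsilon)}\|^2$; and $\kappa=\sup_\theta\|w^*_\theta-w^*_{\xi_\theta}\|$. **RPG-TD.** Start from deterministic $\theta_0,w_0$. At iteration $t$, given $(\theta_t,w_t)$, draw independently $M$ i.i.d.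 transitions $(x_{t,j},r_{t,j},x'_{t,j})$ as in 4 with $\theta=\theta_t$ and $M$ i.i.d. pairs $(s'_{t,j},\epsilon'_{t,j})\sim\nu_{\theta_t}\otimes p$, and set $$w_{t+1}=w_t+\tfrac{\alpha_w}M\sum_j\big(r_{t,j}+\gamma\phi(x'_{t,j})^Tw_t-\phi(x_{t,j})^Tw_t\big)\phi(x_{t,j}),$$ $$\theta_{t+1}=\theta_t+\tfrac{\alpha_\theta}M\sum_j\nabla_\theta f_{\theta_t}(s'_{t,j},\epsilon'_{t,j})\nabla_\theta f_{\theta_t}(s'_{t,j},\epsilon'_{t,j})^Tw_t .$$ **Theorem.** $J$ is differentiable with gradient $\nabla J(\theta)$ as above, the minimizer $w^*_{\xi_\theta}$ exists and is unique, and $\kappa<\infty$. There exist constants $C_\nu>1$, $\lambda>0$ and $\sigma_A>0$ such that, for all $\theta,\theta_1,\theta_2$, all $v\in\mathbb R^d$ and all initial laws $\mu$, $$\|\nu^\mu_{\theta_1}-\nu^\mu_{\theta_2}\|_{TV}\le C_\nu\cdot\tfrac12\sup_s\|P_{\theta_1}(s,\cdot)-P_{\theta_2}(s,\cdot)\|_{TV},\qquad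 v^TA_\theta v\le-\lambda\|v\|^2,\qquad \|A_\theta v\|\ge\sigma_A\|v\|.$$ For all such constants, all $\theta_0,w_0$, and all $\alpha_w,\alpha_\theta>0$ and $M\in\mathbb N$ with $$\alpha_w\le\frac{\lambda}{2C_A^2},\qquad M\ge\frac{48\alpha_wC_A^2}{\lambda},\qquad \alpha_\theta\le\min\Big\{\frac1{4L_J},\frac{\lambda\alpha_w}{24\sqrt6\,L_hL_w}\Big\},$$ the iterates satisfy, for every $T\ge1$, $$\min_{0\le t<T}\mathbb E\|\nabla J(\theta_t)\|^2\le\frac{c_1}T+\frac{c_2}M+c_3\kappa^2,$$ where $$c_1=\frac{8R_{\max}}{\alpha_\theta(1-\gamma)}+\frac{144L_h^2}{\lambda\alpha_w}\|w_0-w^*_{\theta_0}\|^2,$$ $$c_2=\Big[48\alpha_w^2(C_A^2C_w^2+C_b^2)+\frac{96L_w^2L_f^4C_{w_\xi}^2\alpha_\theta^2}{\lambda\alpha_w}\Big]\frac{144L_h^2}{\lambda\alpha_w}+72L_f^4C_{w_\xi}^2,$$ $$c_3=18L_h^2+\Big[\frac{24L_w^2L_h^2\alpha_\theta^2}{\lambda\alpha_w}+\frac{24}{\lambda\alpha_w}\Big]\frac{144L_h^2}{\lambda\alpha_w},$$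 with $C_A=2C_\phi^2$, $C_b=R_{\max}C_\phi$, $C_w=\frac{R_{\max}C_\phi}{\sigma_A}$, $C_Q=L_r+L_P\frac{\gamma R_{\max}}{1-\gamma}$, $C_{w_\xi}=\frac{L_fC_Q}{\lambda_\Psi(1-\gamma)}$, $L_\nu=\frac12C_\nu L_PL_f$, $L_h=L_f^2$, $$L_J=\Big(\tfrac12L_PL_f^2C_\nu+\frac{L_\psi}{1-\gamma}\Big)\Big(L_r+\frac{\gamma R_{\max}L_P}{1-\gamma}\Big)+\frac{L_f}{1-\gamma}\Big(L_QL_f+\frac\gamma2L_P^2R_{\max}L_fC_\nu+\frac{\gamma L_PL_rL_f}{1-\gamma}\Big),$$ $$L_w=\frac{L_J}{\lambda_\Psi}+\frac{L_fC_Q}{\lambda_\Psi^2(1-\gamma)}\Big(L_f^2L_\nu+\frac{2L_fL_\psi}{1-\gamma}\Big).$$ -/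

import Mathlib

open MeasureTheory ProbabilityTheory Filter Topology

noncomputable section

/-- Total variation norm `∫ |μ(dx) - ν(dx)|` of the difference of two finite measures (without the
factor `1/2`), as the supremum of `|∫ g dμ - ∫ g dν|` over measurable `g` with `|g| ≤ 1`. -/
def tvNorm {X : Type*} [MeasurableSpace X] (μ ν : Measure X) : ℝ :=
  ⨆ g : {g : X → ℝ // Measurable g ∧ ∀ x, |g x| ≤ 1}, |∫ x, g.1 x ∂μ - ∫ x, g.1 x ∂ν|

/-- A discounted Markov decision process with a reparameterized policy `a = f_θ(s, ε)`, `ε ∼ noise`,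
parameters `θ ∈ ℝ^d`, actions in `actions ⊆ ℝ^m`, and a feature map for the linear critic.
`step (s, a)` is the joint law of the next state and the reward. -/
structure RPGProblem (S N : Type*) [MeasurableSpace S] [MeasurableSpace N] (d m : ℕ) where
  actions : Set (EuclideanSpace ℝ (Fin m))
  step : Kernel (S × EuclideanSpace ℝ (Fin m)) (S × ℝ)
  init : Measure S
  noise : Measure N
  discount : ℝ
  policy : EuclideanSpace ℝ (Fin d) → S → N → EuclideanSpace ℝ (Fin m)
  feature : S × EuclideanSpace ℝ (Fin m) → EuclideanSpace ℝ (Fin d)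

/-- The constants of the assumptions. -/
structure RPGConstants where
  Rmax : ℝ
  Lf : ℝ
  Lpsi : ℝ
  lamPsi : ℝ
  LP : ℝ
  Lr : ℝ
  LQ : ℝ
  Cphi : ℝ
  lamA : ℝ

namespace RPGProblem

variable {S N : Type*} [MeasurableSpace S] [MeasurableSpace N] {d m : ℕ} (P : RPGProblem S N d m)

/-! ### The Markov chain of a policy, visitation and stationary distributions -/

/-- Law of the next state. -/
def nextState (s : S) (a : EuclideanSpace ℝ (Fin m)) : Measure S :=
  (P.step (s, a)).map Prod.fst

/-- Mean reward `r(s, a)`. -/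
def reward (s : S) (a : EuclideanSpace ℝ (Fin m)) : ℝ :=
  ∫ y, y.2 ∂(P.step (s, a))

/-- The state transition law `P_θ(s, ·)` under the policy `f_θ`. -/
def transition (θ : EuclideanSpace ℝ (Fin d)) (s : S) : Measure S :=
  P.noise.bind fun ε => P.nextState s (P.policy θ s ε)

/-- Law of the state after `t` steps under `f_θ`, from the initial law `μ`. -/
def stateLaw (θ : EuclideanSpace ℝ (Fin d)) (μ : Measure S) : ℕ → Measure S
  | 0 => μ
  | t + 1 => (stateLaw θ μ t).bind (P.transition θ)

/-- The (unnormalized) discounted visitation measure `∑ₜ γ^t μ P_θ^t`, of mass `1 / (1 - γ)`. -/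
def visitMeasure (θ : EuclideanSpace ℝ (Fin d)) (μ : Measure S) : Measure S :=
  Measure.sum fun t : ℕ => ENNReal.ofReal (P.discount ^ t) • P.stateLaw θ μ t

/-- The discounted visitation distribution `ν_θ` (a probability measure). -/
def visitDist (θ : EuclideanSpace ℝ (Fin d)) : Measure S :=
  ENNReal.ofReal (1 - P.discount) • P.visitMeasure θ P.init

/-- `μ` is the setwise limit of the time averages of the state laws under `f_θ`. -/
def IsStationaryLimit (θ : EuclideanSpace ℝ (Fin d)) (μ : Measure S) : Prop :=
  IsProbabilityMeasure μ ∧ ∀ B : Set S, MeasurableSet B →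
    Tendsto (fun T : ℕ => (∑ t ∈ Finset.range (T + 1), (P.stateLaw θ P.init t).real B) / T)
      atTop (𝓝 (μ.real B))

open Classical in
/-- The stationary state distribution `d_θ`: the limit of the time averages. -/
def statDist (θ : EuclideanSpace ℝ (Fin d)) : Measure S :=
  Classical.epsilon fun μ => P.IsStationaryLimit θ μ

/-! ### Value functions and the reparameterization gradient -/

/-- `V^{f_θ}(s) = E[∑ₜ γ^t r(sₜ, aₜ) | s₀ = s]`. -/
def value (θ : EuclideanSpace ℝ (Fin d)) (s : S) : ℝ :=
  ∑' t : ℕ, P.discount ^ t *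
    ∫ s', ∫ ε, P.reward s' (P.policy θ s' ε) ∂P.noise ∂(P.stateLaw θ (Measure.dirac s) t)

/-- `Q^{f_θ}(s, a)`. -/
def qValue (θ : EuclideanSpace ℝ (Fin d)) (s : S) (a : EuclideanSpace ℝ (Fin m)) : ℝ :=
  P.reward s a + P.discount * ∫ s', P.value θ s' ∂(P.nextState s a)

/-- The normalized objective `J(θ) = (1 - γ) E_{s ∼ init} V^{f_θ}(s)`. -/
def objective (θ : EuclideanSpace ℝ (Fin d)) : ℝ :=
  (1 - P.discount) * ∫ s, P.value θ s ∂P.init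

/-- `∇_a Q^{f_θ}(s, a)`. -/
def gradQ (θ : EuclideanSpace ℝ (Fin d)) (s : S) (a : EuclideanSpace ℝ (Fin m)) :
    EuclideanSpace ℝ (Fin m) :=
  gradient (fun a' => P.qValue θ s a') a

/-- The Jacobian of `θ ↦ f_θ(s, ε)`, i.e. `∇_θ f_θ(s, ε)ᵀ`, an `m × d` matrix. -/
def jac (θ : EuclideanSpace ℝ (Fin d)) (s : S) (ε : N) :
    EuclideanSpace ℝ (Fin d) →L[ℝ] EuclideanSpace ℝ (Fin m) :=
  fderiv ℝ (fun θ' => P.policy θ' s ε) θ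

/-- `∇_θ f_θ(s, ε)`, a `d × m` matrix. -/
def gradPolicy (θ : EuclideanSpace ℝ (Fin d)) (s : S) (ε : N) :
    EuclideanSpace ℝ (Fin m) →L[ℝ] EuclideanSpace ℝ (Fin d) :=
  ContinuousLinearMap.adjoint (P.jac θ s ε)

/-- The reparameterization gradient
`∇J(θ) = E_{s ∼ ν_θ, ε}[∇_θ f_θ(s, ε) ∇_a Q^{f_θ}(s, a)|_{a = f_θ(s, ε)}]`. -/
def gradJ (θ : EuclideanSpace ℝ (Fin d)) : EuclideanSpace ℝ (Fin d) :=
  ∫ s, ∫ ε, P.gradPolicy θ s ε (P.gradQ θ s (P.policy θ s ε)) ∂P.noise ∂(P.visitDist θ)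

/-- `Ψ_θ = E_{s ∼ ν_θ, ε}[∇_θ f_θ(s, ε) ∇_θ f_θ(s, ε)ᵀ]`. -/
def Psi (θ : EuclideanSpace ℝ (Fin d)) :
    EuclideanSpace ℝ (Fin d) →L[ℝ] EuclideanSpace ℝ (Fin d) :=
  ∫ s, ∫ ε, (P.gradPolicy θ s ε).comp (P.jac θ s ε) ∂P.noise ∂(P.visitDist θ)

/-- The mean square error `E_{s ∼ ν_θ, ε} ‖∇_θ f_θ(s, ε)ᵀ w - ∇_a Q^{f_θ}(s, f_θ(s, ε))‖²` of a
critic with action gradient `∇_θ f_θ(s, ε)ᵀ w`. -/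
def compatError (θ w : EuclideanSpace ℝ (Fin d)) : ℝ :=
  ∫ s, ∫ ε, ‖P.jac θ s ε w - P.gradQ θ s (P.policy θ s ε)‖ ^ 2 ∂P.noise ∂(P.visitDist θ)

/-- `w` minimizes the mean square error. -/
def IsCompatible (θ w : EuclideanSpace ℝ (Fin d)) : Prop :=
  ∀ w', P.compatError θ w ≤ P.compatError θ w'

open Classical in
/-- The compatible critic weights `w*_{ξ_θ}`. -/
def wCompat (θ : EuclideanSpace ℝ (Fin d)) : EuclideanSpace ℝ (Fin d) :=
  Classical.epsilon fun w => P.IsCompatible θ w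

/-! ### The linear TD critic -/

/-- The law of `(x, r, x')` with `x = (s, f_θ(s, ε))`, `x' = (s', f_θ(s', ε'))`, where `s ∼ d_θ`,
`(s', r) ∼ step x`, and `ε, ε' ∼ noise` are independent. -/
def transLaw (θ : EuclideanSpace ℝ (Fin d)) :
    Measure ((S × EuclideanSpace ℝ (Fin m)) × ℝ × (S × EuclideanSpace ℝ (Fin m))) :=
  (P.statDist θ).bind fun s => P.noise.bind fun ε =>
    (P.step (s, P.policy θ s ε)).bind fun y =>
      P.noise.map fun ε' => ((s, P.policy θ s ε), y.2, (y.1, P.policy θ y.1 ε'))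

/-- `A_θ = E[φ(x) (γ φ(x') - φ(x))ᵀ]`. -/
def critA (θ : EuclideanSpace ℝ (Fin d)) : Matrix (Fin d) (Fin d) ℝ :=
  Matrix.of fun i j => ∫ z, P.feature z.1 i *
    (P.discount * P.feature z.2.2 j - P.feature z.1 j) ∂(P.transLaw θ)

/-- `D_θ = E[φ(x) φ(x)ᵀ]`. -/
def critD (θ : EuclideanSpace ℝ (Fin d)) : Matrix (Fin d) (Fin d) ℝ :=
  Matrix.of fun i j => ∫ z, P.feature z.1 i * P.feature z.1 j ∂(P.transLaw θ)

/-- `b_θ = E[r φ(x)]`. -/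
def critb (θ : EuclideanSpace ℝ (Fin d)) : EuclideanSpace ℝ (Fin d) :=
  ∫ z, z.2.1 • P.feature z.1 ∂(P.transLaw θ)

/-- The TD fixed point `w*_θ = -A_θ⁻¹ b_θ`, i.e. the solution of `A_θ w + b_θ = 0`. -/
def wTD (θ : EuclideanSpace ℝ (Fin d)) : EuclideanSpace ℝ (Fin d) :=
  -(Matrix.toEuclideanCLM (𝕜 := ℝ) (P.critA θ)⁻¹ (P.critb θ))

/-- `κ = sup_θ ‖w*_θ - w*_{ξ_θ}‖`. -/
def kappa : ℝ := ⨆ θ : EuclideanSpace ℝ (Fin d), ‖P.wTD θ - P.wCompat θ‖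

/-! ### The algorithm RPG-TD -/

/-- TD error `r + γ φ(x')ᵀ w - φ(x)ᵀ w` of a transition `(x, r, x')`. -/
def tdError (w : EuclideanSpace ℝ (Fin d))
    (z : (S × EuclideanSpace ℝ (Fin m)) × ℝ × (S × EuclideanSpace ℝ (Fin m))) : ℝ :=
  z.2.1 + P.discount * inner ℝ (P.feature z.2.2) w - inner ℝ (P.feature z.1) w

/-- One iteration `(θ_t, w_t) ↦ (θ_{t+1}, w_{t+1})`, given the critic batch of transitions and the
actor batch of pairs `(s', ε')`. Both updates use `w_t`. -/
def update (αw αθ : ℝ) (M : ℕ) (x : EuclideanSpace ℝ (Fin d) × EuclideanSpace ℝ (Fin d))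
    (crit : Fin M → (S × EuclideanSpace ℝ (Fin m)) × ℝ × (S × EuclideanSpace ℝ (Fin m)))
    (act : Fin M → S × N) : EuclideanSpace ℝ (Fin d) × EuclideanSpace ℝ (Fin d) :=
  (x.1 + (αθ / M) • ∑ j, P.gradPolicy x.1 (act j).1 (act j).2 (P.jac x.1 (act j).1 (act j).2 x.2),
   x.2 + (αw / M) • ∑ j, P.tdError x.2 (crit j) • P.feature (crit j).1)

/-- Law of `(θ_{t+1}, w_{t+1})` given `(θ_t, w_t) = x`: the critic batch consists of `M` i.i.d.
transitions with `s ∼ d_{θ_t}`, the actor batch of `M` i.i.d. pairs from `ν_{θ_t} ⊗ noise`. -/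
def stepLaw (αw αθ : ℝ) (M : ℕ) (x : EuclideanSpace ℝ (Fin d) × EuclideanSpace ℝ (Fin d)) :
    Measure (EuclideanSpace ℝ (Fin d) × EuclideanSpace ℝ (Fin d)) :=
  ((Measure.pi fun _ : Fin M => P.transLaw x.1).prod
    (Measure.pi fun _ : Fin M => (P.visitDist x.1).prod P.noise)).map
      fun y => P.update αw αθ M x y.1 y.2

/-- The law of the iterate `(θ_t, w_t)` of RPG-TD started at `(θ₀, w₀)`. -/
def iterateLaw (αw αθ : ℝ) (M : ℕ) (θ₀ w₀ : EuclideanSpace ℝ (Fin d)) :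
    ℕ → Measure (EuclideanSpace ℝ (Fin d) × EuclideanSpace ℝ (Fin d))
  | 0 => Measure.dirac (θ₀, w₀)
  | t + 1 => (iterateLaw αw αθ M θ₀ w₀ t).bind (P.stepLaw αw αθ M)

/-! ### Assumptions -/

/-- Standing conventions: a genuine MDP with discount `γ ∈ [0, 1)`, bounded rewards, measurable
policy and features, actions in an open set, existence of the derivatives that the assumptions
speak about, and existence of the stationary distributions (ergodicity). -/
structure Standing (Rmax : ℝ) : Prop where
  markov : IsMarkovKernel P.step
  init_prob : IsProbabilityMeasure P.init
  noise_prob : IsProbabilityMeasure P.noise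
  discount_nonneg : 0 ≤ P.discount
  discount_lt_one : P.discount < 1
  actions_open : IsOpen P.actions
  policy_meas : Measurable
    fun z : EuclideanSpace ℝ (Fin d) × S × N => P.policy z.1 z.2.1 z.2.2
  policy_mem : ∀ θ s ε, P.policy θ s ε ∈ P.actions
  policy_diff : ∀ s ε, Differentiable ℝ fun θ => P.policy θ s ε
  feature_meas : Measurable P.feature
  reward_bound : ∀ s, ∀ a ∈ P.actions, ∀ᵐ y ∂(P.step (s, a)), |y.2| ≤ Rmax
  qValue_diff : ∀ θ s, ∀ a ∈ P.actions, DifferentiableAt ℝ (fun a' => P.qValue θ s a') a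
  ergodic : ∀ θ, ∃ μ, P.IsStationaryLimit θ μ

/-- Assumption on the policy. As `lamPsi > 0`, the last field includes that `Ψ_θ` is
non-singular. -/
structure PolicyAssumption (K : RPGConstants) : Prop where
  Lf_pos : 0 < K.Lf
  Lpsi_pos : 0 < K.Lpsi
  lamPsi_pos : 0 < K.lamPsi
  lipschitz : ∀ θ₁ θ₂ s ε, ‖P.policy θ₁ s ε - P.policy θ₂ s ε‖ ≤ K.Lf * ‖θ₁ - θ₂‖
  smooth : ∀ θ₁ θ₂ s ε, ‖P.gradPolicy θ₁ s ε - P.gradPolicy θ₂ s ε‖ ≤ K.Lpsi * ‖θ₁ - θ₂‖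
  psi_eigenvalues : ∀ θ, ∀ z ∈ spectrum ℝ (P.Psi θ), K.lamPsi ≤ z

/-- Assumption on the environment. -/
structure EnvironmentAssumption (K : RPGConstants) : Prop where
  LP_pos : 0 < K.LP
  Lr_pos : 0 < K.Lr
  transition_lipschitz : ∀ s, ∀ a₁ ∈ P.actions, ∀ a₂ ∈ P.actions,
    tvNorm (P.nextState s a₁) (P.nextState s a₂) ≤ K.LP * ‖a₁ - a₂‖
  reward_lipschitz : ∀ s, ∀ a₁ ∈ P.actions, ∀ a₂ ∈ P.actions,
    |P.reward s a₁ - P.reward s a₂| ≤ K.Lr * ‖a₁ - a₂‖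

/-- Smoothness of the action value function. -/
structure QAssumption (K : RPGConstants) : Prop where
  LQ_pos : 0 < K.LQ
  smooth : ∀ θ s, ∀ a₁ ∈ P.actions, ∀ a₂ ∈ P.actions,
    ‖P.gradQ θ s a₁ - P.gradQ θ s a₂‖ ≤ K.LQ * ‖a₁ - a₂‖

/-- Assumption on the features; the eigenvalues of the real matrix `A_θ` are complex. -/
structure FeatureAssumption (K : RPGConstants) : Prop where
  Cphi_pos : 0 < K.Cphi
  lamA_pos : 0 < K.lamA
  bounded : ∀ s, ∀ a ∈ P.actions, ‖P.feature (s, a)‖ ≤ K.Cphi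
  critA_nonsingular : ∀ θ, IsUnit (P.critA θ).det
  critD_nonsingular : ∀ θ, IsUnit (P.critD θ).det
  critA_eigenvalues : ∀ θ, ∀ z ∈ spectrum ℂ ((P.critA θ).map (algebraMap ℝ ℂ)), K.lamA ≤ ‖z‖

/-! ### Derived constants -/

/-- `Cν` bounds the sensitivity of the discounted visitation measures to the transition kernel,
uniformly in the initial law: `‖ν¹ - ν²‖_TV ≤ Cν · ½ sup_s ‖P_{θ₁}(s, ·) - P_{θ₂}(s, ·)‖_TV`. -/
def IsVisitationConstant (Cν : ℝ) : Prop :=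
  ∀ μ : Measure S, IsProbabilityMeasure μ → ∀ θ₁ θ₂,
    tvNorm (P.visitMeasure θ₁ μ) (P.visitMeasure θ₂ μ) ≤
      Cν * ⨆ s, tvNorm (P.transition θ₁ s) (P.transition θ₂ s) / 2

/-- `vᵀ A_θ v ≤ -lam ‖v‖²` for all policies. -/
def IsDissipationConstant (lam : ℝ) : Prop :=
  ∀ θ v, inner ℝ v (Matrix.toEuclideanCLM (𝕜 := ℝ) (P.critA θ) v) ≤ -lam * ‖v‖ ^ 2

/-- `‖A_θ v‖ ≥ sA ‖v‖`, i.e. `‖A_θ⁻¹‖ ≤ 1 / sA`, for all policies. -/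
def IsSingularValueBound (sA : ℝ) : Prop :=
  ∀ θ v, sA * ‖v‖ ≤ ‖Matrix.toEuclideanCLM (𝕜 := ℝ) (P.critA θ) v‖

end RPGProblem

namespace RPGConstants

variable (K : RPGConstants)

def CA : ℝ := 2 * K.Cphi ^ 2

def Cb : ℝ := K.Rmax * K.Cphi

def Cw (sA : ℝ) : ℝ := K.Rmax * K.Cphi / sA

def CQ (γ : ℝ) : ℝ := K.Lr + K.LP * (γ * K.Rmax / (1 - γ))

def CwXi (γ : ℝ) : ℝ := K.Lf * K.CQ γ / (K.lamPsi * (1 - γ))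

def Lnu (Cν : ℝ) : ℝ := 1 / 2 * Cν * K.LP * K.Lf

def Lh : ℝ := K.Lf ^ 2

def LJ (γ Cν : ℝ) : ℝ :=
  (1 / 2 * K.LP * K.Lf ^ 2 * Cν + K.Lpsi / (1 - γ)) * (K.Lr + γ * K.Rmax * K.LP / (1 - γ)) +
    K.Lf / (1 - γ) * (K.LQ * K.Lf + γ / 2 * K.LP ^ 2 * K.Rmax * K.Lf * Cν +
      γ * K.LP * K.Lr * K.Lf / (1 - γ))

def Lw (γ Cν : ℝ) : ℝ :=
  K.LJ γ Cν / K.lamPsi + K.Lf * K.CQ γ / (K.lamPsi ^ 2 * (1 - γ)) *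
    (K.Lf ^ 2 * K.Lnu Cν + 2 * K.Lf * K.Lpsi / (1 - γ))

/-- `e₀` stands for `‖w₀ - w*_{θ₀}‖`. -/
def c₁ (γ lam αw αθ e₀ : ℝ) : ℝ :=
  8 * K.Rmax / (αθ * (1 - γ)) + 144 * K.Lh ^ 2 / (lam * αw) * e₀ ^ 2

def c₂ (γ Cν lam sA αw αθ : ℝ) : ℝ :=
  (48 * αw ^ 2 * (K.CA ^ 2 * K.Cw sA ^ 2 + K.Cb ^ 2) +
      96 * K.Lw γ Cν ^ 2 * K.Lf ^ 4 * K.CwXi γ ^ 2 * αθ ^ 2 / (lam * αw)) *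
    (144 * K.Lh ^ 2 / (lam * αw)) + 72 * K.Lf ^ 4 * K.CwXi γ ^ 2

def c₃ (γ Cν lam αw αθ : ℝ) : ℝ :=
  18 * K.Lh ^ 2 +
    (24 * K.Lw γ Cν ^ 2 * K.Lh ^ 2 * αθ ^ 2 / (lam * αw) + 24 / (lam * αw)) *
      (144 * K.Lh ^ 2 / (lam * αw))

end RPGConstants

end

/-!
The iteration is analysed with one Lyapunov function,
`c ‖w - w*_θ‖² - (2 / α_θ) J(θ)` with `c = 4 L_h² / (λ α_w)`, which decreases in mean by
`‖∇J(θ)‖²` per step up to a batch error of order `1 / M` and a multiple of `κ²`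
(`integral_lyapunov_stepLaw_le`). Summing over `t < T` bounds the average, hence the smallest, of
the mean squared gradients. Three facts enter.

*Smoothness of the objective.* By the performance difference lemma
(`Standing.performance_difference`), `J(θ') - J(θ)` is the mean of
`Q^{f_θ}(s, f_θ'(s, ε)) - Q^{f_θ}(s, f_θ(s, ε))` over the visitation distribution of `θ'`. The
integrand is expanded to first order in `θ'`, with quadratic remainder, and `ν_θ'` is replaced by
`ν_θ` at a cost that is also quadratic, because visitation measures are Lipschitz in `θ` in total
variation. This gives `hasGradientAt_objective` without any interchange of derivative and infinite
sum. Splitting `∇J(θ₁) - ∇J(θ₂)` in the same way, with the variation of `θ ↦ ∇_a Q^{f_θ}` bounded in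
`norm_gradQ_sub_le`, gives the constant `L_J` in `norm_gradJ_sub_le`.

*The actor direction.* The compatibility error is a quadratic function of `w` with Hessian `2 Ψ_θ`
and linear term `-2 ∇J(θ)`, so its minimizer is the solution of `Ψ_θ w = ∇J(θ)`
(`isCompatible_iff`). The mean actor step `α_θ Ψ_θ w` therefore misses `α_θ ∇J(θ)` by
`α_θ Ψ_θ (w - w*_{ξ_θ})`, of norm at most `α_θ L_h (‖w - w*_θ‖ + κ)`. Since `Ψ_θ ≥ λ_Ψ`, the
minimizer is Lipschitz in `θ` with constant `L_w` (`norm_wCompat_sub_le`).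

*The critic.* The matrices `A_θ` have bounded entries and determinants bounded away from zero, hence
singular values bounded away from zero (`exists_isSingularValueBound`); together with the invariance
of the stationary distribution this makes `A_θ` uniformly dissipative
(`exists_isDissipationConstant`). Under the conditions on `α_w` and `M`, a TD step thus multiplies
the mean of `‖w - w*_θ‖²` by at most `1 - 23/16 λ α_w`, up to the batch error
(`integral_norm_update_snd_sub_wTD_sq_le`). The subsequent move of `θ` displaces the
target `w*_θ` by at most `2 κ + L_w ‖θ' - θ‖` (`norm_wTD_sub_wTD_le`), and the step size condition
on `α_θ` lets the gradient term of the Lyapunov function absorb the second part.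
-/

set_option linter.unusedSectionVars false

/-! ### Mixtures of measures -/

section Mixtures

variable {α β γ G : Type*} [MeasurableSpace α] [MeasurableSpace β] [MeasurableSpace γ]

/-- Integrating a parametrized kernel against a parametrized law is measurable in the parameter. -/
theorem measurable_bind_param {μ : α → Measure β} (hμ : Measurable μ)
    [∀ a, IsProbabilityMeasure (μ a)] {κ : α × β → Measure γ} (hκ : Measurable κ) :
    Measurable fun a => (μ a).bind fun b => κ (a, b) := by
  refine Measure.measurable_of_measurable_coe _ fun B hB => ?_
  have h1 : ∀ a, Measurable fun b => κ (a, b) := fun a => hκ.comp measurable_prodMk_left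
  have h2 : ∀ a, ((μ a).bind fun b => κ (a, b)) B = ∫⁻ b, κ (a, b) B ∂(μ a) := fun a =>
    Measure.bind_apply hB (h1 a).aemeasurable
  simp_rw [h2]
  let k : Kernel α β := ⟨μ, hμ⟩
  have : IsMarkovKernel k := ⟨fun a => inferInstanceAs (IsProbabilityMeasure (μ a))⟩
  exact Measurable.lintegral_kernel_prod_right' (κ := k) ((Measure.measurable_coe hB).comp hκ)

theorem isProbabilityMeasure_bind_of_measurable {μ : Measure α} [IsProbabilityMeasure μ]
    {κ : α → Measure β} (hκ : Measurable κ) (h : ∀ a, IsProbabilityMeasure (κ a)) :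
    IsProbabilityMeasure (μ.bind κ) :=
  isProbabilityMeasure_bind hκ.aemeasurable (Eventually.of_forall h)

theorem ae_bind_of_ae_ae {μ : Measure α} {κ : α → Measure β} (hκ : Measurable κ)
    {p : β → Prop} (hp : MeasurableSet {b | p b}) (h : ∀ᵐ a ∂μ, ∀ᵐ b ∂(κ a), p b) :
    ∀ᵐ b ∂(μ.bind κ), p b := by
  have hc : MeasurableSet {b | ¬ p b} := hp.compl
  have hm : Measurable fun a => κ a {b | ¬ p b} := (Measure.measurable_coe hc).comp hκ
  rw [ae_iff, Measure.bind_apply hc hκ.aemeasurable, lintegral_eq_zero_iff hm]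
  exact h

theorem measurable_map_param {μ : α → Measure β} (hμ : Measurable μ)
    [∀ a, IsProbabilityMeasure (μ a)] {f : α × β → γ} (hf : Measurable f) :
    Measurable fun a => (μ a).map fun b => f (a, b) := by
  have h1 : ∀ a, ((μ a).map fun b => f (a, b)) = (μ a).bind fun b => Measure.dirac (f (a, b)) :=
    fun a => (Measure.bind_dirac_eq_map (μ a) (hf.comp measurable_prodMk_left)).symm
  simp_rw [h1]
  exact measurable_bind_param hμ (κ := fun p => Measure.dirac (f p))
    (Measure.measurable_dirac.comp hf)

theorem measurable_prod_param {μ : α → Measure β} {ν : α → Measure γ} (hμ : Measurable μ)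
    (hν : Measurable ν) [∀ a, IsProbabilityMeasure (μ a)] [∀ a, IsProbabilityMeasure (ν a)] :
    Measurable fun a => (μ a).prod (ν a) := by
  refine Measurable.measure_of_isPiSystem_of_isProbabilityMeasure generateFrom_prod.symm
    isPiSystem_prod ?_
  rintro _ ⟨s, hs, t, ht, rfl⟩
  simp_rw [Measure.prod_prod]
  exact ((Measure.measurable_coe hs).comp hμ).mul ((Measure.measurable_coe ht).comp hν)

theorem measurable_pi_param {μ : α → Measure β} (hμ : Measurable μ)
    [∀ a, IsProbabilityMeasure (μ a)] (M : ℕ) :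
    Measurable fun a => Measure.pi fun _ : Fin M => μ a := by
  refine Measurable.measure_of_isPiSystem_of_isProbabilityMeasure generateFrom_pi.symm
    isPiSystem_pi ?_
  rintro _ ⟨s, hs, rfl⟩
  simp_rw [Measure.pi_pi]
  exact Finset.measurable_fun_prod _ fun i _ =>
    (Measure.measurable_coe (hs i (Set.mem_univ i))).comp hμ

theorem ae_pi_forall {μ : Measure α} [IsProbabilityMeasure μ] {M : ℕ} {p : α → Prop}
    (h : ∀ᵐ x ∂μ, p x) : ∀ᵐ ω ∂(Measure.pi fun _ : Fin M => μ), ∀ j, p (ω j) :=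
  ae_all_iff.2 fun j =>
    (measurePreserving_eval (fun _ : Fin M => μ) j).quasiMeasurePreserving.ae h

variable [NormedAddCommGroup G] [NormedSpace ℝ G]

theorem integral_bind_kernel {μ : Measure α} [IsFiniteMeasure μ] (k : Kernel α β)
    [IsFiniteKernel k] {f : β → G} (hf : Integrable f (μ.bind k)) :
    ∫ b, f b ∂(μ.bind k) = ∫ a, ∫ b, f b ∂(k a) ∂μ := by
  have := Kernel.integral_comp (κ := Kernel.const Unit μ) (η := k) (a := ()) (f := f)
    (by rw [Kernel.comp_apply]; exact hf)
  rw [Kernel.comp_apply] at this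
  exact this

theorem integral_bind_of_integrable {μ : Measure α} [IsFiniteMeasure μ] {κ : α → Measure β}
    (hκ : Measurable κ) (hp : ∀ a, IsProbabilityMeasure (κ a)) {f : β → G}
    (hf : Integrable f (μ.bind κ)) :
    ∫ b, f b ∂(μ.bind κ) = ∫ a, ∫ b, f b ∂(κ a) ∂μ := by
  let k : Kernel α β := ⟨κ, hκ⟩
  have : IsMarkovKernel k := ⟨hp⟩
  exact integral_bind_kernel k hf

theorem integrable_integral_of_integrable_bind {μ : Measure α} [IsFiniteMeasure μ]
    {κ : α → Measure β}
    (hκ : Measurable κ) [hp : ∀ a, IsProbabilityMeasure (κ a)] {f : β → G}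
    (hf : Integrable f (μ.bind κ)) :
    Integrable (fun a => ∫ b, f b ∂(κ a)) μ := by
  let k : Kernel α β := ⟨κ, hκ⟩
  have : IsMarkovKernel k := ⟨hp⟩
  have := Integrable.integral_comp (κ := Kernel.const Unit μ) (η := k) (a := ()) (f := f)
    (by rw [Kernel.comp_apply]; exact hf)
  exact this

theorem measurable_integral_param {κ : α → Measure β} (hκ : Measurable κ)
    (hp : ∀ a, IsProbabilityMeasure (κ a)) {f : α × β → ℝ} (hf : Measurable f) :
    Measurable fun a => ∫ b, f (a, b) ∂(κ a) := by
  let k : Kernel α β := ⟨κ, hκ⟩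
  have : IsMarkovKernel k := ⟨hp⟩
  exact (hf.stronglyMeasurable.integral_kernel_prod_right' (κ := k)).measurable

theorem integrable_of_norm_le [MeasurableSpace G] [BorelSpace G] [SecondCountableTopology G]
    {μ : Measure α} [IsFiniteMeasure μ] {f : α → G} {C : ℝ}
    (hf : Measurable f) (h : ∀ x, ‖f x‖ ≤ C) : Integrable f μ :=
  Integrable.of_bound hf.aestronglyMeasurable C (Eventually.of_forall h)

theorem norm_integral_le_of_norm_le_prob {μ : Measure α} [IsProbabilityMeasure μ] {f : α → G}
    {C : ℝ} (h : ∀ x, ‖f x‖ ≤ C) : ‖∫ x, f x ∂μ‖ ≤ C := by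
  simpa using norm_integral_le_of_norm_le_const (μ := μ) (Eventually.of_forall h)

end Mixtures

/-! ### The total variation norm -/

section TotalVariation

variable {X : Type*} [MeasurableSpace X] {μ ν : Measure X}

theorem bddAbove_tvNorm [IsFiniteMeasure μ] [IsFiniteMeasure ν] :
    BddAbove (Set.range fun g : {g : X → ℝ // Measurable g ∧ ∀ x, |g x| ≤ 1} =>
      |∫ x, g.1 x ∂μ - ∫ x, g.1 x ∂ν|) := by
  refine ⟨μ.real Set.univ + ν.real Set.univ, ?_⟩
  rintro _ ⟨g, rfl⟩
  have h (ρ : Measure X) [IsFiniteMeasure ρ] : |∫ x, g.1 x ∂ρ| ≤ ρ.real Set.univ := by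
    simpa using norm_integral_le_of_norm_le_const (μ := ρ) (f := g.1) (C := 1)
      (Eventually.of_forall g.2.2)
  exact (abs_sub _ _).trans (add_le_add (h μ) (h ν))

theorem tvNorm_nonneg : 0 ≤ tvNorm μ ν := Real.iSup_nonneg fun _ => abs_nonneg _

theorem tvNorm_le {c : ℝ}
    (h : ∀ g : X → ℝ, Measurable g → (∀ x, |g x| ≤ 1) → |∫ x, g x ∂μ - ∫ x, g x ∂ν| ≤ c) :
    tvNorm μ ν ≤ c :=
  have : Nonempty {g : X → ℝ // Measurable g ∧ ∀ x, |g x| ≤ 1} :=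
    ⟨⟨fun _ => 0, measurable_const, by simp⟩⟩
  ciSup_le fun g => h g.1 g.2.1 g.2.2

theorem abs_integral_sub_le_tvNorm [IsFiniteMeasure μ] [IsFiniteMeasure ν] {g : X → ℝ} {C : ℝ}
    (hg : Measurable g) (hC : ∀ x, |g x| ≤ C) (h0 : 0 ≤ C) :
    |∫ x, g x ∂μ - ∫ x, g x ∂ν| ≤ C * tvNorm μ ν := by
  rcases h0.eq_or_lt with rfl | hpos
  · have : g = 0 := funext fun x => abs_nonpos_iff.1 (hC x)
    simp [this]
  have key := le_ciSup (bddAbove_tvNorm (μ := μ) (ν := ν))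
    ⟨fun x => C⁻¹ * g x, hg.const_mul _, fun x => by
      rw [abs_mul, abs_of_pos (inv_pos.2 hpos), inv_mul_le_iff₀ hpos]; simpa using hC x⟩
  simp only [integral_const_mul] at key
  rw [← mul_sub, abs_mul, abs_of_pos (inv_pos.2 hpos), inv_mul_le_iff₀ hpos] at key
  exact key

/-- The vector-valued case follows from the scalar one by testing against the direction of the
difference. -/
theorem norm_integral_sub_le_tvNorm {G : Type*} [NormedAddCommGroup G] [InnerProductSpace ℝ G]
    [CompleteSpace G] [SecondCountableTopology G] [MeasurableSpace G] [BorelSpace G]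
    [IsFiniteMeasure μ] [IsFiniteMeasure ν] {g : X → G} {C : ℝ}
    (hg : Measurable g) (hC : ∀ x, ‖g x‖ ≤ C) (h0 : 0 ≤ C) :
    ‖∫ x, g x ∂μ - ∫ x, g x ∂ν‖ ≤ C * tvNorm μ ν := by
  set u := ∫ x, g x ∂μ - ∫ x, g x ∂ν with hu
  rcases eq_or_ne u 0 with h | h
  · rw [h, norm_zero]; exact mul_nonneg h0 tvNorm_nonneg
  have hpos : 0 < ‖u‖ := norm_pos_iff.2 h
  have i1 : Integrable g μ := integrable_of_norm_le hg hC
  have i2 : Integrable g ν := integrable_of_norm_le hg hC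
  have key := abs_integral_sub_le_tvNorm (μ := μ) (ν := ν) (g := fun x => inner ℝ u (g x))
    (C := ‖u‖ * C) (hg.const_inner (c := u)) (fun x => (abs_real_inner_le_norm _ _).trans
      (mul_le_mul_of_nonneg_left (hC x) hpos.le)) (by positivity)
  rw [integral_inner i1, integral_inner i2, ← inner_sub_right, ← hu, real_inner_self_eq_norm_sq,
    abs_of_nonneg (by positivity), sq, mul_assoc] at key
  exact le_of_mul_le_mul_left key hpos

end TotalVariation

/-! ### Sums over independent samples -/

section Samples

variable {X G : Type*} [MeasurableSpace X] {μ : Measure X} [IsProbabilityMeasure μ]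
  [NormedAddCommGroup G] [InnerProductSpace ℝ G] [CompleteSpace G] [SecondCountableTopology G]
  [MeasurableSpace G] [BorelSpace G] {M : ℕ} {f : X → G}

theorem integral_comp_eval (hf : Measurable f) (j : Fin M) :
    ∫ ω, f (ω j) ∂(Measure.pi fun _ : Fin M => μ) = ∫ x, f x ∂μ := by
  have h := measurePreserving_eval (fun _ : Fin M => μ) j
  have h2 := integral_map (μ := Measure.pi fun _ : Fin M => μ) h.measurable.aemeasurable
    (f := f) hf.aestronglyMeasurable
  rw [h.map_eq] at h2
  exact h2.symm

theorem integrable_comp_eval (hf : Integrable f μ) (j : Fin M) :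
    Integrable (fun ω : Fin M → X => f (ω j)) (Measure.pi fun _ : Fin M => μ) :=
  (measurePreserving_eval (fun _ : Fin M => μ) j).integrable_comp_of_integrable hf

theorem integral_pi_sum (hm : Measurable f) (hf : Integrable f μ) :
    ∫ ω, ∑ j, f (ω j) ∂(Measure.pi fun _ : Fin M => μ) = (M : ℝ) • ∫ x, f x ∂μ := by
  rw [integral_finsetSum _ fun j _ => integrable_comp_eval hf j]
  simp [integral_comp_eval hm, Nat.cast_smul_eq_nsmul]

theorem map_pi_pair {i j : Fin M} (hij : i ≠ j) :
    (Measure.pi fun _ : Fin M => μ).map (fun ω => (ω i, ω j)) = μ.prod μ := by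
  have h := iIndepFun_pi (μ := fun _ : Fin M => μ) (X := fun _ x => x)
    (fun _ => aemeasurable_id)
  rw [(h.indepFun hij).map_prod_eq_prod_map_map (measurable_pi_apply i).aemeasurable
    (measurable_pi_apply j).aemeasurable]
  rw [show (fun ω : Fin M → X => ω i) = Function.eval i from rfl,
    show (fun ω : Fin M → X => ω j) = Function.eval j from rfl,
    (measurePreserving_eval (fun _ : Fin M => μ) i).map_eq,
    (measurePreserving_eval (fun _ : Fin M => μ) j).map_eq]

theorem integral_inner_comp_eval (hm : Measurable f) (hf : Integrable f μ) {i j : Fin M}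
    (hij : i ≠ j) :
    ∫ ω, inner ℝ (f (ω i)) (f (ω j)) ∂(Measure.pi fun _ : Fin M => μ) = ‖∫ x, f x ∂μ‖ ^ 2 := by
  have hmeas : Measurable fun z : X × X => (inner ℝ (f z.1) (f z.2) : ℝ) :=
    (hm.comp measurable_fst).inner (hm.comp measurable_snd)
  have h1 : ∫ ω, inner ℝ (f (ω i)) (f (ω j)) ∂(Measure.pi fun _ : Fin M => μ) =
      ∫ z, inner ℝ (f z.1) (f z.2) ∂(μ.prod μ) := by
    rw [← map_pi_pair hij, integral_map (by fun_prop) hmeas.aestronglyMeasurable]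
  have hint : Integrable (fun z : X × X => (inner ℝ (f z.1) (f z.2) : ℝ)) (μ.prod μ) := by
    refine (hf.norm.mul_prod hf.norm).mono hmeas.aestronglyMeasurable (Eventually.of_forall ?_)
    intro z
    simpa using abs_real_inner_le_norm (f z.1) (f z.2)
  rw [h1, integral_prod _ hint]
  simp_rw [integral_inner hf, ← real_inner_self_eq_norm_sq]
  simp_rw [real_inner_comm (∫ x, f x ∂μ)]
  rw [integral_inner hf]

/-- Second moment of a sum of `M` independent copies: all but `M` of the cross terms factor. -/
theorem integral_pi_norm_sum_sq_le (hm : Measurable f) (hf : MemLp f 2 μ) :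
    ∫ ω, ‖∑ j, f (ω j)‖ ^ 2 ∂(Measure.pi fun _ : Fin M => μ) ≤
      (M : ℝ) ^ 2 * ‖∫ x, f x ∂μ‖ ^ 2 + M * ∫ x, ‖f x‖ ^ 2 ∂μ := by
  have hf1 : Integrable f μ := hf.integrable one_le_two
  have hsq : Integrable (fun x => ‖f x‖ ^ 2) μ := hf.integrable_norm_pow two_ne_zero
  have hI : ∀ i j : Fin M, Integrable (fun ω : Fin M → X => (inner ℝ (f (ω i)) (f (ω j)) : ℝ))
      (Measure.pi fun _ : Fin M => μ) := by
    intro i j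
    have hmi : ∀ k : Fin M, MemLp (fun ω : Fin M → X => f (ω k)) 2
        (Measure.pi fun _ : Fin M => μ) := fun k =>
      hf.comp_measurePreserving (measurePreserving_eval (fun _ : Fin M => μ) k)
    refine ((hmi i).norm.integrable_mul (hmi j).norm).mono
      (((hm.comp (measurable_pi_apply i)).inner
        (hm.comp (measurable_pi_apply j))).aestronglyMeasurable) (Eventually.of_forall ?_)
    intro ω
    simpa using abs_real_inner_le_norm (f (ω i)) (f (ω j))
  have hexp : ∀ ω : Fin M → X, ‖∑ j, f (ω j)‖ ^ 2 =
      ∑ i, ∑ j, (inner ℝ (f (ω i)) (f (ω j)) : ℝ) := by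
    intro ω
    rw [← real_inner_self_eq_norm_sq, sum_inner]
    simp_rw [inner_sum]
  simp_rw [hexp]
  rw [integral_finsetSum _ fun i _ => integrable_finsetSum _ fun j _ => hI i j]
  simp_rw [integral_finsetSum _ fun j _ => hI _ j]
  have hterm : ∀ i j : Fin M, ∫ ω, inner ℝ (f (ω i)) (f (ω j))
      ∂(Measure.pi fun _ : Fin M => μ) ≤
      ‖∫ x, f x ∂μ‖ ^ 2 + if i = j then ∫ x, ‖f x‖ ^ 2 ∂μ else 0 := by
    intro i j
    by_cases hij : i = j
    · subst hij
      simp only [real_inner_self_eq_norm_sq, if_true]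
      have := integral_comp_eval (μ := μ) (f := fun x => ‖f x‖ ^ 2) (by fun_prop) i
      rw [this]
      exact le_add_of_nonneg_left (by positivity)
    · rw [integral_inner_comp_eval hm hf1 hij]; simp [hij]
  calc _ ≤ ∑ i : Fin M, ∑ j : Fin M, (‖∫ x, f x ∂μ‖ ^ 2 +
        if i = j then ∫ x, ‖f x‖ ^ 2 ∂μ else 0) :=
        Finset.sum_le_sum fun i _ => Finset.sum_le_sum fun j _ => hterm i j
    _ = _ := by
        simp [Finset.sum_add_distrib]; ring

end Samples

/-! ### The Markov chain of a policy -/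

namespace RPGProblem

variable {S N : Type*} [MeasurableSpace S] [MeasurableSpace N] {d m : ℕ}
  {P : RPGProblem S N d m} {R : ℝ}

theorem Standing.nonempty_state (hP : P.Standing R) : Nonempty S :=
  have := hP.init_prob
  nonempty_of_isProbabilityMeasure P.init

theorem Standing.nonempty_noise (hP : P.Standing R) : Nonempty N :=
  have := hP.noise_prob
  nonempty_of_isProbabilityMeasure P.noise

theorem Standing.Rmax_nonneg (hP : P.Standing R) : 0 ≤ R := by
  have := hP.markov
  obtain ⟨s⟩ := hP.nonempty_state
  obtain ⟨ε⟩ := hP.nonempty_noise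
  obtain ⟨y, hy⟩ := (hP.reward_bound s _ (hP.policy_mem 0 s ε)).exists
  exact (abs_nonneg _).trans hy

theorem Standing.one_sub_pos (hP : P.Standing R) : 0 < 1 - P.discount :=
  sub_pos.2 hP.discount_lt_one

theorem Standing.isProbabilityMeasure_nextState (hP : P.Standing R) (s : S)
    (a : EuclideanSpace ℝ (Fin m)) : IsProbabilityMeasure (P.nextState s a) :=
  have := hP.markov
  Measure.isProbabilityMeasure_map measurable_fst.aemeasurable

theorem measurable_nextState (P : RPGProblem S N d m) :
    Measurable fun p : S × EuclideanSpace ℝ (Fin m) => P.nextState p.1 p.2 :=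
  (Measure.measurable_map _ measurable_fst).comp P.step.measurable

theorem Standing.measurable_nextState_policy (hP : P.Standing R) :
    Measurable fun p : (EuclideanSpace ℝ (Fin d) × S) × N =>
      P.nextState p.1.2 (P.policy p.1.1 p.1.2 p.2) :=
  P.measurable_nextState.comp ((measurable_snd.comp measurable_fst).prodMk
    (hP.policy_meas.comp (by fun_prop : Measurable
      fun p : (EuclideanSpace ℝ (Fin d) × S) × N => (p.1.1, p.1.2, p.2))))

theorem Standing.measurable_transition_param (hP : P.Standing R) :
    Measurable fun p : EuclideanSpace ℝ (Fin d) × S => P.transition p.1 p.2 :=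
  have := hP.noise_prob
  measurable_bind_param (μ := fun _ => P.noise) measurable_const
    (κ := fun p : (EuclideanSpace ℝ (Fin d) × S) × N =>
      P.nextState p.1.2 (P.policy p.1.1 p.1.2 p.2))
    hP.measurable_nextState_policy

theorem Standing.measurable_transition (hP : P.Standing R) (θ : EuclideanSpace ℝ (Fin d)) :
    Measurable (P.transition θ) := by
  have h : Measurable fun s : S => (θ, s) := measurable_const.prodMk measurable_id
  have h2 := hP.measurable_transition_param.comp h
  exact h2

theorem Standing.measurable_nextState_noise (hP : P.Standing R) (θ : EuclideanSpace ℝ (Fin d))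
    (s : S) : Measurable fun ε => P.nextState s (P.policy θ s ε) :=
  hP.measurable_nextState_policy.comp
    (measurable_const.prodMk measurable_id : Measurable fun ε : N => ((θ, s), ε))

theorem Standing.isProbabilityMeasure_transition (hP : P.Standing R)
    (θ : EuclideanSpace ℝ (Fin d)) (s : S) : IsProbabilityMeasure (P.transition θ s) :=
  have := hP.noise_prob
  isProbabilityMeasure_bind_of_measurable (hP.measurable_nextState_noise θ s)
    fun _ => hP.isProbabilityMeasure_nextState _ _

theorem Standing.integral_transition (hP : P.Standing R) (θ : EuclideanSpace ℝ (Fin d)) (s : S)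
    {g : S → ℝ} {C : ℝ} (hg : Measurable g) (hC : ∀ x, |g x| ≤ C) :
    ∫ x, g x ∂(P.transition θ s) =
      ∫ ε, ∫ x, g x ∂(P.nextState s (P.policy θ s ε)) ∂P.noise := by
  have := hP.noise_prob
  have h := hP.isProbabilityMeasure_transition θ s
  exact integral_bind_of_integrable (hP.measurable_nextState_noise θ s)
    (fun _ => hP.isProbabilityMeasure_nextState _ _)
    (show Integrable g (P.transition θ s) from integrable_of_norm_le hg hC)

theorem Standing.measurable_stateLaw {α : Type*} [MeasurableSpace α] (hP : P.Standing R)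
    {θ : α → EuclideanSpace ℝ (Fin d)} (hθ : Measurable θ) {μ : α → Measure S}
    (hμ : Measurable μ) (h : ∀ a, IsProbabilityMeasure (μ a)) (t : ℕ) :
    (Measurable fun a => P.stateLaw (θ a) (μ a) t) ∧
      ∀ a, IsProbabilityMeasure (P.stateLaw (θ a) (μ a) t) := by
  induction t with
  | zero => exact ⟨hμ, h⟩
  | succ t ih =>
    have := ih.2
    have h1 : Measurable fun p : α × S => (θ p.1, p.2) :=
      (hθ.comp measurable_fst).prodMk measurable_snd
    have h2 := hP.measurable_transition_param.comp h1
    have h3 := measurable_bind_param ih.1 (κ := fun p => P.transition (θ p.1) p.2) h2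
    refine ⟨h3, fun a => isProbabilityMeasure_bind_of_measurable (hP.measurable_transition _)
        (hP.isProbabilityMeasure_transition _)⟩

theorem Standing.isProbabilityMeasure_stateLaw (hP : P.Standing R)
    (θ : EuclideanSpace ℝ (Fin d)) (μ : Measure S) [h : IsProbabilityMeasure μ] (t : ℕ) :
    IsProbabilityMeasure (P.stateLaw θ μ t) :=
  (hP.measurable_stateLaw (α := Unit) (θ := fun _ => θ) (μ := fun _ => μ) measurable_const
    measurable_const (fun _ => h) t).2 ()

theorem Standing.measurable_stateLaw_dirac (hP : P.Standing R) (θ : EuclideanSpace ℝ (Fin d))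
    (t : ℕ) : Measurable fun s => P.stateLaw θ (Measure.dirac s) t :=
  (hP.measurable_stateLaw (θ := fun _ => θ) measurable_const Measure.measurable_dirac
    (fun _ => inferInstance) t).1

theorem stateLaw_bind (θ : EuclideanSpace ℝ (Fin d)) (μ : Measure S) (t : ℕ) :
    P.stateLaw θ (μ.bind (P.transition θ)) t = P.stateLaw θ μ (t + 1) := by
  induction t with
  | zero => rfl
  | succ t ih => rw [stateLaw, ih]; rfl

theorem Standing.stateLaw_eq_bind (hP : P.Standing R) (θ : EuclideanSpace ℝ (Fin d))
    (μ : Measure S) (t : ℕ) :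
    P.stateLaw θ μ t = μ.bind fun s => P.stateLaw θ (Measure.dirac s) t := by
  induction t with
  | zero => exact Measure.bind_dirac.symm
  | succ t ih =>
    rw [stateLaw, ih, Measure.bind_bind (hP.measurable_stateLaw_dirac θ t).aemeasurable
      (hP.measurable_transition θ).aemeasurable]
    rfl

/-! ### Discounted visitation measures -/

theorem visitMeasure_apply (θ : EuclideanSpace ℝ (Fin d)) (μ : Measure S) {B : Set S}
    (hB : MeasurableSet B) :
    P.visitMeasure θ μ B = ∑' t : ℕ, ENNReal.ofReal (P.discount ^ t) * P.stateLaw θ μ t B := by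
  simp [visitMeasure, Measure.sum_apply _ hB]

theorem Standing.measurable_visitMeasure {α : Type*} [MeasurableSpace α] (hP : P.Standing R)
    {θ : α → EuclideanSpace ℝ (Fin d)} (hθ : Measurable θ) {μ : α → Measure S}
    (hμ : Measurable μ) (h : ∀ a, IsProbabilityMeasure (μ a)) :
    Measurable fun a => P.visitMeasure (θ a) (μ a) := by
  refine Measure.measurable_of_measurable_coe _ fun B hB => ?_
  simp_rw [visitMeasure_apply _ _ hB]
  exact Measurable.tsum fun t => ((Measure.measurable_coe hB).comp
    (hP.measurable_stateLaw hθ hμ h t).1).const_mul _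

theorem Standing.visitMeasure_univ (hP : P.Standing R) (θ : EuclideanSpace ℝ (Fin d))
    (μ : Measure S) [IsProbabilityMeasure μ] :
    P.visitMeasure θ μ Set.univ = ENNReal.ofReal (1 - P.discount)⁻¹ := by
  rw [visitMeasure_apply _ _ MeasurableSet.univ]
  have h (t : ℕ) : P.stateLaw θ μ t Set.univ = 1 :=
    (hP.isProbabilityMeasure_stateLaw θ μ t).measure_univ
  simp_rw [h, mul_one]
  rw [← ENNReal.ofReal_tsum_of_nonneg (fun t => pow_nonneg hP.discount_nonneg t)
    (summable_geometric_of_lt_one hP.discount_nonneg hP.discount_lt_one),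
    tsum_geometric_of_lt_one hP.discount_nonneg hP.discount_lt_one]

theorem Standing.isFiniteMeasure_visitMeasure (hP : P.Standing R) (θ : EuclideanSpace ℝ (Fin d))
    (μ : Measure S) [IsProbabilityMeasure μ] : IsFiniteMeasure (P.visitMeasure θ μ) :=
  ⟨by rw [hP.visitMeasure_univ]; exact ENNReal.ofReal_lt_top⟩

theorem Standing.visitMeasure_real_univ (hP : P.Standing R) (θ : EuclideanSpace ℝ (Fin d))
    (μ : Measure S) [IsProbabilityMeasure μ] :
    (P.visitMeasure θ μ).real Set.univ = (1 - P.discount)⁻¹ := by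
  rw [measureReal_def, hP.visitMeasure_univ, ENNReal.toReal_ofReal]
  exact (inv_pos.2 hP.one_sub_pos).le

theorem Standing.abs_integral_visitMeasure_le (hP : P.Standing R)
    (θ : EuclideanSpace ℝ (Fin d)) (μ : Measure S) [IsProbabilityMeasure μ] {g : S → ℝ} {C : ℝ}
    (hC : ∀ x, |g x| ≤ C) : |∫ s, g s ∂(P.visitMeasure θ μ)| ≤ C / (1 - P.discount) := by
  have := hP.isFiniteMeasure_visitMeasure θ μ
  have h := norm_integral_le_of_norm_le_const (μ := P.visitMeasure θ μ) (f := g)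
    (Eventually.of_forall hC)
  rwa [hP.visitMeasure_real_univ, ← div_eq_mul_inv] at h

theorem Standing.ofReal_discount_pow_succ (hP : P.Standing R) (t : ℕ) :
    ENNReal.ofReal (P.discount ^ (t + 1)) =
      ENNReal.ofReal P.discount * ENNReal.ofReal (P.discount ^ t) := by
  rw [pow_succ', ENNReal.ofReal_mul hP.discount_nonneg]

/-- Forward equation `ν = μ + γ ν P_θ` of the discounted visitation measure. -/
theorem Standing.visitMeasure_eq_add_bind (hP : P.Standing R) (θ : EuclideanSpace ℝ (Fin d))
    (μ : Measure S) :
    P.visitMeasure θ μ =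
      μ + ENNReal.ofReal P.discount • (P.visitMeasure θ μ).bind (P.transition θ) := by
  have hm := hP.measurable_transition θ
  ext B hB
  have h0 := tsum_eq_zero_add'
    (f := fun t : ℕ => ENNReal.ofReal (P.discount ^ t) * P.stateLaw θ μ t B) ENNReal.summable
  rw [visitMeasure_apply _ _ hB, h0]
  simp only [Measure.add_apply, Measure.smul_apply, smul_eq_mul, Measure.bind_apply hB
    hm.aemeasurable]
  congr 1
  · simp [stateLaw]
  · simp_rw [visitMeasure, lintegral_sum_measure, lintegral_smul_measure,
      hP.ofReal_discount_pow_succ, stateLaw, Measure.bind_apply hB hm.aemeasurable, smul_eq_mul,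
      ← ENNReal.tsum_mul_left, mul_assoc]

/-- Backward equation: the visitation measure after one step. -/
theorem Standing.visitMeasure_eq_add_visitMeasure (hP : P.Standing R)
    (θ : EuclideanSpace ℝ (Fin d)) (μ : Measure S) :
    P.visitMeasure θ μ =
      μ + ENNReal.ofReal P.discount • P.visitMeasure θ (μ.bind (P.transition θ)) := by
  ext B hB
  have h0 := tsum_eq_zero_add'
    (f := fun t : ℕ => ENNReal.ofReal (P.discount ^ t) * P.stateLaw θ μ t B) ENNReal.summable
  rw [visitMeasure_apply _ _ hB, h0]
  simp only [Measure.add_apply, Measure.smul_apply, smul_eq_mul, visitMeasure_apply _ _ hB]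
  congr 1
  · simp [stateLaw]
  · simp_rw [hP.ofReal_discount_pow_succ, stateLaw_bind, ← ENNReal.tsum_mul_left, mul_assoc]

theorem Standing.visitMeasure_eq_bind (hP : P.Standing R) (θ : EuclideanSpace ℝ (Fin d))
    (μ : Measure S) :
    P.visitMeasure θ μ = μ.bind fun s => P.visitMeasure θ (Measure.dirac s) := by
  have hm := hP.measurable_visitMeasure (θ := fun _ : S => θ) measurable_const
    Measure.measurable_dirac (fun _ => inferInstance)
  ext B hB
  rw [Measure.bind_apply hB hm.aemeasurable, visitMeasure_apply _ _ hB]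
  simp_rw [visitMeasure_apply _ _ hB]
  have h1 (t : ℕ) : Measurable fun s => P.stateLaw θ (Measure.dirac s) t B :=
    (Measure.measurable_coe hB).comp (hP.measurable_stateLaw_dirac θ t)
  rw [lintegral_tsum fun t => ((h1 t).const_mul _).aemeasurable]
  refine tsum_congr fun t => ?_
  rw [lintegral_const_mul _ (h1 t)]
  conv_lhs => rw [hP.stateLaw_eq_bind, Measure.bind_apply hB
    (hP.measurable_stateLaw_dirac θ t).aemeasurable]

/-- The discounted sum `∑ₜ γ^t E[g(sₜ) | s₀ = s]` along the chain of `f_θ`. -/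
noncomputable def resolvent (P : RPGProblem S N d m) (θ : EuclideanSpace ℝ (Fin d)) (g : S → ℝ)
    (s : S) : ℝ :=
  ∫ x, g x ∂(P.visitMeasure θ (Measure.dirac s))

section Resolvent

variable {θ : EuclideanSpace ℝ (Fin d)} {g : S → ℝ} {C : ℝ}

theorem Standing.abs_resolvent_le (hP : P.Standing R) (hC : ∀ x, |g x| ≤ C) (s : S) :
    |P.resolvent θ g s| ≤ C / (1 - P.discount) :=
  hP.abs_integral_visitMeasure_le θ _ hC

/-- The visitation measures as a kernel in the initial state. -/
noncomputable def visitKernel (hP : P.Standing R) (θ : EuclideanSpace ℝ (Fin d)) : Kernel S S :=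
  ⟨fun s => P.visitMeasure θ (Measure.dirac s), hP.measurable_visitMeasure (θ := fun _ : S => θ)
    measurable_const Measure.measurable_dirac (fun _ => inferInstance)⟩

theorem isFiniteKernel_visitKernel (hP : P.Standing R) (θ : EuclideanSpace ℝ (Fin d)) :
    IsFiniteKernel (visitKernel hP θ) :=
  ⟨ENNReal.ofReal (1 - P.discount)⁻¹, ENNReal.ofReal_lt_top,
    fun _ => (hP.visitMeasure_univ θ _).le⟩

theorem Standing.measurable_resolvent (hP : P.Standing R) (hg : Measurable g) :
    Measurable (P.resolvent θ g) := by
  have := isFiniteKernel_visitKernel hP θ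
  exact ((hg.comp measurable_snd).stronglyMeasurable.integral_kernel_prod_right'
    (κ := visitKernel hP θ)).measurable

theorem Standing.integral_resolvent (hP : P.Standing R) (hg : Measurable g)
    (hC : ∀ x, |g x| ≤ C) (μ : Measure S) [IsProbabilityMeasure μ] :
    ∫ s, P.resolvent θ g s ∂μ = ∫ s, g s ∂(P.visitMeasure θ μ) := by
  have := isFiniteKernel_visitKernel hP θ
  have := hP.isFiniteMeasure_visitMeasure θ μ
  have hb : P.visitMeasure θ μ = μ.bind (visitKernel hP θ) := hP.visitMeasure_eq_bind θ μ
  rw [hb, integral_bind_kernel]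
  · rfl
  · rw [← hb]; exact integrable_of_norm_le hg hC

/-- The forward equation `ν = μ + γ ν P_θ`, tested against a bounded function. -/
theorem Standing.integral_visitMeasure_step (hP : P.Standing R) (hg : Measurable g)
    (hC : ∀ x, |g x| ≤ C) (μ : Measure S) [IsProbabilityMeasure μ] :
    ∫ s, g s ∂(P.visitMeasure θ μ) =
      ∫ s, g s ∂μ + P.discount * ∫ s, ∫ x, g x ∂(P.transition θ s) ∂(P.visitMeasure θ μ) := by
  have h1 := hP.isFiniteMeasure_visitMeasure θ μ
  have hm := hP.measurable_transition θ
  have hp := hP.isProbabilityMeasure_transition θ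
  let k : Kernel S S := ⟨P.transition θ, hm⟩
  have hk : IsMarkovKernel k := ⟨hp⟩
  have hfin : IsFiniteMeasure ((P.visitMeasure θ μ).bind (P.transition θ)) :=
    inferInstanceAs (IsFiniteMeasure ((P.visitMeasure θ μ).bind k))
  have hi : Integrable g ((P.visitMeasure θ μ).bind (P.transition θ)) :=
    integrable_of_norm_le hg hC
  conv_lhs => rw [hP.visitMeasure_eq_add_bind θ μ]
  rw [integral_add_measure (integrable_of_norm_le hg hC)
      (hi.smul_measure ENNReal.ofReal_ne_top), integral_smul_measure,
    ENNReal.toReal_ofReal hP.discount_nonneg, integral_bind_of_integrable hm hp hi, smul_eq_mul]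

/-- Bellman equation `U = g + γ P_θ U` of the resolvent. -/
theorem Standing.resolvent_eq (hP : P.Standing R) (hg : Measurable g) (hC : ∀ x, |g x| ≤ C)
    (s : S) :
    P.resolvent θ g s = g s + P.discount * ∫ x, P.resolvent θ g x ∂(P.transition θ s) := by
  have hp := hP.isProbabilityMeasure_transition θ s
  have h1 := hP.isFiniteMeasure_visitMeasure θ (P.transition θ s)
  have hi : Integrable g (P.visitMeasure θ (P.transition θ s)) := integrable_of_norm_le hg hC
  rw [hP.integral_resolvent hg hC, resolvent, hP.visitMeasure_eq_add_visitMeasure,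
    Measure.dirac_bind (hP.measurable_transition θ),
    integral_add_measure (integrable_of_norm_le hg hC) (hi.smul_measure ENNReal.ofReal_ne_top),
    integral_smul_measure, ENNReal.toReal_ofReal hP.discount_nonneg,
    integral_dirac' _ _ hg.stronglyMeasurable, smul_eq_mul]

end Resolvent

theorem Standing.measurable_integral_transition (hP : P.Standing R)
    (θ : EuclideanSpace ℝ (Fin d)) {g : S → ℝ} (hg : Measurable g) :
    Measurable fun s => ∫ x, g x ∂(P.transition θ s) :=
  measurable_integral_param (hP.measurable_transition θ) (hP.isProbabilityMeasure_transition θ)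
    (hg.comp measurable_snd)

theorem Standing.abs_integral_transition_le (hP : P.Standing R)
    (θ : EuclideanSpace ℝ (Fin d)) {g : S → ℝ} {C : ℝ} (hC : ∀ x, |g x| ≤ C) (s : S) :
    |∫ x, g x ∂(P.transition θ s)| ≤ C :=
  have := hP.isProbabilityMeasure_transition θ s
  norm_integral_le_of_norm_le_prob (f := g) hC

end RPGProblem

/-! ### Value functions and performance difference -/

namespace RPGProblem

variable {S N : Type*} [MeasurableSpace S] [MeasurableSpace N] {d m : ℕ}
  {P : RPGProblem S N d m} {R : ℝ}

theorem Standing.measurable_reward (hP : P.Standing R) :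
    Measurable fun p : S × EuclideanSpace ℝ (Fin m) => P.reward p.1 p.2 :=
  have := hP.markov
  measurable_integral_param P.step.measurable (fun _ => inferInstance)
    (f := fun p : (S × EuclideanSpace ℝ (Fin m)) × S × ℝ => p.2.2) (by fun_prop)

theorem Standing.abs_reward_le (hP : P.Standing R) (s : S) {a : EuclideanSpace ℝ (Fin m)}
    (ha : a ∈ P.actions) : |P.reward s a| ≤ R := by
  have := hP.markov
  have h := norm_integral_le_of_norm_le_const (μ := P.step (s, a)) (f := fun y : S × ℝ => y.2)
    (hP.reward_bound s a ha)
  rwa [probReal_univ, mul_one] at h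

theorem Standing.measurable_policy_prod (hP : P.Standing R) (θ : EuclideanSpace ℝ (Fin d)) :
    Measurable fun p : S × N => P.policy θ p.1 p.2 := by
  have h : Measurable fun p : S × N => (θ, p.1, p.2) := by fun_prop
  exact hP.policy_meas.comp h

theorem Standing.measurable_policy_noise (hP : P.Standing R) (θ : EuclideanSpace ℝ (Fin d))
    (s : S) : Measurable fun ε => P.policy θ s ε := by
  have h : Measurable fun ε : N => (θ, s, ε) := by fun_prop
  exact hP.policy_meas.comp h

theorem Standing.measurable_integral_noise (hP : P.Standing R) {g : S × N → ℝ}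
    (hg : Measurable g) : Measurable fun s => ∫ ε, g (s, ε) ∂P.noise :=
  have := hP.noise_prob
  measurable_integral_param (κ := fun _ : S => P.noise) measurable_const
    (fun _ => inferInstance) hg

/-- The mean reward `E_ε r(s, f_θ(s, ε))` of the policy. -/
noncomputable def rewardMean (P : RPGProblem S N d m) (θ : EuclideanSpace ℝ (Fin d)) (s : S) :
    ℝ :=
  ∫ ε, P.reward s (P.policy θ s ε) ∂P.noise

theorem Standing.measurable_reward_policy (hP : P.Standing R) (θ : EuclideanSpace ℝ (Fin d)) :
    Measurable fun p : S × N => P.reward p.1 (P.policy θ p.1 p.2) :=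
  hP.measurable_reward.comp (measurable_fst.prodMk (hP.measurable_policy_prod θ))

theorem Standing.measurable_rewardMean (hP : P.Standing R) (θ : EuclideanSpace ℝ (Fin d)) :
    Measurable (P.rewardMean θ) :=
  hP.measurable_integral_noise (hP.measurable_reward_policy θ)

theorem Standing.abs_rewardMean_le (hP : P.Standing R) (θ : EuclideanSpace ℝ (Fin d)) (s : S) :
    |P.rewardMean θ s| ≤ R :=
  have := hP.noise_prob
  norm_integral_le_of_norm_le_prob (f := fun ε => P.reward s (P.policy θ s ε))
    fun ε => hP.abs_reward_le s (hP.policy_mem θ s ε)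

/-- An integral over the countable sum of measures defining the visitation measure is the
discounted sum that defines the value function. -/
theorem Standing.value_eq_resolvent (hP : P.Standing R) (θ : EuclideanSpace ℝ (Fin d)) :
    P.value θ = P.resolvent θ (P.rewardMean θ) := by
  funext s
  have h1 := hP.isFiniteMeasure_visitMeasure θ (Measure.dirac s)
  have hi : Integrable (P.rewardMean θ) (P.visitMeasure θ (Measure.dirac s)) :=
    integrable_of_norm_le (hP.measurable_rewardMean θ) (hP.abs_rewardMean_le θ)
  have h2 := hasSum_integral_measure (f := P.rewardMean θ)
    (μ := fun t : ℕ => ENNReal.ofReal (P.discount ^ t) • P.stateLaw θ (Measure.dirac s) t) hi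
  have h3 := h2.tsum_eq
  simp_rw [integral_smul_measure, ENNReal.toReal_ofReal (pow_nonneg hP.discount_nonneg _),
    smul_eq_mul] at h3
  exact h3

theorem Standing.measurable_value (hP : P.Standing R) (θ : EuclideanSpace ℝ (Fin d)) :
    Measurable (P.value θ) := by
  rw [hP.value_eq_resolvent]; exact hP.measurable_resolvent (hP.measurable_rewardMean θ)

theorem Standing.abs_value_le (hP : P.Standing R) (θ : EuclideanSpace ℝ (Fin d)) (s : S) :
    |P.value θ s| ≤ R / (1 - P.discount) := by
  rw [hP.value_eq_resolvent]; exact hP.abs_resolvent_le (hP.abs_rewardMean_le θ) s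

theorem Standing.integral_value (hP : P.Standing R) (θ : EuclideanSpace ℝ (Fin d))
    (μ : Measure S) [IsProbabilityMeasure μ] :
    ∫ s, P.value θ s ∂μ = ∫ s, P.rewardMean θ s ∂(P.visitMeasure θ μ) := by
  rw [hP.value_eq_resolvent]
  exact hP.integral_resolvent (hP.measurable_rewardMean θ) (hP.abs_rewardMean_le θ) μ

theorem Standing.value_bellman (hP : P.Standing R) (θ : EuclideanSpace ℝ (Fin d)) (s : S) :
    P.value θ s = P.rewardMean θ s + P.discount * ∫ x, P.value θ x ∂(P.transition θ s) := by
  rw [hP.value_eq_resolvent]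
  exact hP.resolvent_eq (hP.measurable_rewardMean θ) (hP.abs_rewardMean_le θ) s

theorem Standing.measurable_integral_nextState (hP : P.Standing R) {g : S → ℝ}
    (hg : Measurable g) :
    Measurable fun p : S × EuclideanSpace ℝ (Fin m) => ∫ x, g x ∂(P.nextState p.1 p.2) :=
  measurable_integral_param P.measurable_nextState
    (fun _ => hP.isProbabilityMeasure_nextState _ _) (hg.comp measurable_snd)

theorem Standing.abs_integral_nextState_le (hP : P.Standing R) {g : S → ℝ} {C : ℝ}
    (hC : ∀ x, |g x| ≤ C) (s : S) (a : EuclideanSpace ℝ (Fin m)) :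
    |∫ x, g x ∂(P.nextState s a)| ≤ C :=
  have := hP.isProbabilityMeasure_nextState s a
  norm_integral_le_of_norm_le_prob (f := g) hC

theorem Standing.measurable_qValue (hP : P.Standing R) (θ : EuclideanSpace ℝ (Fin d)) :
    Measurable fun p : S × EuclideanSpace ℝ (Fin m) => P.qValue θ p.1 p.2 :=
  hP.measurable_reward.add
    ((hP.measurable_integral_nextState (hP.measurable_value θ)).const_mul _)

theorem Standing.measurable_qValue_policy (hP : P.Standing R) (θ θ' : EuclideanSpace ℝ (Fin d)) :
    Measurable fun p : S × N => P.qValue θ p.1 (P.policy θ' p.1 p.2) :=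
  (hP.measurable_qValue θ).comp (measurable_fst.prodMk (hP.measurable_policy_prod θ'))

theorem Standing.abs_qValue_le (hP : P.Standing R) (θ : EuclideanSpace ℝ (Fin d)) (s : S)
    {a : EuclideanSpace ℝ (Fin m)} (ha : a ∈ P.actions) :
    |P.qValue θ s a| ≤ R + P.discount * (R / (1 - P.discount)) := by
  refine (abs_add_le _ _).trans (add_le_add (hP.abs_reward_le s ha) ?_)
  rw [abs_mul, abs_of_nonneg hP.discount_nonneg]
  exact mul_le_mul_of_nonneg_left (hP.abs_integral_nextState_le (hP.abs_value_le θ) s a)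
    hP.discount_nonneg

theorem Standing.integral_qValue_policy (hP : P.Standing R) (θ θ' : EuclideanSpace ℝ (Fin d))
    (s : S) :
    ∫ ε, P.qValue θ s (P.policy θ' s ε) ∂P.noise =
      P.rewardMean θ' s + P.discount * ∫ x, P.value θ x ∂(P.transition θ' s) := by
  have := hP.noise_prob
  have hm : Measurable fun ε : N => (s, ε) := measurable_prodMk_left
  have hm2 : Measurable fun ε : N => (s, P.policy θ' s ε) :=
    measurable_const.prodMk (hP.measurable_policy_noise θ' s)
  have i1 : Integrable (fun ε => P.reward s (P.policy θ' s ε)) P.noise :=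
    integrable_of_norm_le ((hP.measurable_reward_policy θ').comp hm)
      fun ε => hP.abs_reward_le s (hP.policy_mem θ' s ε)
  have i2 : Integrable (fun ε => ∫ x, P.value θ x ∂(P.nextState s (P.policy θ' s ε))) P.noise :=
    integrable_of_norm_le ((hP.measurable_integral_nextState (hP.measurable_value θ)).comp hm2)
      fun ε => hP.abs_integral_nextState_le (hP.abs_value_le θ) s _
  rw [hP.integral_transition θ' s (hP.measurable_value θ) (hP.abs_value_le θ), rewardMean,
    ← integral_const_mul, ← integral_add i1 (i2.const_mul _)]
  rfl

theorem Standing.value_eq_integral_qValue (hP : P.Standing R) (θ : EuclideanSpace ℝ (Fin d))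
    (s : S) : P.value θ s = ∫ ε, P.qValue θ s (P.policy θ s ε) ∂P.noise := by
  rw [hP.integral_qValue_policy, ← hP.value_bellman]

theorem Standing.integrable_qValue_policy (hP : P.Standing R) (θ θ' : EuclideanSpace ℝ (Fin d))
    (s : S) : Integrable (fun ε => P.qValue θ s (P.policy θ' s ε)) P.noise :=
  have := hP.noise_prob
  have hm : Measurable fun ε : N => (s, ε) := measurable_prodMk_left
  integrable_of_norm_le ((hP.measurable_qValue_policy θ θ').comp hm)
    fun ε => hP.abs_qValue_le θ s (hP.policy_mem θ' s ε)

/-- Performance difference: the change of the value is the mean advantage of the new policy over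
the old one along the visitation measure of the new policy. -/
theorem Standing.performance_difference (hP : P.Standing R) (θ θ' : EuclideanSpace ℝ (Fin d))
    (μ : Measure S) [IsProbabilityMeasure μ] :
    ∫ s, P.value θ' s ∂μ - ∫ s, P.value θ s ∂μ =
      ∫ s, ∫ ε, (P.qValue θ s (P.policy θ' s ε) - P.qValue θ s (P.policy θ s ε)) ∂P.noise
        ∂(P.visitMeasure θ' μ) := by
  have h1 := hP.isFiniteMeasure_visitMeasure θ' μ
  have hin : ∀ s, ∫ ε, (P.qValue θ s (P.policy θ' s ε) - P.qValue θ s (P.policy θ s ε)) ∂P.noise =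
      P.rewardMean θ' s + P.discount * ∫ x, P.value θ x ∂(P.transition θ' s) - P.value θ s := by
    intro s
    rw [integral_sub (hP.integrable_qValue_policy θ θ' s) (hP.integrable_qValue_policy θ θ s),
      ← hP.value_eq_integral_qValue, hP.integral_qValue_policy]
  have i1 : Integrable (P.rewardMean θ') (P.visitMeasure θ' μ) :=
    integrable_of_norm_le (hP.measurable_rewardMean θ') (hP.abs_rewardMean_le θ')
  have i2 : Integrable (fun s => ∫ x, P.value θ x ∂(P.transition θ' s)) (P.visitMeasure θ' μ) :=
    integrable_of_norm_le (hP.measurable_integral_transition θ' (hP.measurable_value θ))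
      (hP.abs_integral_transition_le θ' (hP.abs_value_le θ))
  have i3 : Integrable (P.value θ) (P.visitMeasure θ' μ) :=
    integrable_of_norm_le (hP.measurable_value θ) (hP.abs_value_le θ)
  have i4 : Integrable (fun s => P.rewardMean θ' s +
      P.discount * ∫ x, P.value θ x ∂(P.transition θ' s)) (P.visitMeasure θ' μ) :=
    i1.add (i2.const_mul _)
  simp_rw [hin]
  rw [integral_sub i4 i3, integral_add i1 (i2.const_mul _),
    integral_const_mul, hP.integral_value θ' μ,
    hP.integral_visitMeasure_step (hP.measurable_value θ) (hP.abs_value_le θ) μ]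
  ring

/-! ### Sensitivity of the visitation measures -/

theorem Standing.tvNorm_transition_le_two (hP : P.Standing R) (θ₁ θ₂ : EuclideanSpace ℝ (Fin d))
    (s : S) : tvNorm (P.transition θ₁ s) (P.transition θ₂ s) ≤ 2 := by
  refine tvNorm_le fun g _ hC => ?_
  have h1 := hP.abs_integral_transition_le θ₁ hC s
  have h2 := hP.abs_integral_transition_le θ₂ hC s
  exact (abs_sub _ _).trans (by linarith)

theorem Standing.bddAbove_tvNorm_transition (hP : P.Standing R)
    (θ₁ θ₂ : EuclideanSpace ℝ (Fin d)) :
    BddAbove (Set.range fun s => tvNorm (P.transition θ₁ s) (P.transition θ₂ s) / 2) := by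
  refine ⟨1, ?_⟩
  rintro _ ⟨s, rfl⟩
  have := hP.tvNorm_transition_le_two θ₁ θ₂ s
  simp only; linarith

/-- Write `νᵢ` and `Pᵢ` for the visitation measure and the transition kernel of `θᵢ`. If `U` is the
resolvent of `g` for `θ₂`, then `∫ g dν₁ - ∫ g dν₂ = γ ∫ (P₁ - P₂) U dν₁`, and `|U| ≤ 1 / (1 - γ)`
when `|g| ≤ 1`. -/
theorem Standing.exists_isVisitationConstant (hP : P.Standing R) :
    ∃ Cν, 1 < Cν ∧ P.IsVisitationConstant Cν := by
  have hγ := hP.one_sub_pos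
  have hγ0 := hP.discount_nonneg
  refine ⟨2 + 2 * P.discount / (1 - P.discount) ^ 2, ?_, ?_⟩
  · have : 0 ≤ 2 * P.discount / (1 - P.discount) ^ 2 := by positivity
    linarith
  intro μ hμ θ₁ θ₂
  set D := ⨆ s, tvNorm (P.transition θ₁ s) (P.transition θ₂ s) / 2 with hD
  have hD0 : 0 ≤ D := Real.iSup_nonneg fun s => div_nonneg tvNorm_nonneg two_pos.le
  refine tvNorm_le fun g hg hC => ?_
  have h1 := hP.isFiniteMeasure_visitMeasure θ₁ μ
  set U := P.resolvent θ₂ g with hU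
  have hUm : Measurable U := hP.measurable_resolvent hg
  have hUb : ∀ s, |U s| ≤ 1 / (1 - P.discount) := hP.abs_resolvent_le hC
  have m1 := hP.measurable_integral_transition θ₁ hUm
  have m2 := hP.measurable_integral_transition θ₂ hUm
  have i1 : Integrable (fun s => ∫ x, U x ∂(P.transition θ₁ s)) (P.visitMeasure θ₁ μ) :=
    integrable_of_norm_le m1 (hP.abs_integral_transition_le θ₁ hUb)
  have i2 : Integrable (fun s => ∫ x, U x ∂(P.transition θ₂ s)) (P.visitMeasure θ₁ μ) :=
    integrable_of_norm_le m2 (hP.abs_integral_transition_le θ₂ hUb)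
  have i3 : Integrable g (P.visitMeasure θ₁ μ) := integrable_of_norm_le hg hC
  have e1 : ∫ s, g s ∂(P.visitMeasure θ₂ μ) = ∫ s, U s ∂μ :=
    (hP.integral_resolvent hg hC μ).symm
  have e2 := hP.integral_visitMeasure_step (θ := θ₁) hUm hUb μ
  have e3 : ∫ s, U s ∂(P.visitMeasure θ₁ μ) = ∫ s, g s ∂(P.visitMeasure θ₁ μ) +
      P.discount * ∫ s, ∫ x, U x ∂(P.transition θ₂ s) ∂(P.visitMeasure θ₁ μ) := by
    rw [← integral_const_mul, ← integral_add i3 (i2.const_mul _)]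
    exact integral_congr_ae (Eventually.of_forall fun s => hP.resolvent_eq hg hC s)
  have e4 : ∫ s, g s ∂(P.visitMeasure θ₁ μ) - ∫ s, g s ∂(P.visitMeasure θ₂ μ) =
      P.discount * ∫ s, (∫ x, U x ∂(P.transition θ₁ s) - ∫ x, U x ∂(P.transition θ₂ s))
        ∂(P.visitMeasure θ₁ μ) := by
    rw [integral_sub i1 i2, e1]; linarith
  have hb : ∀ s, |∫ x, U x ∂(P.transition θ₁ s) - ∫ x, U x ∂(P.transition θ₂ s)| ≤
      2 * D / (1 - P.discount) := by
    intro s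
    have p1 := hP.isProbabilityMeasure_transition θ₁ s
    have p2 := hP.isProbabilityMeasure_transition θ₂ s
    have hs := le_ciSup (hP.bddAbove_tvNorm_transition θ₁ θ₂) s
    refine (abs_integral_sub_le_tvNorm hUm hUb (by positivity)).trans ?_
    rw [div_mul_eq_mul_div, one_mul]
    exact div_le_div_of_nonneg_right (by linarith) hγ.le
  rw [e4, abs_mul, abs_of_nonneg hγ0]
  calc P.discount * _ ≤ P.discount * (2 * D / (1 - P.discount) / (1 - P.discount)) :=
        mul_le_mul_of_nonneg_left (hP.abs_integral_visitMeasure_le θ₁ μ hb) hγ0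
    _ = 2 * P.discount / (1 - P.discount) ^ 2 * D := by field_simp
    _ ≤ _ := by nlinarith

end RPGProblem

/-! ### Derivatives: measurability and quadratic remainders -/

section Calculus

variable {V W : Type*} [NormedAddCommGroup V] [InnerProductSpace ℝ V] [FiniteDimensional ℝ V]
  [MeasurableSpace V] [BorelSpace V] [NormedAddCommGroup W] [InnerProductSpace ℝ W]
  [FiniteDimensional ℝ W] [MeasurableSpace W] [BorelSpace W]

theorem secondCountable_clm : SecondCountableTopology (V →L[ℝ] W) :=
  have := FiniteDimensional.proper_real (V →L[ℝ] W)
  inferInstance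

/-- Measurability with respect to the operator norm can be checked coordinatewise, since the domain
is finite-dimensional. -/
theorem measurable_clm_of_apply {α : Type*} [MeasurableSpace α] {T : α → V →L[ℝ] W}
    (h : ∀ v, Measurable fun a => T a v) : Measurable T := by
  have := FiniteDimensional.proper_real (V →L[ℝ] W)
  have := FiniteDimensional.proper_real V
  let b := stdOrthonormalBasis ℝ V
  have hT : T = fun a => ∑ i,
      ContinuousLinearMap.smulRightL ℝ V W (innerSL ℝ (b i)) (T a (b i)) := by
    funext a
    ext v
    conv_lhs => rw [← b.sum_repr' v]
    simp [map_sum]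
  rw [hT]
  exact Finset.measurable_fun_sum _ fun i _ =>
    (ContinuousLinearMap.smulRightL ℝ V W (innerSL ℝ (b i))).continuous.measurable.comp (h _)

theorem measurable_apply_of_apply {α : Type*} [MeasurableSpace α] {T : α → V →L[ℝ] W} {v : α → V}
    (h : ∀ u, Measurable fun a => T a u) (hv : Measurable v) : Measurable fun a => T a (v a) := by
  have := FiniteDimensional.proper_real V
  have := FiniteDimensional.proper_real W
  let b := stdOrthonormalBasis ℝ V
  have hT : (fun a => T a (v a)) = fun a => ∑ i, (inner ℝ (b i) (v a) : ℝ) • T a (b i) := by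
    funext a
    conv_lhs => rw [← b.sum_repr' (v a)]
    simp [map_sum]
  rw [hT]
  exact Finset.measurable_fun_sum _ fun i _ => (hv.const_inner (c := b i)).smul (h _)

theorem measurable_of_inner {α : Type*} [MeasurableSpace α] {g : α → V}
    (h : ∀ v, Measurable fun a => (inner ℝ v (g a) : ℝ)) : Measurable g := by
  have := FiniteDimensional.proper_real V
  let b := stdOrthonormalBasis ℝ V
  have hg : g = fun a => ∑ i, (inner ℝ (b i) (g a) : ℝ) • b i := by
    funext a
    exact (b.sum_repr' (g a)).symm
  rw [hg]
  exact Finset.measurable_fun_sum _ fun i _ => (h _).smul_const _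

/-- Derivatives are limits of sequences of difference quotients, hence measurable in parameters. -/
theorem tendsto_difference_quotient {f : V → W} {x : V} {f' : V →L[ℝ] W} (h : HasFDerivAt f f' x)
    (v : V) :
    Tendsto (fun n : ℕ => (n : ℝ) • (f (x + (n : ℝ)⁻¹ • v) - f x)) atTop (𝓝 (f' v)) :=
  h.lim v (by simpa using tendsto_natCast_atTop_atTop)

/-- No differentiability is needed: elsewhere `gradient` has the value `0`. -/
theorem norm_gradient_le {f : V → ℝ} {U : Set V} (hU : IsOpen U) {a : V} (ha : a ∈ U) {C : ℝ}
    (hC : 0 ≤ C) (h : ∀ x ∈ U, |f x - f a| ≤ C * ‖x - a‖) : ‖gradient f a‖ ≤ C := by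
  rw [gradient, LinearIsometryEquiv.norm_map]
  refine norm_fderiv_le_of_lip' ℝ hC ?_
  filter_upwards [hU.mem_nhds ha] with x hx using h x hx

/-- The mean value inequality for `f - ⟪g x, ·⟫` on a ball. Only the variation of the gradient from
the base point `x` is needed; the factor `1 / 2` that integration along the segment would give is
not claimed. -/
theorem abs_quadratic_remainder_le {f : V → ℝ} {g : V → V} {x : V} {L : ℝ}
    (hf : ∀ z, HasGradientAt f (g z) z) (hL : ∀ z, ‖g z - g x‖ ≤ L * ‖z - x‖) (y : V) (h0 : 0 ≤ L) :
    |f y - f x - inner ℝ (g x) (y - x)| ≤ L * ‖y - x‖ ^ 2 := by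
  have hd : ∀ z ∈ Metric.closedBall x ‖y - x‖, HasFDerivWithinAt
      (fun z => f z - inner ℝ (g x) z)
      (InnerProductSpace.toDual ℝ V (g z) - innerSL ℝ (g x)) (Metric.closedBall x ‖y - x‖) z := by
    intro z _
    exact ((hf z).hasFDerivAt.sub (innerSL ℝ (g x)).hasFDerivAt).hasFDerivWithinAt
  have hb : ∀ z ∈ Metric.closedBall x ‖y - x‖,
      ‖InnerProductSpace.toDual ℝ V (g z) - innerSL ℝ (g x)‖ ≤ L * ‖y - x‖ := by
    intro z hz
    have : InnerProductSpace.toDual ℝ V (g z) - innerSL ℝ (g x) =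
        InnerProductSpace.toDual ℝ V (g z - g x) := by
      ext w; simp
    rw [this, LinearIsometryEquiv.norm_map]
    refine (hL z).trans (mul_le_mul_of_nonneg_left ?_ h0)
    simpa [dist_eq_norm] using hz
  have key := (convex_closedBall x ‖y - x‖).norm_image_sub_le_of_norm_hasFDerivWithin_le hd hb
    (Metric.mem_closedBall_self (norm_nonneg _)) (by simp [dist_eq_norm] : y ∈ _)
  rw [Real.norm_eq_abs] at key
  rw [inner_sub_right, sq, ← mul_assoc]
  convert key using 2
  ring

end Calculus

namespace RPGProblem

variable {S N : Type*} [MeasurableSpace S] [MeasurableSpace N] {d m : ℕ}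
  {P : RPGProblem S N d m} {K : RPGConstants}

/-! ### The policy and its Jacobian -/

theorem Standing.measurable_jac_apply {R : ℝ} (hP : P.Standing R) (v : EuclideanSpace ℝ (Fin d)) :
    Measurable fun p : EuclideanSpace ℝ (Fin d) × S × N => P.jac p.1 p.2.1 p.2.2 v := by
  have hm : ∀ n : ℕ, Measurable fun p : EuclideanSpace ℝ (Fin d) × S × N =>
      (n : ℝ) • (P.policy (p.1 + (n : ℝ)⁻¹ • v) p.2.1 p.2.2 - P.policy p.1 p.2.1 p.2.2) := by
    intro n
    have h1 : Measurable fun p : EuclideanSpace ℝ (Fin d) × S × N =>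
        (p.1 + (n : ℝ)⁻¹ • v, p.2.1, p.2.2) := by fun_prop
    have h2 := hP.policy_meas.comp h1
    exact (h2.sub hP.policy_meas).const_smul (n : ℝ)
  refine measurable_of_tendsto_metrizable hm (tendsto_pi_nhds.2 fun p => ?_)
  exact tendsto_difference_quotient (hP.policy_diff p.2.1 p.2.2 p.1).hasFDerivAt v

theorem PolicyAssumption.norm_jac_le (h : P.PolicyAssumption K)
    (θ : EuclideanSpace ℝ (Fin d)) (s : S) (ε : N) : ‖P.jac θ s ε‖ ≤ K.Lf :=
  norm_fderiv_le_of_lip' ℝ h.Lf_pos.le (Eventually.of_forall fun θ' => h.lipschitz θ' θ s ε)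

theorem PolicyAssumption.norm_gradPolicy_le (h : P.PolicyAssumption K)
    (θ : EuclideanSpace ℝ (Fin d)) (s : S) (ε : N) : ‖P.gradPolicy θ s ε‖ ≤ K.Lf := by
  rw [gradPolicy, LinearIsometryEquiv.norm_map]; exact h.norm_jac_le θ s ε

theorem PolicyAssumption.norm_jac_sub_le (h : P.PolicyAssumption K)
    (θ₁ θ₂ : EuclideanSpace ℝ (Fin d)) (s : S) (ε : N) :
    ‖P.jac θ₁ s ε - P.jac θ₂ s ε‖ ≤ K.Lpsi * ‖θ₁ - θ₂‖ := by
  have := h.smooth θ₁ θ₂ s ε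
  rwa [gradPolicy, gradPolicy, ← map_sub, LinearIsometryEquiv.norm_map] at this

/-! ### Lipschitz bounds for values and visitation measures -/

section Lipschitz

variable (hP : P.Standing K.Rmax) (hpolicy : P.PolicyAssumption K)
  (henv : P.EnvironmentAssumption K)

include hP hpolicy henv

theorem tvNorm_transition_le (θ₁ θ₂ : EuclideanSpace ℝ (Fin d)) (s : S) :
    tvNorm (P.transition θ₁ s) (P.transition θ₂ s) ≤ K.LP * K.Lf * ‖θ₁ - θ₂‖ := by
  have := hP.noise_prob
  refine tvNorm_le fun g hg hC => ?_
  have hm : ∀ θ : EuclideanSpace ℝ (Fin d), Measurable fun ε => (s, P.policy θ s ε) := fun θ =>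
    measurable_const.prodMk (hP.measurable_policy_noise θ s)
  have hi : ∀ θ, Integrable (fun ε => ∫ x, g x ∂(P.nextState s (P.policy θ s ε))) P.noise :=
    fun θ => integrable_of_norm_le ((hP.measurable_integral_nextState hg).comp (hm θ))
      fun ε => hP.abs_integral_nextState_le hC s _
  rw [hP.integral_transition θ₁ s hg hC, hP.integral_transition θ₂ s hg hC,
    ← integral_sub (hi θ₁) (hi θ₂)]
  rw [← Real.norm_eq_abs]
  refine norm_integral_le_of_norm_le_prob (fun ε => ?_)
  rw [Real.norm_eq_abs]
  have p1 := hP.isProbabilityMeasure_nextState s (P.policy θ₁ s ε)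
  have p2 := hP.isProbabilityMeasure_nextState s (P.policy θ₂ s ε)
  refine (abs_integral_sub_le_tvNorm hg hC zero_le_one).trans ?_
  rw [one_mul, mul_assoc]
  exact (henv.transition_lipschitz s _ (hP.policy_mem θ₁ s ε) _ (hP.policy_mem θ₂ s ε)).trans
    (mul_le_mul_of_nonneg_left (hpolicy.lipschitz θ₁ θ₂ s ε) henv.LP_pos.le)

theorem tvNorm_visitMeasure_le {Cν : ℝ} (h0 : 0 ≤ Cν) (hν : P.IsVisitationConstant Cν)
    (μ : Measure S) [hμ : IsProbabilityMeasure μ] (θ₁ θ₂ : EuclideanSpace ℝ (Fin d)) :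
    tvNorm (P.visitMeasure θ₁ μ) (P.visitMeasure θ₂ μ) ≤ K.Lnu Cν * ‖θ₁ - θ₂‖ := by
  have := hP.nonempty_state
  refine (hν μ hμ θ₁ θ₂).trans ?_
  have : ⨆ s, tvNorm (P.transition θ₁ s) (P.transition θ₂ s) / 2 ≤
      K.LP * K.Lf * ‖θ₁ - θ₂‖ / 2 :=
    ciSup_le fun s => div_le_div_of_nonneg_right (tvNorm_transition_le hP hpolicy henv θ₁ θ₂ s)
      two_pos.le
  calc _ ≤ Cν * (K.LP * K.Lf * ‖θ₁ - θ₂‖ / 2) := mul_le_mul_of_nonneg_left this h0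
    _ = _ := by rw [RPGConstants.Lnu]; ring

theorem Lnu_nonneg {Cν : ℝ} (h0 : 0 ≤ Cν) : 0 ≤ K.Lnu Cν := by
  have h1 := hpolicy.Lf_pos; have h2 := henv.LP_pos
  rw [RPGConstants.Lnu]; positivity

theorem abs_rewardMean_sub_le (θ₁ θ₂ : EuclideanSpace ℝ (Fin d)) (s : S) :
    |P.rewardMean θ₁ s - P.rewardMean θ₂ s| ≤ K.Lr * K.Lf * ‖θ₁ - θ₂‖ := by
  have := hP.noise_prob
  have hm : Measurable fun ε : N => (s, ε) := measurable_prodMk_left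
  have hi : ∀ θ, Integrable (fun ε => P.reward s (P.policy θ s ε)) P.noise := fun θ =>
    integrable_of_norm_le ((hP.measurable_reward_policy θ).comp hm)
      fun ε => hP.abs_reward_le s (hP.policy_mem θ s ε)
  rw [rewardMean, rewardMean, ← integral_sub (hi θ₁) (hi θ₂)]
  rw [← Real.norm_eq_abs]
  refine norm_integral_le_of_norm_le_prob (fun ε => ?_)
  rw [Real.norm_eq_abs]
  rw [mul_assoc]
  exact (henv.reward_lipschitz s _ (hP.policy_mem θ₁ s ε) _ (hP.policy_mem θ₂ s ε)).trans
    (mul_le_mul_of_nonneg_left (hpolicy.lipschitz θ₁ θ₂ s ε) henv.Lr_pos.le)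

theorem abs_value_sub_le {Cν : ℝ} (h0 : 0 ≤ Cν) (hν : P.IsVisitationConstant Cν)
    (θ₁ θ₂ : EuclideanSpace ℝ (Fin d)) (s : S) :
    |P.value θ₁ s - P.value θ₂ s| ≤
      (K.Lr * K.Lf / (1 - P.discount) + K.Rmax * K.Lnu Cν) * ‖θ₁ - θ₂‖ := by
  have f1 := hP.isFiniteMeasure_visitMeasure θ₁ (Measure.dirac s)
  have f2 := hP.isFiniteMeasure_visitMeasure θ₂ (Measure.dirac s)
  have hi : ∀ θ, Integrable (P.rewardMean θ) (P.visitMeasure θ₁ (Measure.dirac s)) := fun θ =>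
    integrable_of_norm_le (hP.measurable_rewardMean θ) (hP.abs_rewardMean_le θ)
  have e : P.value θ₁ s - P.value θ₂ s =
      ∫ x, (P.rewardMean θ₁ x - P.rewardMean θ₂ x) ∂(P.visitMeasure θ₁ (Measure.dirac s)) +
      (∫ x, P.rewardMean θ₂ x ∂(P.visitMeasure θ₁ (Measure.dirac s)) -
        ∫ x, P.rewardMean θ₂ x ∂(P.visitMeasure θ₂ (Measure.dirac s))) := by
    rw [integral_sub (hi θ₁) (hi θ₂), hP.value_eq_resolvent, hP.value_eq_resolvent, resolvent,
      resolvent]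
    ring
  have b1 := hP.abs_integral_visitMeasure_le θ₁ (Measure.dirac s)
    (abs_rewardMean_sub_le hP hpolicy henv θ₁ θ₂)
  have b2 := (abs_integral_sub_le_tvNorm (μ := P.visitMeasure θ₁ (Measure.dirac s))
    (ν := P.visitMeasure θ₂ (Measure.dirac s)) (hP.measurable_rewardMean θ₂)
    (hP.abs_rewardMean_le θ₂) hP.Rmax_nonneg).trans
    (mul_le_mul_of_nonneg_left (tvNorm_visitMeasure_le hP hpolicy henv h0 hν (Measure.dirac s)
      θ₁ θ₂) hP.Rmax_nonneg)
  rw [e]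
  refine (abs_add_le _ _).trans ((add_le_add b1 b2).trans (le_of_eq ?_))
  ring

omit hpolicy in
theorem CQ_nonneg : 0 ≤ K.CQ P.discount := by
  have h1 := henv.LP_pos; have h2 := henv.Lr_pos; have h3 := hP.Rmax_nonneg
  have h4 := hP.discount_nonneg; have h5 := hP.one_sub_pos
  rw [RPGConstants.CQ]; positivity

omit hpolicy in
theorem abs_integral_nextState_sub_le {g : S → ℝ} {C : ℝ} (hg : Measurable g)
    (hC : ∀ x, |g x| ≤ C) (h0 : 0 ≤ C) (s : S) {a₁ a₂ : EuclideanSpace ℝ (Fin m)}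
    (h₁ : a₁ ∈ P.actions) (h₂ : a₂ ∈ P.actions) :
    |∫ x, g x ∂(P.nextState s a₁) - ∫ x, g x ∂(P.nextState s a₂)| ≤
      C * K.LP * ‖a₁ - a₂‖ := by
  have p1 := hP.isProbabilityMeasure_nextState s a₁
  have p2 := hP.isProbabilityMeasure_nextState s a₂
  rw [mul_assoc]
  exact (abs_integral_sub_le_tvNorm hg hC h0).trans
    (mul_le_mul_of_nonneg_left (henv.transition_lipschitz s _ h₁ _ h₂) h0)

omit hpolicy in
theorem abs_qValue_sub_le (θ : EuclideanSpace ℝ (Fin d)) (s : S)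
    {a₁ a₂ : EuclideanSpace ℝ (Fin m)} (h₁ : a₁ ∈ P.actions) (h₂ : a₂ ∈ P.actions) :
    |P.qValue θ s a₁ - P.qValue θ s a₂| ≤ K.CQ P.discount * ‖a₁ - a₂‖ := by
  have hγ := hP.discount_nonneg
  have h3 : 0 ≤ K.Rmax / (1 - P.discount) := div_nonneg hP.Rmax_nonneg hP.one_sub_pos.le
  have b1 := henv.reward_lipschitz s a₁ h₁ a₂ h₂
  have b2 := mul_le_mul_of_nonneg_left (abs_integral_nextState_sub_le hP henv
    (hP.measurable_value θ) (hP.abs_value_le θ) h3 s h₁ h₂) hγ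
  rw [← abs_of_nonneg hγ, ← abs_mul, abs_of_nonneg hγ] at b2
  have e : P.qValue θ s a₁ - P.qValue θ s a₂ = (P.reward s a₁ - P.reward s a₂) +
      P.discount * (∫ x, P.value θ x ∂(P.nextState s a₁) -
        ∫ x, P.value θ x ∂(P.nextState s a₂)) := by
    rw [qValue, qValue]; ring
  rw [e]
  refine (abs_add_le _ _).trans ((add_le_add b1 b2).trans (le_of_eq ?_))
  rw [RPGConstants.CQ]; ring

omit hpolicy in
theorem norm_gradQ_le (θ : EuclideanSpace ℝ (Fin d)) (s : S)
    {a : EuclideanSpace ℝ (Fin m)} (ha : a ∈ P.actions) :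
    ‖P.gradQ θ s a‖ ≤ K.CQ P.discount :=
  norm_gradient_le hP.actions_open ha (CQ_nonneg hP henv)
    fun _ hx => abs_qValue_sub_le hP henv θ s hx ha

/-- The `θ`-dependence of `∇_a Q` enters only through the value function of the next state, so
the Lipschitz continuity of the transition law turns a uniform bound on the change of the value
function into one on the change of the gradient. -/
theorem norm_gradQ_sub_le {Cν : ℝ} (h0 : 0 ≤ Cν) (hν : P.IsVisitationConstant Cν)
    (θ₁ θ₂ : EuclideanSpace ℝ (Fin d)) (s : S)
    {a : EuclideanSpace ℝ (Fin m)} (ha : a ∈ P.actions) :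
    ‖P.gradQ θ₁ s a - P.gradQ θ₂ s a‖ ≤
      P.discount * K.LP * (K.Lr * K.Lf / (1 - P.discount) + K.Rmax * K.Lnu Cν) * ‖θ₁ - θ₂‖ := by
  have hγ := hP.discount_nonneg
  have hc : 0 ≤ K.Lr * K.Lf / (1 - P.discount) + K.Rmax * K.Lnu Cν :=
    add_nonneg (div_nonneg (mul_nonneg henv.Lr_pos.le hpolicy.Lf_pos.le) hP.one_sub_pos.le)
      (mul_nonneg hP.Rmax_nonneg (Lnu_nonneg hP hpolicy henv h0))
  have hD := abs_value_sub_le hP hpolicy henv h0 hν θ₁ θ₂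
  set D := (K.Lr * K.Lf / (1 - P.discount) + K.Rmax * K.Lnu Cν) * ‖θ₁ - θ₂‖ with hDdef
  have hD0 : 0 ≤ D := mul_nonneg hc (norm_nonneg _)
  have d1 := hP.qValue_diff θ₁ s a ha
  have d2 := hP.qValue_diff θ₂ s a ha
  have e : P.gradQ θ₁ s a - P.gradQ θ₂ s a =
      gradient (fun a' => P.qValue θ₁ s a' - P.qValue θ₂ s a') a := by
    rw [gradQ, gradQ, gradient, gradient, gradient, ← map_sub, fderiv_fun_sub d1 d2]
  have eq : ∀ a', P.qValue θ₁ s a' - P.qValue θ₂ s a' =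
      P.discount * ∫ x, (P.value θ₁ x - P.value θ₂ x) ∂(P.nextState s a') := by
    intro a'
    have p1 := hP.isProbabilityMeasure_nextState s a'
    rw [integral_sub (integrable_of_norm_le (hP.measurable_value θ₁) (hP.abs_value_le θ₁))
      (integrable_of_norm_le (hP.measurable_value θ₂) (hP.abs_value_le θ₂)), qValue, qValue]
    ring
  rw [e]
  have hL : P.discount * K.LP * (K.Lr * K.Lf / (1 - P.discount) + K.Rmax * K.Lnu Cν) *
      ‖θ₁ - θ₂‖ = P.discount * (D * K.LP) := by rw [hDdef]; ring
  rw [hL]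
  refine norm_gradient_le hP.actions_open ha
    (mul_nonneg hγ (mul_nonneg hD0 henv.LP_pos.le)) fun x hx => ?_
  rw [eq, eq, ← mul_sub, abs_mul, abs_of_nonneg hγ, mul_assoc]
  exact mul_le_mul_of_nonneg_left (abs_integral_nextState_sub_le hP henv
    ((hP.measurable_value θ₁).sub (hP.measurable_value θ₂)) hD hD0 s hx ha) hγ

end Lipschitz

end RPGProblem

/-! ### The law of the actor samples -/

namespace RPGProblem

variable {S N : Type*} [MeasurableSpace S] [MeasurableSpace N] {d m : ℕ}
  {P : RPGProblem S N d m} {K : RPGConstants} {R : ℝ}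

theorem Standing.isProbabilityMeasure_visitDist (hP : P.Standing R)
    (θ : EuclideanSpace ℝ (Fin d)) : IsProbabilityMeasure (P.visitDist θ) := by
  have := hP.init_prob
  refine ⟨?_⟩
  rw [visitDist, Measure.smul_apply, hP.visitMeasure_univ, smul_eq_mul,
    ← ENNReal.ofReal_mul hP.one_sub_pos.le, mul_inv_cancel₀ hP.one_sub_pos.ne',
    ENNReal.ofReal_one]

theorem Standing.measurable_visitDist (hP : P.Standing R) : Measurable P.visitDist := by
  have := hP.init_prob
  refine Measure.measurable_of_measurable_coe _ fun B hB => ?_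
  have h := hP.measurable_visitMeasure (θ := fun θ : EuclideanSpace ℝ (Fin d) => θ) measurable_id
    (μ := fun _ => P.init) measurable_const (fun _ => hP.init_prob)
  simp_rw [visitDist, Measure.smul_apply, smul_eq_mul]
  exact ((Measure.measurable_coe hB).comp h).const_mul _

theorem Standing.integral_visitDist (hP : P.Standing R) (θ : EuclideanSpace ℝ (Fin d))
    (g : S → ℝ) :
    ∫ s, g s ∂(P.visitDist θ) = (1 - P.discount) * ∫ s, g s ∂(P.visitMeasure θ P.init) := by
  rw [visitDist, integral_smul_measure, ENNReal.toReal_ofReal hP.one_sub_pos.le, smul_eq_mul]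

/-- The law `ν_θ ⊗ noise` of the pairs `(s, ε)` used by the actor. -/
noncomputable def actorLaw (P : RPGProblem S N d m) (θ : EuclideanSpace ℝ (Fin d)) :
    Measure (S × N) :=
  (P.visitDist θ).prod P.noise

theorem Standing.isProbabilityMeasure_actorLaw (hP : P.Standing R)
    (θ : EuclideanSpace ℝ (Fin d)) : IsProbabilityMeasure (P.actorLaw θ) :=
  have := hP.isProbabilityMeasure_visitDist θ
  have := hP.noise_prob
  inferInstanceAs (IsProbabilityMeasure ((P.visitDist θ).prod P.noise))

section Bounded

variable {G : Type*} [NormedAddCommGroup G] [NormedSpace ℝ G] [MeasurableSpace G]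
  [BorelSpace G] [SecondCountableTopology G] {g : S × N → G} {C : ℝ}

theorem Standing.integrable_actorLaw (hP : P.Standing R) (hg : Measurable g)
    (hC : ∀ p, ‖g p‖ ≤ C) (θ : EuclideanSpace ℝ (Fin d)) : Integrable g (P.actorLaw θ) :=
  have := hP.isProbabilityMeasure_actorLaw θ
  integrable_of_norm_le hg hC

theorem Standing.integral_actorLaw (hP : P.Standing R) (hg : Measurable g)
    (hC : ∀ p, ‖g p‖ ≤ C) (θ : EuclideanSpace ℝ (Fin d)) :
    ∫ p, g p ∂(P.actorLaw θ) = ∫ s, ∫ ε, g (s, ε) ∂P.noise ∂(P.visitDist θ) := by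
  have := hP.isProbabilityMeasure_visitDist θ
  have := hP.noise_prob
  exact integral_prod g (hP.integrable_actorLaw hg hC θ)

theorem Standing.norm_integral_actorLaw_le (hP : P.Standing R)
    (hC : ∀ p, ‖g p‖ ≤ C) (θ : EuclideanSpace ℝ (Fin d)) : ‖∫ p, g p ∂(P.actorLaw θ)‖ ≤ C :=
  have := hP.isProbabilityMeasure_actorLaw θ
  norm_integral_le_of_norm_le_prob hC

end Bounded

/-- Integrating out the noise leaves a function of the state, so only the visitation distributions
differ. Their total variation distance is bounded by that of the unnormalized measures; the factor
`1 - γ` is given away. -/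
theorem norm_integral_actorLaw_sub_le (hP : P.Standing K.Rmax) (hpolicy : P.PolicyAssumption K)
    (henv : P.EnvironmentAssumption K) {Cν : ℝ} (h0 : 0 ≤ Cν) (hν : P.IsVisitationConstant Cν)
    {G : Type*} [NormedAddCommGroup G] [InnerProductSpace ℝ G] [CompleteSpace G]
    [MeasurableSpace G] [BorelSpace G] [SecondCountableTopology G] {g : S × N → G} {C : ℝ}
    (hg : Measurable g) (hC : ∀ p, ‖g p‖ ≤ C) (hC0 : 0 ≤ C) (θ₁ θ₂ : EuclideanSpace ℝ (Fin d)) :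
    ‖∫ p, g p ∂(P.actorLaw θ₁) - ∫ p, g p ∂(P.actorLaw θ₂)‖ ≤ C * (K.Lnu Cν * ‖θ₁ - θ₂‖) := by
  have := hP.isProbabilityMeasure_visitDist θ₁
  have := hP.isProbabilityMeasure_visitDist θ₂
  have := hP.noise_prob
  have := hP.init_prob
  rw [hP.integral_actorLaw hg hC, hP.integral_actorLaw hg hC]
  have hm : Measurable fun s => ∫ ε, g (s, ε) ∂P.noise :=
    (hg.stronglyMeasurable.integral_prod_right' (ν := P.noise)).measurable
  have hb : ∀ s, ‖∫ ε, g (s, ε) ∂P.noise‖ ≤ C := fun s =>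
    norm_integral_le_of_norm_le_prob fun ε => hC (s, ε)
  refine (norm_integral_sub_le_tvNorm hm hb hC0).trans (mul_le_mul_of_nonneg_left ?_ hC0)
  refine tvNorm_le fun f hf hf1 => ?_
  have f1 := hP.isFiniteMeasure_visitMeasure θ₁ P.init
  have f2 := hP.isFiniteMeasure_visitMeasure θ₂ P.init
  rw [hP.integral_visitDist, hP.integral_visitDist, ← mul_sub, abs_mul,
    abs_of_pos hP.one_sub_pos]
  have h1 := abs_integral_sub_le_tvNorm (μ := P.visitMeasure θ₁ P.init)
    (ν := P.visitMeasure θ₂ P.init) hf hf1 zero_le_one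
  have h2 := tvNorm_visitMeasure_le hP hpolicy henv h0 hν P.init θ₁ θ₂
  have h3 := hP.discount_nonneg
  rw [one_mul] at h1
  exact (mul_le_of_le_one_left (abs_nonneg _) (by linarith)).trans (h1.trans h2)

/-! ### The policy gradient -/

theorem Standing.measurable_jac_prod (hP : P.Standing R) (θ v : EuclideanSpace ℝ (Fin d)) :
    Measurable fun p : S × N => P.jac θ p.1 p.2 v := by
  have h1 : Measurable fun p : S × N => (θ, p.1, p.2) := by fun_prop
  have h2 := (hP.measurable_jac_apply v).comp h1
  exact h2

theorem Standing.measurable_gradPolicy_apply (hP : P.Standing R) (θ : EuclideanSpace ℝ (Fin d))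
    {g : S × N → EuclideanSpace ℝ (Fin m)} (hg : Measurable g) :
    Measurable fun p : S × N => P.gradPolicy θ p.1 p.2 (g p) := by
  refine measurable_of_inner fun v => ?_
  simp_rw [gradPolicy, ContinuousLinearMap.adjoint_inner_right]
  exact (hP.measurable_jac_prod θ v).inner hg

theorem Standing.measurable_gradQ_policy (hP : P.Standing R) (θ θ' : EuclideanSpace ℝ (Fin d)) :
    Measurable fun p : S × N => P.gradQ θ p.1 (P.policy θ' p.1 p.2) := by
  refine measurable_of_inner fun v => ?_
  have hpol := hP.measurable_policy_prod θ'
  have hm : ∀ n : ℕ, Measurable fun p : S × N =>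
      (n : ℝ) • (P.qValue θ p.1 (P.policy θ' p.1 p.2 + (n : ℝ)⁻¹ • v) -
        P.qValue θ p.1 (P.policy θ' p.1 p.2)) := by
    intro n
    have h1 : Measurable fun p : S × N => (p.1, P.policy θ' p.1 p.2 + (n : ℝ)⁻¹ • v) :=
      measurable_fst.prodMk (hpol.add_const _)
    have h2 := (hP.measurable_qValue θ).comp h1
    exact (h2.sub (hP.measurable_qValue_policy θ θ')).const_smul (n : ℝ)
  refine measurable_of_tendsto_metrizable hm (tendsto_pi_nhds.2 fun p => ?_)
  have h := tendsto_difference_quotient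
    (hP.qValue_diff θ p.1 _ (hP.policy_mem θ' p.1 p.2)).hasFDerivAt v
  rw [real_inner_comm, gradQ, gradient, InnerProductSpace.toDual_symm_apply]
  exact h

/-- The gradient of `θ' ↦ Q^{f_θ}(s, f_θ'(s, ε))`. -/
noncomputable def gradTerm (P : RPGProblem S N d m) (θ θ' : EuclideanSpace ℝ (Fin d))
    (p : S × N) : EuclideanSpace ℝ (Fin d) :=
  P.gradPolicy θ' p.1 p.2 (P.gradQ θ p.1 (P.policy θ' p.1 p.2))

theorem Standing.hasGradientAt_qValue_policy (hP : P.Standing R)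
    (θ θ' : EuclideanSpace ℝ (Fin d)) (s : S) (ε : N) :
    HasGradientAt (fun θ' => P.qValue θ s (P.policy θ' s ε)) (P.gradTerm θ θ' (s, ε)) θ' := by
  have h1 := (hP.qValue_diff θ s _ (hP.policy_mem θ' s ε)).hasFDerivAt
  have h2 := h1.comp θ' (hP.policy_diff s ε θ').hasFDerivAt
  have e : InnerProductSpace.toDual ℝ (EuclideanSpace ℝ (Fin d)) (P.gradTerm θ θ' (s, ε)) =
      (fderiv ℝ (fun a' => P.qValue θ s a') (P.policy θ' s ε)).comp
        (fderiv ℝ (fun θ => P.policy θ s ε) θ') := by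
    ext v
    simp only [gradTerm, gradPolicy, gradQ, InnerProductSpace.toDual_apply_apply,
      ContinuousLinearMap.adjoint_inner_left, ContinuousLinearMap.comp_apply, gradient,
      InnerProductSpace.toDual_symm_apply]
    rfl
  rw [hasGradientAt_iff_hasFDerivAt, e]
  exact h2

theorem Standing.measurable_gradTerm (hP : P.Standing R) (θ θ' : EuclideanSpace ℝ (Fin d)) :
    Measurable (P.gradTerm θ θ') :=
  hP.measurable_gradPolicy_apply θ' (hP.measurable_gradQ_policy θ θ')

section Gradient

variable (hP : P.Standing K.Rmax) (hpolicy : P.PolicyAssumption K)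
  (henv : P.EnvironmentAssumption K)

include hP hpolicy henv

theorem norm_gradTerm_le (θ θ' : EuclideanSpace ℝ (Fin d)) (p : S × N) :
    ‖P.gradTerm θ θ' p‖ ≤ K.Lf * K.CQ P.discount :=
  ((P.gradPolicy θ' p.1 p.2).le_opNorm _).trans
    (mul_le_mul (hpolicy.norm_gradPolicy_le θ' p.1 p.2)
      (norm_gradQ_le hP henv θ p.1 (hP.policy_mem θ' p.1 p.2)) (norm_nonneg _) hpolicy.Lf_pos.le)

theorem gradJ_eq_integral (θ : EuclideanSpace ℝ (Fin d)) :
    P.gradJ θ = ∫ p, P.gradTerm θ θ p ∂(P.actorLaw θ) :=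
  (hP.integral_actorLaw (hP.measurable_gradTerm θ θ) (norm_gradTerm_le hP hpolicy henv θ θ) θ).symm

theorem norm_gradJ_le (θ : EuclideanSpace ℝ (Fin d)) :
    ‖P.gradJ θ‖ ≤ K.Lf * K.CQ P.discount := by
  rw [gradJ_eq_integral hP hpolicy henv]
  exact hP.norm_integral_actorLaw_le (norm_gradTerm_le hP hpolicy henv θ θ) θ

/-- Here the parameter `θ` of `Q` is fixed and only the action moves. -/
theorem norm_gradTerm_sub_le (hQ : P.QAssumption K) (θ θ₁ θ₂ : EuclideanSpace ℝ (Fin d))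
    (p : S × N) :
    ‖P.gradTerm θ θ₁ p - P.gradTerm θ θ₂ p‖ ≤
      (K.Lpsi * K.CQ P.discount + K.Lf * (K.LQ * K.Lf)) * ‖θ₁ - θ₂‖ := by
  have m1 := hP.policy_mem θ₁ p.1 p.2
  have m2 := hP.policy_mem θ₂ p.1 p.2
  have e : P.gradTerm θ θ₁ p - P.gradTerm θ θ₂ p =
      (P.gradPolicy θ₁ p.1 p.2 - P.gradPolicy θ₂ p.1 p.2) (P.gradQ θ p.1 (P.policy θ₁ p.1 p.2)) +
      P.gradPolicy θ₂ p.1 p.2 (P.gradQ θ p.1 (P.policy θ₁ p.1 p.2) -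
        P.gradQ θ p.1 (P.policy θ₂ p.1 p.2)) := by
    simp [gradTerm]
  have b1 : ‖(P.gradPolicy θ₁ p.1 p.2 - P.gradPolicy θ₂ p.1 p.2)
      (P.gradQ θ p.1 (P.policy θ₁ p.1 p.2))‖ ≤ K.Lpsi * ‖θ₁ - θ₂‖ * K.CQ P.discount :=
    (ContinuousLinearMap.le_opNorm _ _).trans
      (mul_le_mul (hpolicy.smooth θ₁ θ₂ p.1 p.2) (norm_gradQ_le hP henv θ p.1 m1) (norm_nonneg _)
        (mul_nonneg hpolicy.Lpsi_pos.le (norm_nonneg _)))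
  have b2 : ‖P.gradPolicy θ₂ p.1 p.2 (P.gradQ θ p.1 (P.policy θ₁ p.1 p.2) -
        P.gradQ θ p.1 (P.policy θ₂ p.1 p.2))‖ ≤ K.Lf * (K.LQ * (K.Lf * ‖θ₁ - θ₂‖)) :=
    (ContinuousLinearMap.le_opNorm _ _).trans
      (mul_le_mul (hpolicy.norm_gradPolicy_le θ₂ p.1 p.2)
        ((hQ.smooth θ p.1 _ m1 _ m2).trans
          (mul_le_mul_of_nonneg_left (hpolicy.lipschitz θ₁ θ₂ p.1 p.2) hQ.LQ_pos.le))
        (norm_nonneg _) hpolicy.Lf_pos.le)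
  rw [e]
  refine (norm_add_le _ _).trans ((add_le_add b1 b2).trans (le_of_eq ?_))
  ring

/-- By performance difference, `J(θ') - J(θ)` is a mean under `ν_θ'` of differences of `Q^{f_θ}`.
Each difference is expanded at `θ`, and then `ν_θ'` is exchanged for `ν_θ` in the linear term, which
is itself of size `‖θ' - θ‖`. -/
theorem abs_objective_remainder_le (hQ : P.QAssumption K) {Cν : ℝ} (h0 : 0 ≤ Cν)
    (hν : P.IsVisitationConstant Cν) (θ θ' : EuclideanSpace ℝ (Fin d)) :
    |P.objective θ' - P.objective θ - inner ℝ (P.gradJ θ) (θ' - θ)| ≤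
      (K.Lpsi * K.CQ P.discount + K.Lf * (K.LQ * K.Lf) + K.Lf * K.CQ P.discount * K.Lnu Cν) *
        ‖θ' - θ‖ ^ 2 := by
  have := hP.init_prob
  have hC := CQ_nonneg hP henv
  have hC1 : 0 ≤ K.Lpsi * K.CQ P.discount + K.Lf * (K.LQ * K.Lf) :=
    add_nonneg (mul_nonneg hpolicy.Lpsi_pos.le hC)
      (mul_nonneg hpolicy.Lf_pos.le (mul_nonneg hQ.LQ_pos.le hpolicy.Lf_pos.le))
  set C1 := K.Lpsi * K.CQ P.discount + K.Lf * (K.LQ * K.Lf) with hC1def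
  let F : S × N → ℝ := fun p =>
    P.qValue θ p.1 (P.policy θ' p.1 p.2) - P.qValue θ p.1 (P.policy θ p.1 p.2)
  have hFm : Measurable F :=
    (hP.measurable_qValue_policy θ θ').sub (hP.measurable_qValue_policy θ θ)
  have hFb : ∀ p, ‖F p‖ ≤ K.CQ P.discount * ‖P.policy θ' p.1 p.2 - P.policy θ p.1 p.2‖ := fun p =>
    abs_qValue_sub_le hP henv θ p.1 (hP.policy_mem θ' p.1 p.2) (hP.policy_mem θ p.1 p.2)
  have hFb' : ∀ p, ‖F p‖ ≤ K.CQ P.discount * (K.Lf * ‖θ' - θ‖) := fun p =>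
    (hFb p).trans (mul_le_mul_of_nonneg_left (hpolicy.lipschitz θ' θ p.1 p.2) hC)
  have hgm := hP.measurable_gradTerm θ θ
  have hgb := norm_gradTerm_le hP hpolicy henv θ θ
  have hJ : P.objective θ' - P.objective θ = ∫ p, F p ∂(P.actorLaw θ') := by
    rw [hP.integral_actorLaw hFm hFb', hP.integral_visitDist, objective, objective, ← mul_sub,
      hP.performance_difference θ θ' P.init]
  have i1 := hP.integrable_actorLaw hFm hFb' θ'
  have i2 := hP.integrable_actorLaw hgm hgb θ'
  have hsplit : P.objective θ' - P.objective θ - inner ℝ (P.gradJ θ) (θ' - θ) =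
      ∫ p, (F p - inner ℝ (θ' - θ) (P.gradTerm θ θ p)) ∂(P.actorLaw θ') +
      inner ℝ (θ' - θ) (∫ p, P.gradTerm θ θ p ∂(P.actorLaw θ') -
        ∫ p, P.gradTerm θ θ p ∂(P.actorLaw θ)) := by
    rw [integral_sub i1 (i2.const_inner _), integral_inner i2, hJ,
      inner_sub_right (θ' - θ), gradJ_eq_integral hP hpolicy henv, real_inner_comm (θ' - θ)]
    ring
  have b1 : ‖∫ p, (F p - inner ℝ (θ' - θ) (P.gradTerm θ θ p)) ∂(P.actorLaw θ')‖ ≤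
      C1 * ‖θ' - θ‖ ^ 2 := by
    refine hP.norm_integral_actorLaw_le (fun p => ?_) θ'
    have h := abs_quadratic_remainder_le (x := θ)
      (fun z => hP.hasGradientAt_qValue_policy θ z p.1 p.2)
      (fun z => norm_gradTerm_sub_le hP hpolicy henv hQ θ z θ p) θ' hC1
    rw [real_inner_comm]
    exact h
  have b2 : |inner ℝ (θ' - θ) (∫ p, P.gradTerm θ θ p ∂(P.actorLaw θ') -
        ∫ p, P.gradTerm θ θ p ∂(P.actorLaw θ))| ≤
      ‖θ' - θ‖ * (K.Lf * K.CQ P.discount * (K.Lnu Cν * ‖θ' - θ‖)) :=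
    (abs_real_inner_le_norm _ _).trans (mul_le_mul_of_nonneg_left
      (norm_integral_actorLaw_sub_le hP hpolicy henv h0 hν hgm hgb
        (mul_nonneg hpolicy.Lf_pos.le hC) θ' θ) (norm_nonneg _))
  rw [hsplit]
  refine (abs_add_le _ _).trans ((add_le_add b1 b2).trans (le_of_eq ?_))
  ring

/-- The policy gradient theorem, with the remainder bound supplied by some constant of sensitivity
of the visitation measures. -/
theorem hasGradientAt_objective (hQ : P.QAssumption K) (θ : EuclideanSpace ℝ (Fin d)) :
    HasGradientAt P.objective (P.gradJ θ) θ := by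
  obtain ⟨Cν, h1, hν⟩ := hP.exists_isVisitationConstant
  rw [hasGradientAt_iff_isLittleO]
  refine Asymptotics.IsBigO.trans_isLittleO (g := fun θ' => ‖θ' - θ‖ ^ 2)
    (Asymptotics.IsBigO.of_bound (K.Lpsi * K.CQ P.discount + K.Lf * (K.LQ * K.Lf) +
      K.Lf * K.CQ P.discount * K.Lnu Cν) (Eventually.of_forall fun θ' => ?_))
    (Asymptotics.isLittleO_pow_sub_sub θ one_lt_two)
  rw [Real.norm_eq_abs, norm_pow, norm_norm]
  exact abs_objective_remainder_le hP hpolicy henv hQ (zero_le_one.trans h1.le) hν θ θ'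

/-- Three variations are added: of `Q` with the policy it evaluates, of the policy and its Jacobian
at fixed `Q`, and of the visitation distribution. -/
theorem norm_gradJ_sub_le (hQ : P.QAssumption K) {Cν : ℝ} (h0 : 0 ≤ Cν)
    (hν : P.IsVisitationConstant Cν) (θ₁ θ₂ : EuclideanSpace ℝ (Fin d)) :
    ‖P.gradJ θ₁ - P.gradJ θ₂‖ ≤ K.LJ P.discount Cν * ‖θ₁ - θ₂‖ := by
  have hC := CQ_nonneg hP henv
  have m1 := hP.measurable_gradTerm θ₁ θ₁
  have m2 := hP.measurable_gradTerm θ₂ θ₂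
  have n1 := norm_gradTerm_le hP hpolicy henv θ₁ θ₁
  have n2 := norm_gradTerm_le hP hpolicy henv θ₂ θ₂
  have e : P.gradJ θ₁ - P.gradJ θ₂ =
      ∫ p, (P.gradTerm θ₁ θ₁ p - P.gradTerm θ₂ θ₂ p) ∂(P.actorLaw θ₁) +
      (∫ p, P.gradTerm θ₂ θ₂ p ∂(P.actorLaw θ₁) - ∫ p, P.gradTerm θ₂ θ₂ p ∂(P.actorLaw θ₂)) := by
    rw [integral_sub (hP.integrable_actorLaw m1 n1 θ₁) (hP.integrable_actorLaw m2 n2 θ₁),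
      gradJ_eq_integral hP hpolicy henv, gradJ_eq_integral hP hpolicy henv]
    abel
  have b2 := norm_integral_actorLaw_sub_le hP hpolicy henv h0 hν m2 n2
    (mul_nonneg hpolicy.Lf_pos.le hC) θ₁ θ₂
  have b1 : ‖∫ p, (P.gradTerm θ₁ θ₁ p - P.gradTerm θ₂ θ₂ p) ∂(P.actorLaw θ₁)‖ ≤
      K.Lf * (P.discount * K.LP * (K.Lr * K.Lf / (1 - P.discount) + K.Rmax * K.Lnu Cν) *
        ‖θ₁ - θ₂‖) +
      (K.Lpsi * K.CQ P.discount + K.Lf * (K.LQ * K.Lf)) * ‖θ₁ - θ₂‖ := by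
    refine hP.norm_integral_actorLaw_le (fun p => ?_) θ₁
    have e1 : P.gradTerm θ₁ θ₁ p - P.gradTerm θ₂ θ₂ p =
        P.gradPolicy θ₁ p.1 p.2 (P.gradQ θ₁ p.1 (P.policy θ₁ p.1 p.2) -
          P.gradQ θ₂ p.1 (P.policy θ₁ p.1 p.2)) +
        (P.gradTerm θ₂ θ₁ p - P.gradTerm θ₂ θ₂ p) := by
      simp [gradTerm]
    rw [e1]
    refine (norm_add_le _ _).trans (add_le_add ?_ (norm_gradTerm_sub_le hP hpolicy henv hQ _ _ _ p))
    exact (ContinuousLinearMap.le_opNorm _ _).trans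
      (mul_le_mul (hpolicy.norm_gradPolicy_le θ₁ p.1 p.2)
        (norm_gradQ_sub_le hP hpolicy henv h0 hν θ₁ θ₂ p.1 (hP.policy_mem θ₁ p.1 p.2))
        (norm_nonneg _) hpolicy.Lf_pos.le)
  rw [e]
  refine (norm_add_le _ _).trans ((add_le_add b1 b2).trans ?_)
  have hγ := hP.discount_nonneg
  -- several terms of `LJ` carry one factor `u = 1 / (1 - γ) ≥ 1` more than the bound just obtained
  have hu1 : 1 ≤ (1 - P.discount)⁻¹ := (one_le_inv₀ hP.one_sub_pos).2 (by linarith)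
  have p1 := hpolicy.Lf_pos
  have p2 := hpolicy.Lpsi_pos
  have p3 := henv.LP_pos
  have p4 := henv.Lr_pos
  have p5 := hQ.LQ_pos
  have p6 := hP.Rmax_nonneg
  have hCQ : K.CQ P.discount = K.Lr + P.discount * K.Rmax * K.LP / (1 - P.discount) := by
    rw [RPGConstants.CQ]; ring
  rw [RPGConstants.LJ, ← hCQ, RPGConstants.Lnu]
  simp only [div_eq_mul_inv]
  set u := (1 - P.discount)⁻¹
  set c := K.CQ P.discount
  have hu0 : 0 ≤ u - 1 := by linarith
  have t1 : 0 ≤ K.Lpsi * c * (u - 1) := by positivity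
  have t2 : 0 ≤ K.Lf ^ 2 * K.LQ * (u - 1) := by positivity
  have t3 : 0 ≤ K.Lf * P.discount * K.LP * K.Rmax * (1 / 2 * Cν * K.LP * K.Lf) * (u - 1) := by
    positivity
  have t4 : 0 ≤ K.Lf ^ 2 * P.discount * K.LP * K.Lr * u * (u - 1) := by positivity
  have t5 := mul_nonneg (add_nonneg (add_nonneg t1 t2) (add_nonneg t3 t4)) (norm_nonneg (θ₁ - θ₂))
  refine le_of_sub_nonneg (t5.trans_eq ?_)
  ring

theorem LJ_pos (hQ : P.QAssumption K) {Cν : ℝ} (h0 : 0 ≤ Cν) : 0 < K.LJ P.discount Cν := by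
  have hγ := hP.discount_nonneg
  have hu := hP.one_sub_pos
  have p1 := hpolicy.Lf_pos
  have p2 := hpolicy.Lpsi_pos
  have p3 := henv.LP_pos
  have p4 := henv.Lr_pos
  have p5 := hQ.LQ_pos
  have p6 := hP.Rmax_nonneg
  rw [RPGConstants.LJ]
  positivity

theorem abs_objective_sub_inner_le (hQ : P.QAssumption K) {Cν : ℝ} (h0 : 0 ≤ Cν)
    (hν : P.IsVisitationConstant Cν) (θ θ' : EuclideanSpace ℝ (Fin d)) :
    |P.objective θ' - P.objective θ - inner ℝ (P.gradJ θ) (θ' - θ)| ≤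
      K.LJ P.discount Cν * ‖θ' - θ‖ ^ 2 :=
  abs_quadratic_remainder_le (fun z => hasGradientAt_objective hP hpolicy henv hQ z)
    (fun z => norm_gradJ_sub_le hP hpolicy henv hQ h0 hν z θ) θ'
    (LJ_pos hP hpolicy henv hQ h0).le

end Gradient

theorem Standing.abs_objective_le (hP : P.Standing R) (θ : EuclideanSpace ℝ (Fin d)) :
    |P.objective θ| ≤ R := by
  have := hP.init_prob
  rw [objective, abs_mul, abs_of_pos hP.one_sub_pos]
  have h := norm_integral_le_of_norm_le_prob (μ := P.init) (f := P.value θ) (hP.abs_value_le θ)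
  rw [Real.norm_eq_abs] at h
  refine (mul_le_mul_of_nonneg_left h hP.one_sub_pos.le).trans_eq ?_
  field_simp [hP.one_sub_pos.ne']

end RPGProblem

/-! ### Compatible critic weights -/

section Spectrum

variable {V : Type*} [NormedAddCommGroup V] [InnerProductSpace ℝ V] [FiniteDimensional ℝ V]

/-- A lower bound for the spectrum of a symmetric operator is one for its quadratic form, since the
infimum of the Rayleigh quotient is an eigenvalue. -/
theorem le_inner_of_spectrum {T : V →L[ℝ] V} (hT : (T : V →ₗ[ℝ] V).IsSymmetric) {c : ℝ}
    (hc : ∀ z ∈ spectrum ℝ T, c ≤ z) (v : V) : c * ‖v‖ ^ 2 ≤ inner ℝ v (T v) := by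
  rcases eq_or_ne v 0 with rfl | hv
  · simp
  have : Nontrivial V := ⟨⟨v, 0, hv⟩⟩
  have hev := hT.hasEigenvalue_iInf_of_finiteDimensional
  set q : { x : V // x ≠ 0 } → ℝ := fun x =>
    RCLike.re (inner ℝ ((T : V →ₗ[ℝ] V) x) (x : V)) / ‖(x : V)‖ ^ 2 with hq
  have hz : c ≤ ⨅ x, q x := by
    refine hc _ fun hu => ?_
    obtain ⟨w, hw⟩ := hev.exists_hasEigenvector
    obtain ⟨u, hu⟩ := hu
    have h1 : (u : V →L[ℝ] V) w = 0 := by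
      rw [hu, _root_.sub_apply, sub_eq_zero]
      exact hw.apply_eq_smul.symm
    have h2 : ((u⁻¹ * u : (V →L[ℝ] V)ˣ) : V →L[ℝ] V) w = 0 := by
      rw [Units.val_mul, mul_apply_eq_comp, h1, map_zero]
    rw [inv_mul_cancel] at h2
    exact hw.2 (by simpa using h2)
  have hbdd : BddBelow (Set.range q) := by
    refine ⟨-‖T‖, ?_⟩
    rintro _ ⟨x, rfl⟩
    have hx : 0 < ‖(x : V)‖ ^ 2 := pow_pos (norm_pos_iff.2 x.2) 2
    rw [hq]
    simp only [RCLike.re_to_real]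
    rw [le_div_iff₀ hx]
    have h := abs_real_inner_le_norm (T x) (x : V)
    have h2 := mul_le_mul_of_nonneg_right (T.le_opNorm x) (norm_nonneg (x : V))
    have h3 := neg_abs_le (inner ℝ (T x) (x : V))
    simp only [ContinuousLinearMap.coe_coe]
    nlinarith
  have h := hz.trans (ciInf_le hbdd ⟨v, hv⟩)
  have hpos : 0 < ‖v‖ ^ 2 := pow_pos (norm_pos_iff.2 hv) 2
  rw [hq] at h
  simp only [RCLike.re_to_real] at h
  rw [le_div_iff₀ hpos] at h
  rw [real_inner_comm]
  exact h

end Spectrum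

namespace RPGProblem

variable {S N : Type*} [MeasurableSpace S] [MeasurableSpace N] {d m : ℕ}
  {P : RPGProblem S N d m} {K : RPGConstants} {R : ℝ}

/-- The vector `∇_θ f_θ(s, ε) ∇_θ f_θ(s, ε)ᵀ w`, a sample of `Ψ_θ w`. -/
noncomputable def psiSample (P : RPGProblem S N d m) (θ w : EuclideanSpace ℝ (Fin d))
    (p : S × N) : EuclideanSpace ℝ (Fin d) :=
  P.gradPolicy θ p.1 p.2 (P.jac θ p.1 p.2 w)

theorem Standing.measurable_psiSample (hP : P.Standing R) (θ w : EuclideanSpace ℝ (Fin d)) :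
    Measurable (P.psiSample θ w) :=
  hP.measurable_gradPolicy_apply θ (hP.measurable_jac_prod θ w)

section Psi

variable (hP : P.Standing K.Rmax) (hpolicy : P.PolicyAssumption K)
  (henv : P.EnvironmentAssumption K)

include hP hpolicy

theorem norm_psiSample_le (θ w : EuclideanSpace ℝ (Fin d)) (p : S × N) :
    ‖P.psiSample θ w p‖ ≤ K.Lf ^ 2 * ‖w‖ := by
  rw [sq, mul_assoc]
  exact (ContinuousLinearMap.le_opNorm _ _).trans (mul_le_mul (hpolicy.norm_gradPolicy_le θ p.1 p.2)
    ((ContinuousLinearMap.le_opNorm _ _).trans (mul_le_mul_of_nonneg_right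
      (hpolicy.norm_jac_le θ p.1 p.2) (norm_nonneg _))) (norm_nonneg _) hpolicy.Lf_pos.le)

theorem Psi_apply (θ w : EuclideanSpace ℝ (Fin d)) :
    P.Psi θ w = ∫ p, P.psiSample θ w p ∂(P.actorLaw θ) := by
  have := secondCountable_clm (V := EuclideanSpace ℝ (Fin d)) (W := EuclideanSpace ℝ (Fin d))
  have hm : Measurable fun p : S × N => (P.gradPolicy θ p.1 p.2).comp (P.jac θ p.1 p.2) :=
    measurable_clm_of_apply fun v => hP.measurable_psiSample θ v
  have hb : ∀ p : S × N, ‖(P.gradPolicy θ p.1 p.2).comp (P.jac θ p.1 p.2)‖ ≤ K.Lf * K.Lf :=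
    fun p => (ContinuousLinearMap.opNorm_comp_le _ _).trans
      (mul_le_mul (hpolicy.norm_gradPolicy_le θ p.1 p.2) (hpolicy.norm_jac_le θ p.1 p.2)
        (norm_nonneg _) hpolicy.Lf_pos.le)
  have h1 : P.Psi θ = ∫ p : S × N, (P.gradPolicy θ p.1 p.2).comp (P.jac θ p.1 p.2)
      ∂(P.actorLaw θ) := (hP.integral_actorLaw hm hb θ).symm
  rw [h1, ContinuousLinearMap.integral_apply (hP.integrable_actorLaw hm hb θ)]
  rfl

theorem integrable_psiSample (θ θ' w : EuclideanSpace ℝ (Fin d)) :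
    Integrable (P.psiSample θ w) (P.actorLaw θ') :=
  hP.integrable_actorLaw (hP.measurable_psiSample θ w) (norm_psiSample_le hP hpolicy θ w) θ'

theorem norm_Psi_apply_le (θ w : EuclideanSpace ℝ (Fin d)) : ‖P.Psi θ w‖ ≤ K.Lh * ‖w‖ := by
  rw [Psi_apply hP hpolicy]
  exact hP.norm_integral_actorLaw_le (norm_psiSample_le hP hpolicy θ w) θ

theorem Psi_isSymmetric (θ : EuclideanSpace ℝ (Fin d)) :
    (P.Psi θ : EuclideanSpace ℝ (Fin d) →ₗ[ℝ] EuclideanSpace ℝ (Fin d)).IsSymmetric := by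
  intro v w
  simp only [ContinuousLinearMap.coe_coe]
  rw [real_inner_comm, Psi_apply hP hpolicy, Psi_apply hP hpolicy,
    ← integral_inner (integrable_psiSample hP hpolicy θ θ v),
    ← integral_inner (integrable_psiSample hP hpolicy θ θ w)]
  refine integral_congr_ae (Eventually.of_forall fun p => ?_)
  simp only [psiSample, gradPolicy, ContinuousLinearMap.adjoint_inner_right]
  exact real_inner_comm _ _

theorem le_inner_Psi (θ w : EuclideanSpace ℝ (Fin d)) :
    K.lamPsi * ‖w‖ ^ 2 ≤ inner ℝ w (P.Psi θ w) :=
  le_inner_of_spectrum (Psi_isSymmetric hP hpolicy θ) (hpolicy.psi_eigenvalues θ) w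

theorem le_norm_Psi (θ w : EuclideanSpace ℝ (Fin d)) : K.lamPsi * ‖w‖ ≤ ‖P.Psi θ w‖ := by
  rcases eq_or_ne w 0 with rfl | hw
  · simp
  have h1 := (le_inner_Psi hP hpolicy θ w).trans (real_inner_le_norm _ _)
  rw [sq, ← mul_assoc, mul_comm ‖w‖ ‖P.Psi θ w‖] at h1
  exact le_of_mul_le_mul_right h1 (norm_pos_iff.2 hw)

theorem exists_Psi_eq (θ g : EuclideanSpace ℝ (Fin d)) : ∃ w, P.Psi θ w = g := by
  have hinj : Function.Injective
      (P.Psi θ : EuclideanSpace ℝ (Fin d) →ₗ[ℝ] EuclideanSpace ℝ (Fin d)) := by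
    rw [injective_iff_map_eq_zero]
    intro w hw
    have h := le_norm_Psi hP hpolicy θ w
    rw [show P.Psi θ w = 0 from hw, norm_zero] at h
    exact norm_le_zero_iff.1 (nonpos_of_mul_nonpos_right h hpolicy.lamPsi_pos)
  exact LinearMap.injective_iff_surjective.1 hinj g

include henv

/-- The mean square error is a quadratic function of `w` with Hessian `2 Ψ_θ`, and the
linear term is given by the policy gradient. -/
theorem compatError_eq (θ w : EuclideanSpace ℝ (Fin d)) :
    P.compatError θ w = inner ℝ w (P.Psi θ w) - 2 * inner ℝ w (P.gradJ θ) +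
      P.compatError θ 0 := by
  have hC := CQ_nonneg hP henv
  have hq := hP.measurable_gradQ_policy θ θ
  have hqb : ∀ p : S × N, ‖P.gradQ θ p.1 (P.policy θ p.1 p.2)‖ ≤ K.CQ P.discount := fun p =>
    norm_gradQ_le hP henv θ p.1 (hP.policy_mem θ p.1 p.2)
  have hint : ∀ u : EuclideanSpace ℝ (Fin d),
      Measurable (fun p : S × N =>
        ‖P.jac θ p.1 p.2 u - P.gradQ θ p.1 (P.policy θ p.1 p.2)‖ ^ 2) ∧
      ∀ p : S × N, ‖‖P.jac θ p.1 p.2 u - P.gradQ θ p.1 (P.policy θ p.1 p.2)‖ ^ 2‖ ≤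
        (K.Lf * ‖u‖ + K.CQ P.discount) ^ 2 := by
    intro u
    refine ⟨((hP.measurable_jac_prod θ u).sub hq).norm.pow_const 2, fun p => ?_⟩
    rw [norm_pow, norm_norm]
    refine pow_le_pow_left₀ (norm_nonneg _) ?_ 2
    refine (norm_sub_le _ _).trans (add_le_add ?_ (hqb p))
    exact (ContinuousLinearMap.le_opNorm _ _).trans (mul_le_mul_of_nonneg_right
      (hpolicy.norm_jac_le θ p.1 p.2) (norm_nonneg _))
  have e : ∀ u, P.compatError θ u = ∫ p : S × N,
      ‖P.jac θ p.1 p.2 u - P.gradQ θ p.1 (P.policy θ p.1 p.2)‖ ^ 2 ∂(P.actorLaw θ) := fun u =>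
    (hP.integral_actorLaw (hint u).1 (hint u).2 θ).symm
  have i0 := hP.integrable_actorLaw (hint 0).1 (hint 0).2 θ
  have i1 := (integrable_psiSample hP hpolicy θ θ w).const_inner (𝕜 := ℝ) w
  have i2 := (hP.integrable_actorLaw (hP.measurable_gradTerm θ θ)
    (norm_gradTerm_le hP hpolicy henv θ θ) θ).const_inner (𝕜 := ℝ) w
  have i3 : Integrable (fun p => inner ℝ w (P.psiSample θ w p) -
      2 * inner ℝ w (P.gradTerm θ θ p)) (P.actorLaw θ) := i1.sub (i2.const_mul _)
  rw [e, e, Psi_apply hP hpolicy, gradJ_eq_integral hP hpolicy henv,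
    ← integral_inner (integrable_psiSample hP hpolicy θ θ w),
    ← integral_inner (hP.integrable_actorLaw (hP.measurable_gradTerm θ θ)
      (norm_gradTerm_le hP hpolicy henv θ θ) θ), ← integral_const_mul,
    ← integral_sub i1 (i2.const_mul _), ← integral_add i3 i0]
  refine integral_congr_ae (Eventually.of_forall fun p => ?_)
  simp only [psiSample, gradTerm, gradPolicy, ContinuousLinearMap.adjoint_inner_right, map_zero,
    zero_sub, norm_neg]
  rw [norm_sub_sq_real, real_inner_self_eq_norm_sq]

theorem compatError_eq_add (θ w w₀ : EuclideanSpace ℝ (Fin d)) (h : P.Psi θ w₀ = P.gradJ θ) :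
    P.compatError θ w = P.compatError θ w₀ + inner ℝ (w - w₀) (P.Psi θ (w - w₀)) := by
  have hs : inner ℝ w₀ (P.Psi θ w) = inner ℝ w (P.Psi θ w₀) := by
    rw [real_inner_comm]
    exact Psi_isSymmetric hP hpolicy θ w w₀
  rw [compatError_eq hP hpolicy henv θ w, compatError_eq hP hpolicy henv θ w₀, ← h, map_sub,
    inner_sub_left, inner_sub_right, inner_sub_right, hs]
  ring

/-- The normal equation of the least squares problem. Positivity of `Ψ_θ` makes it sufficient. -/
theorem isCompatible_iff (θ w : EuclideanSpace ℝ (Fin d)) :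
    P.IsCompatible θ w ↔ P.Psi θ w = P.gradJ θ := by
  have key : ∀ u, 0 ≤ inner ℝ u (P.Psi θ u) := fun u =>
    (mul_nonneg hpolicy.lamPsi_pos.le (sq_nonneg _)).trans (le_inner_Psi hP hpolicy θ u)
  constructor
  · intro hw
    obtain ⟨w₀, h₀⟩ := exists_Psi_eq hP hpolicy θ (P.gradJ θ)
    have h1 := compatError_eq_add hP hpolicy henv θ w w₀ h₀
    have h2 := hw w₀
    have h3 := le_inner_Psi hP hpolicy θ (w - w₀)
    have h4 : ‖w - w₀‖ ^ 2 ≤ 0 :=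
      nonpos_of_mul_nonpos_right (h3.trans (by linarith)) hpolicy.lamPsi_pos
    have h5 : w - w₀ = 0 := norm_eq_zero.1 (pow_eq_zero_iff two_ne_zero |>.1
      (le_antisymm h4 (sq_nonneg _)))
    rw [sub_eq_zero.1 h5, h₀]
  · intro hw w'
    rw [compatError_eq_add hP hpolicy henv θ w' w hw]
    linarith [key (w' - w)]

theorem existsUnique_isCompatible (θ : EuclideanSpace ℝ (Fin d)) : ∃! w, P.IsCompatible θ w := by
  obtain ⟨w, hw⟩ := exists_Psi_eq hP hpolicy θ (P.gradJ θ)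
  refine ⟨w, (isCompatible_iff hP hpolicy henv θ w).2 hw, fun w' hw' => ?_⟩
  replace hw' := (isCompatible_iff hP hpolicy henv θ w').1 hw'
  rw [← hw, ← sub_eq_zero, ← map_sub] at hw'
  have h := le_norm_Psi hP hpolicy θ (w' - w)
  rw [hw', norm_zero] at h
  exact sub_eq_zero.1 (norm_le_zero_iff.1 (nonpos_of_mul_nonpos_right h hpolicy.lamPsi_pos))

theorem Psi_wCompat (θ : EuclideanSpace ℝ (Fin d)) : P.Psi θ (P.wCompat θ) = P.gradJ θ :=
  (isCompatible_iff hP hpolicy henv θ _).1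
    (Classical.epsilon_spec (existsUnique_isCompatible hP hpolicy henv θ).exists)

theorem norm_wCompat_le (θ : EuclideanSpace ℝ (Fin d)) :
    ‖P.wCompat θ‖ ≤ K.CwXi P.discount := by
  have h1 := (le_norm_Psi hP hpolicy θ (P.wCompat θ)).trans
    ((Psi_wCompat hP hpolicy henv θ).symm ▸ norm_gradJ_le hP hpolicy henv θ)
  have hl := hpolicy.lamPsi_pos
  have hγ := hP.one_sub_pos
  have hγ0 := hP.discount_nonneg
  have hn : 0 ≤ K.Lf * K.CQ P.discount := mul_nonneg hpolicy.Lf_pos.le (CQ_nonneg hP henv)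
  rw [RPGConstants.CwXi, le_div_iff₀ (mul_pos hl hγ), ← mul_assoc, mul_comm ‖_‖]
  calc _ ≤ K.Lf * K.CQ P.discount * (1 - P.discount) := mul_le_mul_of_nonneg_right h1 hγ.le
    _ ≤ _ := mul_le_of_le_one_right hn (by linarith)

/-- The integrand varies at rate `2 L_f L_ψ` and the visitation distribution at rate `L_ν`. -/
theorem norm_Psi_sub_apply_le {Cν : ℝ} (h0 : 0 ≤ Cν) (hν : P.IsVisitationConstant Cν)
    (θ₁ θ₂ w : EuclideanSpace ℝ (Fin d)) :
    ‖P.Psi θ₁ w - P.Psi θ₂ w‖ ≤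
      (K.Lf ^ 2 * K.Lnu Cν + 2 * K.Lf * K.Lpsi) * ‖w‖ * ‖θ₁ - θ₂‖ := by
  have e : P.Psi θ₁ w - P.Psi θ₂ w =
      ∫ p, (P.psiSample θ₁ w p - P.psiSample θ₂ w p) ∂(P.actorLaw θ₁) +
      (∫ p, P.psiSample θ₂ w p ∂(P.actorLaw θ₁) - ∫ p, P.psiSample θ₂ w p ∂(P.actorLaw θ₂)) := by
    rw [integral_sub (integrable_psiSample hP hpolicy θ₁ θ₁ w)
      (integrable_psiSample hP hpolicy θ₂ θ₁ w), Psi_apply hP hpolicy, Psi_apply hP hpolicy]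
    abel
  have b2 := norm_integral_actorLaw_sub_le hP hpolicy henv h0 hν (hP.measurable_psiSample θ₂ w)
    (norm_psiSample_le hP hpolicy θ₂ w) (by positivity) θ₁ θ₂
  have b1 : ‖∫ p, (P.psiSample θ₁ w p - P.psiSample θ₂ w p) ∂(P.actorLaw θ₁)‖ ≤
      K.Lpsi * ‖θ₁ - θ₂‖ * (K.Lf * ‖w‖) + K.Lf * (K.Lpsi * ‖θ₁ - θ₂‖ * ‖w‖) := by
    refine hP.norm_integral_actorLaw_le (fun p => ?_) θ₁
    have e1 : P.psiSample θ₁ w p - P.psiSample θ₂ w p =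
        (P.gradPolicy θ₁ p.1 p.2 - P.gradPolicy θ₂ p.1 p.2) (P.jac θ₁ p.1 p.2 w) +
        P.gradPolicy θ₂ p.1 p.2 ((P.jac θ₁ p.1 p.2 - P.jac θ₂ p.1 p.2) w) := by
      simp [psiSample]
    have hL : 0 ≤ K.Lpsi * ‖θ₁ - θ₂‖ := mul_nonneg hpolicy.Lpsi_pos.le (norm_nonneg _)
    rw [e1]
    refine (norm_add_le _ _).trans (add_le_add ?_ ?_)
    · exact (ContinuousLinearMap.le_opNorm _ _).trans (mul_le_mul (hpolicy.smooth θ₁ θ₂ p.1 p.2)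
        ((ContinuousLinearMap.le_opNorm _ _).trans (mul_le_mul_of_nonneg_right
          (hpolicy.norm_jac_le θ₁ p.1 p.2) (norm_nonneg _))) (norm_nonneg _) hL)
    · exact (ContinuousLinearMap.le_opNorm _ _).trans (mul_le_mul
        (hpolicy.norm_gradPolicy_le θ₂ p.1 p.2)
        ((ContinuousLinearMap.le_opNorm _ _).trans (mul_le_mul_of_nonneg_right
          (hpolicy.norm_jac_sub_le θ₁ θ₂ p.1 p.2) (norm_nonneg _))) (norm_nonneg _)
        hpolicy.Lf_pos.le)
  rw [e]
  refine (norm_add_le _ _).trans ((add_le_add b1 b2).trans (le_of_eq ?_))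
  ring

/-- From `Ψ₁ (w₁ - w₂) = (∇J(θ₁) - ∇J(θ₂)) - (Ψ₁ - Ψ₂) w₂`, with `wᵢ` and `Ψᵢ` belonging to `θᵢ`. -/
theorem norm_wCompat_sub_le (hQ : P.QAssumption K) {Cν : ℝ} (h0 : 0 ≤ Cν)
    (hν : P.IsVisitationConstant Cν) (θ₁ θ₂ : EuclideanSpace ℝ (Fin d)) :
    ‖P.wCompat θ₁ - P.wCompat θ₂‖ ≤ K.Lw P.discount Cν * ‖θ₁ - θ₂‖ := by
  have e : P.Psi θ₁ (P.wCompat θ₁ - P.wCompat θ₂) = (P.gradJ θ₁ - P.gradJ θ₂) -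
      (P.Psi θ₁ (P.wCompat θ₂) - P.Psi θ₂ (P.wCompat θ₂)) := by
    rw [map_sub, Psi_wCompat hP hpolicy henv, Psi_wCompat hP hpolicy henv]
    abel
  have hl := hpolicy.lamPsi_pos
  have hγ := hP.one_sub_pos
  have hγ0 := hP.discount_nonneg
  have hu1 : 1 ≤ (1 - P.discount)⁻¹ := (one_le_inv₀ hγ).2 (by linarith)
  have pf := hpolicy.Lf_pos
  have pp := hpolicy.Lpsi_pos
  have hLnu := Lnu_nonneg hP hpolicy henv h0
  have b := le_norm_Psi hP hpolicy θ₁ (P.wCompat θ₁ - P.wCompat θ₂)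
  rw [e] at b
  have b2 := (norm_sub_le _ _).trans (add_le_add (norm_gradJ_sub_le hP hpolicy henv hQ h0 hν θ₁ θ₂)
    (norm_Psi_sub_apply_le hP hpolicy henv h0 hν θ₁ θ₂ (P.wCompat θ₂)))
  have b3 : (K.Lf ^ 2 * K.Lnu Cν + 2 * K.Lf * K.Lpsi) * ‖P.wCompat θ₂‖ ≤
      (K.Lf ^ 2 * K.Lnu Cν + 2 * K.Lf * K.Lpsi / (1 - P.discount)) * K.CwXi P.discount := by
    refine mul_le_mul ?_ (norm_wCompat_le hP hpolicy henv θ₂) (norm_nonneg _) (by positivity)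
    rw [div_eq_mul_inv]
    exact add_le_add le_rfl (le_mul_of_one_le_right (by positivity) hu1)
  have b4 := b.trans (b2.trans (add_le_add le_rfl
    (mul_le_mul_of_nonneg_right b3 (norm_nonneg (θ₁ - θ₂)))))
  rw [← mul_le_mul_iff_right₀ hl]
  refine b4.trans (le_of_eq ?_)
  rw [RPGConstants.Lw, RPGConstants.CwXi]
  field_simp

theorem Lw_pos (hQ : P.QAssumption K) {Cν : ℝ} (h0 : 0 ≤ Cν) : 0 < K.Lw P.discount Cν := by
  have hl := hpolicy.lamPsi_pos
  have hγ := hP.one_sub_pos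
  have pf := hpolicy.Lf_pos
  have pp := hpolicy.Lpsi_pos
  have hLnu := Lnu_nonneg hP hpolicy henv h0
  have hLJ := LJ_pos hP hpolicy henv hQ h0
  have hC := CQ_nonneg hP henv
  rw [RPGConstants.Lw]
  positivity

end Psi

end RPGProblem

/-! ### A uniform singular value bound from the eigenvalues -/

section SingularValues

variable {n : ℕ}

theorem Matrix.toEuclideanCLM_adjugate (A : Matrix (Fin n) (Fin n) ℝ)
    (v : EuclideanSpace ℝ (Fin n)) :
    Matrix.toEuclideanCLM (𝕜 := ℝ) A.adjugate (Matrix.toEuclideanCLM (𝕜 := ℝ) A v) =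
      A.det • v := by
  rw [← mul_apply_eq_comp, ← map_mul, Matrix.adjugate_mul, map_smul, map_one]
  rfl

/-- The determinant is the product of the complex eigenvalues with multiplicity. -/
theorem pow_le_abs_det_of_spectrum (A : Matrix (Fin n) (Fin n) ℝ) {c : ℝ} (hc : 0 ≤ c)
    (h : ∀ z ∈ spectrum ℂ (A.map (algebraMap ℝ ℂ)), c ≤ ‖z‖) : c ^ n ≤ |A.det| := by
  have h1 : ‖(A.map (algebraMap ℝ ℂ)).det‖ = |A.det| := by
    rw [← RingHom.mapMatrix_apply, ← RingHom.map_det]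
    simp
  rw [← h1, Matrix.det_eq_prod_roots_charpoly]
  set B := A.map (algebraMap ℝ ℂ)
  have hcard : Multiset.card B.charpoly.roots = n := by
    rw [← (IsAlgClosed.splits B.charpoly).natDegree_eq_card_roots,
      Matrix.charpoly_natDegree_eq_dim, Fintype.card_fin]
  have key : ∀ s : Multiset ℂ, (∀ z ∈ s, c ≤ ‖z‖) → c ^ Multiset.card s ≤ ‖s.prod‖ := by
    intro s
    induction s using Multiset.induction_on with
    | empty => simp
    | cons a s ih =>
      intro hs
      rw [Multiset.card_cons, Multiset.prod_cons, norm_mul, pow_succ']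
      exact mul_le_mul (hs a (Multiset.mem_cons_self a s))
        (ih fun z hz => hs z (Multiset.mem_cons_of_mem hz)) (pow_nonneg hc _) (norm_nonneg _)
  have h2 := key B.charpoly.roots fun z hz =>
    h z (Matrix.mem_spectrum_of_isRoot_charpoly (Polynomial.isRoot_of_mem_roots hz))
  rwa [hcard] at h2

/-- Matrices with bounded entries whose complex eigenvalues stay away from `0` have singular values
bounded away from `0`: the determinant is bounded below and the adjugate above. -/
theorem exists_singularValue_bound (B : ℝ) {c : ℝ} (hc : 0 < c) :
    ∃ s, 0 < s ∧ ∀ A : Matrix (Fin n) (Fin n) ℝ, (∀ i j, |A i j| ≤ B) →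
      (∀ z ∈ spectrum ℂ (A.map (algebraMap ℝ ℂ)), c ≤ ‖z‖) →
      ∀ v, s * ‖v‖ ≤ ‖Matrix.toEuclideanCLM (𝕜 := ℝ) A v‖ := by
  have hcomp : IsCompact (Set.univ.pi fun _ : Fin n => Set.univ.pi fun _ : Fin n =>
      Set.Icc (-B) B) :=
    isCompact_univ_pi fun _ => isCompact_univ_pi fun _ => isCompact_Icc
  have hcont : Continuous fun A : Matrix (Fin n) (Fin n) ℝ =>
      ‖Matrix.toEuclideanCLM (𝕜 := ℝ) A.adjugate‖ := by
    have h1 : Continuous fun A : Matrix (Fin n) (Fin n) ℝ =>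
        Matrix.toEuclideanCLM (n := Fin n) (𝕜 := ℝ) A :=
      LinearMap.continuous_of_finiteDimensional
        (Matrix.toEuclideanCLM (n := Fin n) (𝕜 := ℝ)).toAlgEquiv.toLinearMap
    exact (h1.comp (Continuous.matrix_adjugate continuous_id)).norm
  obtain ⟨C, hC⟩ := (hcomp.image hcont).bddAbove
  refine ⟨c ^ n / (|C| + 1), by positivity, fun A hA hsp v => ?_⟩
  have hAC : ‖Matrix.toEuclideanCLM (𝕜 := ℝ) A.adjugate‖ ≤ |C| + 1 := by
    have := hC (Set.mem_image_of_mem _ (Set.mem_univ_pi.2 fun i => Set.mem_univ_pi.2 fun j =>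
      Set.mem_Icc.2 (abs_le.1 (hA i j)) : A ∈ _))
    exact this.trans ((le_abs_self C).trans (by linarith))
  have h1 : |A.det| * ‖v‖ ≤ (|C| + 1) * ‖Matrix.toEuclideanCLM (𝕜 := ℝ) A v‖ := by
    rw [← Real.norm_eq_abs, ← norm_smul, ← Matrix.toEuclideanCLM_adjugate]
    exact (ContinuousLinearMap.le_opNorm _ _).trans (mul_le_mul_of_nonneg_right hAC (norm_nonneg _))
  rw [div_mul_eq_mul_div, div_le_iff₀ (by positivity), mul_comm _ (|C| + 1)]
  exact (mul_le_mul_of_nonneg_right (pow_le_abs_det_of_spectrum A hc.le hsp)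
    (norm_nonneg v)).trans h1

end SingularValues

/-! ### The stationary distribution -/

section LayerCake

variable {X : Type*} [MeasurableSpace X] {μ : Measure X} [IsFiniteMeasure μ] {g : X → ℝ}

/-- Layer cake formula on `[0, 1]`. -/
theorem integral_eq_setIntegral_real_lt (hg : Measurable g) (h0 : ∀ x, 0 ≤ g x)
    (h1 : ∀ x, g x ≤ 1) :
    ∫ x, g x ∂μ = ∫ u in Set.Ioc (0 : ℝ) 1, μ.real {x | u < g x} := by
  have hi : Integrable g μ := integrable_of_norm_le hg (C := 1) fun x => by
    rw [Real.norm_of_nonneg (h0 x)]; exact h1 x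
  rw [hi.integral_eq_integral_meas_lt (Eventually.of_forall h0)]
  refine setIntegral_eq_of_subset_of_forall_sdiff_eq_zero measurableSet_Ioi
    Set.Ioc_subset_Ioi_self fun u hu => ?_
  have : {x | u < g x} = ∅ := by
    ext x
    have : ¬ u ≤ 1 := fun h => hu.2 ⟨hu.1, h⟩
    simp only [Set.mem_ofPred_eq, Set.mem_empty_iff_false, iff_false, not_lt]
    linarith [h1 x]
  rw [this, measureReal_empty]

theorem measurable_real_lt : Measurable fun u : ℝ => μ.real {x | u < g x} :=
  Antitone.measurable fun _ _ h =>
    measureReal_mono (fun _ hx => lt_of_le_of_lt h hx) (measure_ne_top _ _)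

theorem integrableOn_real_lt :
    IntegrableOn (fun u : ℝ => μ.real {x | u < g x}) (Set.Ioc (0 : ℝ) 1) :=
  integrable_of_norm_le measurable_real_lt (C := μ.real Set.univ) fun u => by
    rw [Real.norm_of_nonneg measureReal_nonneg]
    exact measureReal_mono (Set.subset_univ _) (measure_ne_top _ _)

end LayerCake

namespace RPGProblem

variable {S N : Type*} [MeasurableSpace S] [MeasurableSpace N] {d m : ℕ}
  {P : RPGProblem S N d m} {K : RPGConstants} {R : ℝ}

theorem Standing.isStationaryLimit_statDist (hP : P.Standing R) (θ : EuclideanSpace ℝ (Fin d)) :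
    P.IsStationaryLimit θ (P.statDist θ) :=
  Classical.epsilon_spec (hP.ergodic θ)

theorem Standing.isProbabilityMeasure_statDist (hP : P.Standing R)
    (θ : EuclideanSpace ℝ (Fin d)) : IsProbabilityMeasure (P.statDist θ) :=
  (hP.isStationaryLimit_statDist θ).1

/-- For each set the probability is a limit of measurable functions of `θ`, namely time averages. -/
theorem Standing.measurable_statDist (hP : P.Standing R) : Measurable P.statDist := by
  have := hP.init_prob
  have hpr := hP.isProbabilityMeasure_statDist
  refine Measure.measurable_of_measurable_coe _ fun B hB => ?_
  have hm : ∀ T : ℕ, Measurable fun θ : EuclideanSpace ℝ (Fin d) =>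
      (∑ t ∈ Finset.range (T + 1), (P.stateLaw θ P.init t).real B) / T := by
    intro T
    refine (Finset.measurable_fun_sum _ fun t _ => ?_).div_const _
    have h := (hP.measurable_stateLaw (θ := fun θ : EuclideanSpace ℝ (Fin d) => θ) measurable_id
      (μ := fun _ => P.init) measurable_const (fun _ => hP.init_prob) t).1
    exact ((Measure.measurable_coe hB).comp h).ennreal_toReal
  have h1 : Measurable fun θ => (P.statDist θ).real B :=
    measurable_of_tendsto_metrizable hm
      (tendsto_pi_nhds.2 fun θ => (hP.isStationaryLimit_statDist θ).2 B hB)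
  have h2 : ∀ θ, P.statDist θ B = ENNReal.ofReal ((P.statDist θ).real B) := fun θ =>
    (ofReal_measureReal (measure_ne_top _ _)).symm
  simp_rw [h2]
  exact h1.ennreal_ofReal

/-- Setwise convergence of the time averages carries over to bounded functions, by the layer cake
formula and dominated convergence. -/
theorem Standing.tendsto_average_integral (hP : P.Standing R) (θ : EuclideanSpace ℝ (Fin d))
    {g : S → ℝ} (hg : Measurable g) (h0 : ∀ x, 0 ≤ g x) (h1 : ∀ x, g x ≤ 1) :
    Tendsto (fun T : ℕ =>
      (∑ t ∈ Finset.range (T + 1), ∫ s, g s ∂(P.stateLaw θ P.init t)) / T)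
      atTop (𝓝 (∫ s, g s ∂(P.statDist θ))) := by
  have := hP.init_prob
  have hpr := hP.isProbabilityMeasure_statDist θ
  have hst := fun t => hP.isProbabilityMeasure_stateLaw θ P.init t
  have e : ∀ T : ℕ, (∑ t ∈ Finset.range (T + 1), ∫ s, g s ∂(P.stateLaw θ P.init t)) / T =
      ∫ u in Set.Ioc (0 : ℝ) 1,
        (∑ t ∈ Finset.range (T + 1), (P.stateLaw θ P.init t).real {x | u < g x}) / T := by
    intro T
    rw [integral_div, integral_finsetSum _ fun t _ => integrableOn_real_lt]
    simp_rw [integral_eq_setIntegral_real_lt hg h0 h1]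
  simp_rw [e]
  rw [integral_eq_setIntegral_real_lt hg h0 h1]
  refine tendsto_integral_of_dominated_convergence (fun _ => (2 : ℝ)) (fun T => ?_)
    (integrable_const _) (fun T => ?_) (Eventually.of_forall fun u => ?_)
  · exact ((Finset.measurable_fun_sum _ fun t _ =>
      measurable_real_lt).div_const _).aestronglyMeasurable
  · refine Eventually.of_forall fun u => ?_
    rw [Real.norm_of_nonneg (div_nonneg (Finset.sum_nonneg fun _ _ => measureReal_nonneg)
      (Nat.cast_nonneg T))]
    rcases Nat.eq_zero_or_pos T with rfl | hT
    · simp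
    have hT' : (1 : ℝ) ≤ T := by exact_mod_cast hT
    rw [div_le_iff₀ (by linarith)]
    calc _ ≤ ∑ t ∈ Finset.range (T + 1), (1 : ℝ) :=
          Finset.sum_le_sum fun t _ => measureReal_le_one
      _ ≤ 2 * T := by
          rw [Finset.sum_const, Finset.card_range]
          simp only [nsmul_eq_mul, mul_one, Nat.cast_add, Nat.cast_one]
          linarith
  · exact (hP.isStationaryLimit_statDist θ).2 _ (measurableSet_lt measurable_const hg)

theorem Standing.real_bind_transition (hP : P.Standing R) (θ : EuclideanSpace ℝ (Fin d))
    (μ : Measure S) [IsProbabilityMeasure μ] {B : Set S} (hB : MeasurableSet B) :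
    (μ.bind (P.transition θ)).real B = ∫ s, (P.transition θ s).real B ∂μ := by
  have hm := hP.measurable_transition θ
  have hp := hP.isProbabilityMeasure_transition θ
  rw [measureReal_def, Measure.bind_apply hB hm.aemeasurable]
  exact (integral_toReal ((Measure.measurable_coe hB).comp hm).aemeasurable
    (Eventually.of_forall fun s => measure_lt_top _ _)).symm

/-- Invariance of the stationary distribution, which is only given as a setwise limit of averages:
the limit is tested against the bounded function `s ↦ P_θ(s, B)`. -/
theorem Standing.statDist_bind_transition (hP : P.Standing R) (θ : EuclideanSpace ℝ (Fin d)) :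
    (P.statDist θ).bind (P.transition θ) = P.statDist θ := by
  have := hP.init_prob
  have hpr := hP.isProbabilityMeasure_statDist θ
  have hst := fun t => hP.isProbabilityMeasure_stateLaw θ P.init t
  have hm := hP.measurable_transition θ
  have hp := hP.isProbabilityMeasure_transition θ
  have hpb : IsProbabilityMeasure ((P.statDist θ).bind (P.transition θ)) :=
    isProbabilityMeasure_bind_of_measurable hm hp
  ext B hB
  rw [← measureReal_eq_measureReal_iff, hP.real_bind_transition θ _ hB]
  have hg : Measurable fun s => (P.transition θ s).real B :=
    ((Measure.measurable_coe hB).comp hm).ennreal_toReal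
  have t1 := hP.tendsto_average_integral θ hg (fun _ => measureReal_nonneg)
    (fun _ => measureReal_le_one)
  have t2 := (hP.isStationaryLimit_statDist θ).2 B hB
  -- the averages of the law at times `1, …, T + 1` and at times `0, …, T` differ by `O(1 / T)`
  have e : ∀ T : ℕ, (∑ t ∈ Finset.range (T + 1),
      ∫ s, (P.transition θ s).real B ∂(P.stateLaw θ P.init t)) / T =
      (∑ t ∈ Finset.range (T + 1), (P.stateLaw θ P.init t).real B) / T +
        ((P.stateLaw θ P.init (T + 1)).real B - P.init.real B) * (T : ℝ)⁻¹ := by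
    intro T
    have h1 : ∀ t, ∫ s, (P.transition θ s).real B ∂(P.stateLaw θ P.init t) =
        (P.stateLaw θ P.init (t + 1)).real B := fun t =>
      (hP.real_bind_transition θ _ hB).symm
    have h2 := Finset.sum_range_sub (fun t => (P.stateLaw θ P.init t).real B) (T + 1)
    rw [Finset.sum_sub_distrib] at h2
    have h3 : (P.stateLaw θ P.init 0).real B = P.init.real B := rfl
    simp_rw [h1]
    rw [← div_eq_mul_inv, ← add_div]
    congr 1
    linarith
  have t3 : Tendsto (fun T : ℕ => ((P.stateLaw θ P.init (T + 1)).real B - P.init.real B) *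
      (T : ℝ)⁻¹) atTop (𝓝 0) := by
    refine bdd_le_mul_tendsto_zero' 1 (Eventually.of_forall fun T => ?_)
      tendsto_inv_atTop_nhds_zero_nat
    have a1 := measureReal_le_one (μ := P.stateLaw θ P.init (T + 1)) (s := B)
    have a2 := measureReal_le_one (μ := P.init) (s := B)
    have a3 := measureReal_nonneg (μ := P.stateLaw θ P.init (T + 1)) (s := B)
    have a4 := measureReal_nonneg (μ := P.init) (s := B)
    rw [abs_le]; constructor <;> linarith
  simp_rw [e] at t1
  have t4 := t2.add t3
  rw [add_zero] at t4
  exact tendsto_nhds_unique t1 t4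

end RPGProblem

/-! ### The law of the critic samples -/

namespace RPGProblem

variable {S N : Type*} [MeasurableSpace S] [MeasurableSpace N] {d m : ℕ}
  {P : RPGProblem S N d m} {K : RPGConstants} {R : ℝ}

/-- The law of `(x, r, x')` given the state, the noise, the next state and the reward. -/
noncomputable def transLawNext (P : RPGProblem S N d m)
    (p : ((EuclideanSpace ℝ (Fin d) × S) × N) × (S × ℝ)) :
    Measure ((S × EuclideanSpace ℝ (Fin m)) × ℝ × (S × EuclideanSpace ℝ (Fin m))) :=
  P.noise.map fun ε' => ((p.1.1.2, P.policy p.1.1.1 p.1.1.2 p.1.2), p.2.2,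
    (p.2.1, P.policy p.1.1.1 p.2.1 ε'))

/-- The law of `(x, r, x')` given the state and the noise. -/
noncomputable def transLawNoise (P : RPGProblem S N d m)
    (p : (EuclideanSpace ℝ (Fin d) × S) × N) :
    Measure ((S × EuclideanSpace ℝ (Fin m)) × ℝ × (S × EuclideanSpace ℝ (Fin m))) :=
  (P.step (p.1.2, P.policy p.1.1 p.1.2 p.2)).bind fun y => P.transLawNext (p, y)

/-- The law of `(x, r, x')` given the state. -/
noncomputable def transLawState (P : RPGProblem S N d m) (p : EuclideanSpace ℝ (Fin d) × S) :
    Measure ((S × EuclideanSpace ℝ (Fin m)) × ℝ × (S × EuclideanSpace ℝ (Fin m))) :=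
  P.noise.bind fun ε => P.transLawNoise (p, ε)

theorem transLaw_eq (θ : EuclideanSpace ℝ (Fin d)) :
    P.transLaw θ = (P.statDist θ).bind fun s => P.transLawState (θ, s) := rfl

theorem Standing.measurable_transLawNext_map (hP : P.Standing R) :
    Measurable fun q : (((EuclideanSpace ℝ (Fin d) × S) × N) × (S × ℝ)) × N =>
      ((q.1.1.1.2, P.policy q.1.1.1.1 q.1.1.1.2 q.1.1.2), q.1.2.2,
        (q.1.2.1, P.policy q.1.1.1.1 q.1.2.1 q.2)) := by
  have h1 : Measurable fun q : (((EuclideanSpace ℝ (Fin d) × S) × N) × (S × ℝ)) × N =>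
      (q.1.1.1.1, q.1.1.1.2, q.1.1.2) := by fun_prop
  have h2 : Measurable fun q : (((EuclideanSpace ℝ (Fin d) × S) × N) × (S × ℝ)) × N =>
      (q.1.1.1.1, q.1.2.1, q.2) := by fun_prop
  have h3 := hP.policy_meas.comp h1
  have h4 := hP.policy_meas.comp h2
  have h5 : Measurable fun q : (((EuclideanSpace ℝ (Fin d) × S) × N) × (S × ℝ)) × N =>
      q.1.1.1.2 := by fun_prop
  have h6 : Measurable fun q : (((EuclideanSpace ℝ (Fin d) × S) × N) × (S × ℝ)) × N =>
      q.1.2.2 := by fun_prop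
  have h7 : Measurable fun q : (((EuclideanSpace ℝ (Fin d) × S) × N) × (S × ℝ)) × N =>
      q.1.2.1 := by fun_prop
  exact (h5.prodMk h3).prodMk (h6.prodMk (h7.prodMk h4))

theorem Standing.measurable_transLawNext (hP : P.Standing R) : Measurable P.transLawNext :=
  have := hP.noise_prob
  measurable_map_param (μ := fun _ => P.noise) measurable_const hP.measurable_transLawNext_map

theorem Standing.isProbabilityMeasure_transLawNext (hP : P.Standing R)
    (p : ((EuclideanSpace ℝ (Fin d) × S) × N) × (S × ℝ)) :
    IsProbabilityMeasure (P.transLawNext p) :=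
  have := hP.noise_prob
  Measure.isProbabilityMeasure_map
    (hP.measurable_transLawNext_map.comp measurable_prodMk_left).aemeasurable

theorem Standing.measurable_policy_triple (hP : P.Standing R) :
    Measurable fun p : (EuclideanSpace ℝ (Fin d) × S) × N =>
      (p.1.2, P.policy p.1.1 p.1.2 p.2) := by
  have h1 : Measurable fun p : (EuclideanSpace ℝ (Fin d) × S) × N => (p.1.1, p.1.2, p.2) := by
    fun_prop
  have h2 := hP.policy_meas.comp h1
  exact (measurable_snd.comp measurable_fst).prodMk h2

theorem Standing.measurable_transLawNoise (hP : P.Standing R) : Measurable P.transLawNoise := by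
  have := hP.markov
  have h := P.step.measurable.comp hP.measurable_policy_triple
  have h2 := measurable_bind_param (μ := fun p : (EuclideanSpace ℝ (Fin d) × S) × N =>
    P.step (p.1.2, P.policy p.1.1 p.1.2 p.2)) h (κ := P.transLawNext) hP.measurable_transLawNext
  exact h2

theorem Standing.isProbabilityMeasure_transLawNoise (hP : P.Standing R)
    (p : (EuclideanSpace ℝ (Fin d) × S) × N) : IsProbabilityMeasure (P.transLawNoise p) :=
  have := hP.markov
  isProbabilityMeasure_bind_of_measurable
    (hP.measurable_transLawNext.comp measurable_prodMk_left)
    fun _ => hP.isProbabilityMeasure_transLawNext _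

theorem Standing.measurable_transLawState (hP : P.Standing R) : Measurable P.transLawState := by
  have := hP.noise_prob
  have h2 := measurable_bind_param (μ := fun _ : EuclideanSpace ℝ (Fin d) × S => P.noise)
    measurable_const (κ := P.transLawNoise) hP.measurable_transLawNoise
  exact h2

theorem Standing.isProbabilityMeasure_transLawState (hP : P.Standing R)
    (p : EuclideanSpace ℝ (Fin d) × S) : IsProbabilityMeasure (P.transLawState p) :=
  have := hP.noise_prob
  isProbabilityMeasure_bind_of_measurable
    (hP.measurable_transLawNoise.comp measurable_prodMk_left)
    fun _ => hP.isProbabilityMeasure_transLawNoise _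

theorem Standing.measurable_transLaw (hP : P.Standing R) : Measurable P.transLaw := by
  have := hP.isProbabilityMeasure_statDist
  have h2 := measurable_bind_param hP.measurable_statDist (κ := P.transLawState)
    hP.measurable_transLawState
  exact h2

theorem Standing.isProbabilityMeasure_transLaw (hP : P.Standing R)
    (θ : EuclideanSpace ℝ (Fin d)) : IsProbabilityMeasure (P.transLaw θ) := by
  have := hP.isProbabilityMeasure_statDist θ
  have m1 : Measurable fun s => P.transLawState (θ, s) :=
    hP.measurable_transLawState.comp measurable_prodMk_left
  rw [transLaw_eq]
  exact isProbabilityMeasure_bind_of_measurable m1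
    fun _ => hP.isProbabilityMeasure_transLawState _

theorem Standing.lintegral_transLaw (hP : P.Standing R) (θ : EuclideanSpace ℝ (Fin d))
    {G : (S × EuclideanSpace ℝ (Fin m)) × ℝ × (S × EuclideanSpace ℝ (Fin m)) → ENNReal}
    (hG : Measurable G) :
    ∫⁻ z, G z ∂(P.transLaw θ) = ∫⁻ s, ∫⁻ ε, ∫⁻ y, ∫⁻ ε',
      G ((s, P.policy θ s ε), y.2, (y.1, P.policy θ y.1 ε')) ∂P.noise
        ∂(P.step (s, P.policy θ s ε)) ∂P.noise ∂(P.statDist θ) := by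
  have m1 : Measurable fun s => P.transLawState (θ, s) :=
    hP.measurable_transLawState.comp measurable_prodMk_left
  have m2 : ∀ s, Measurable fun ε => P.transLawNoise ((θ, s), ε) := fun s =>
    hP.measurable_transLawNoise.comp measurable_prodMk_left
  have m3 : ∀ s ε, Measurable fun y => P.transLawNext (((θ, s), ε), y) := fun s ε =>
    hP.measurable_transLawNext.comp measurable_prodMk_left
  rw [transLaw_eq, Measure.lintegral_bind m1.aemeasurable hG.aemeasurable]
  refine lintegral_congr fun s => ?_
  rw [transLawState, Measure.lintegral_bind (m2 s).aemeasurable hG.aemeasurable]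
  refine lintegral_congr fun ε => ?_
  rw [transLawNoise, Measure.lintegral_bind (m3 s ε).aemeasurable hG.aemeasurable]
  refine lintegral_congr fun y => ?_
  rw [transLawNext, lintegral_map hG]
  exact hP.measurable_transLawNext_map.comp measurable_prodMk_left

/-- By stationarity, `x'` has the same law as `x`. -/
theorem Standing.lintegral_transLaw_next (hP : P.Standing R) (θ : EuclideanSpace ℝ (Fin d))
    {G : S × EuclideanSpace ℝ (Fin m) → ENNReal} (hG : Measurable G) :
    ∫⁻ z, G z.2.2 ∂(P.transLaw θ) = ∫⁻ z, G z.1 ∂(P.transLaw θ) := by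
  have := hP.noise_prob
  have := hP.markov
  rw [hP.lintegral_transLaw θ (G := fun z => G z.2.2)
      (hG.comp (measurable_snd.comp measurable_snd)),
    hP.lintegral_transLaw θ (G := fun z => G z.1) (hG.comp measurable_fst)]
  simp only [lintegral_const, measure_univ, mul_one]
  set H : S → ENNReal := fun s => ∫⁻ ε, G (s, P.policy θ s ε) ∂P.noise with hHdef
  have hH : Measurable H :=
    Measurable.lintegral_prod_right' (ν := P.noise)
      (hG.comp (measurable_fst.prodMk (hP.measurable_policy_prod θ)))
  have hm := hP.measurable_transition θ
  have e : ∀ s, ∫⁻ ε, ∫⁻ y, H y.1 ∂(P.step (s, P.policy θ s ε)) ∂P.noise =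
      ∫⁻ x, H x ∂(P.transition θ s) := by
    intro s
    rw [transition, Measure.lintegral_bind (hP.measurable_nextState_noise θ s).aemeasurable
      hH.aemeasurable]
    refine lintegral_congr fun ε => ?_
    rw [nextState, lintegral_map hH measurable_fst]
  calc _ = ∫⁻ s, ∫⁻ x, H x ∂(P.transition θ s) ∂(P.statDist θ) := lintegral_congr e
    _ = ∫⁻ s, H s ∂(P.statDist θ) := by
      rw [← Measure.lintegral_bind hm.aemeasurable hH.aemeasurable, hP.statDist_bind_transition]

section Critic

variable (hP : P.Standing K.Rmax) (hphi : P.FeatureAssumption K)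

include hP hphi

/-- Almost every sample has bounded features and a bounded reward. -/
theorem ae_transLaw (θ : EuclideanSpace ℝ (Fin d)) :
    ∀ᵐ z ∂(P.transLaw θ), ‖P.feature z.1‖ ≤ K.Cphi ∧ ‖P.feature z.2.2‖ ≤ K.Cphi ∧
      |z.2.1| ≤ K.Rmax := by
  have hf := hP.feature_meas
  have hset : MeasurableSet {z : (S × EuclideanSpace ℝ (Fin m)) × ℝ ×
      (S × EuclideanSpace ℝ (Fin m)) | ‖P.feature z.1‖ ≤ K.Cphi ∧ ‖P.feature z.2.2‖ ≤ K.Cphi ∧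
      |z.2.1| ≤ K.Rmax} := by
    refine MeasurableSet.inter (measurableSet_le ((hf.comp measurable_fst).norm)
      measurable_const) (MeasurableSet.inter (measurableSet_le
      ((hf.comp (measurable_snd.comp measurable_snd)).norm) measurable_const) (measurableSet_le
      ((measurable_fst.comp measurable_snd).norm) measurable_const))
  have m1 : Measurable fun s => P.transLawState (θ, s) :=
    hP.measurable_transLawState.comp measurable_prodMk_left
  have m2 : ∀ s, Measurable fun ε => P.transLawNoise ((θ, s), ε) := fun s =>
    hP.measurable_transLawNoise.comp measurable_prodMk_left
  have m3 : ∀ s ε, Measurable fun y => P.transLawNext (((θ, s), ε), y) := fun s ε =>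
    hP.measurable_transLawNext.comp measurable_prodMk_left
  rw [transLaw_eq]
  refine ae_bind_of_ae_ae m1 hset (Eventually.of_forall fun s => ?_)
  refine ae_bind_of_ae_ae (m2 s) hset (Eventually.of_forall fun ε => ?_)
  refine ae_bind_of_ae_ae (m3 s ε) hset ?_
  filter_upwards [hP.reward_bound s _ (hP.policy_mem θ s ε)] with y hy
  have hmm := hP.measurable_transLawNext_map.comp
    (measurable_prodMk_left (x := (((θ, s), ε), y)))
  refine (ae_map_iff hmm.aemeasurable hset).2 ?_
  exact Eventually.of_forall fun ε' => ⟨hphi.bounded s _ (hP.policy_mem θ s ε),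
    hphi.bounded y.1 _ (hP.policy_mem θ y.1 ε'), hy⟩

end Critic

/-- The sample `(γ φ(x')ᵀ v - φ(x)ᵀ v) φ(x)` of `A_θ v`. -/
noncomputable def critSample (P : RPGProblem S N d m) (v : EuclideanSpace ℝ (Fin d))
    (z : (S × EuclideanSpace ℝ (Fin m)) × ℝ × (S × EuclideanSpace ℝ (Fin m))) :
    EuclideanSpace ℝ (Fin d) :=
  (P.discount * inner ℝ (P.feature z.2.2) v - inner ℝ (P.feature z.1) v) • P.feature z.1

theorem tdError_smul_eq (w : EuclideanSpace ℝ (Fin d))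
    (z : (S × EuclideanSpace ℝ (Fin m)) × ℝ × (S × EuclideanSpace ℝ (Fin m))) :
    P.tdError w z • P.feature z.1 = P.critSample w z + z.2.1 • P.feature z.1 := by
  rw [tdError, critSample, ← add_smul]; congr 1; ring

theorem Standing.measurable_feature_fst (hP : P.Standing R) :
    Measurable fun z : (S × EuclideanSpace ℝ (Fin m)) × ℝ × (S × EuclideanSpace ℝ (Fin m)) =>
      P.feature z.1 := hP.feature_meas.comp measurable_fst

theorem Standing.measurable_feature_next (hP : P.Standing R) :
    Measurable fun z : (S × EuclideanSpace ℝ (Fin m)) × ℝ × (S × EuclideanSpace ℝ (Fin m)) =>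
      P.feature z.2.2 := hP.feature_meas.comp (measurable_snd.comp measurable_snd)

theorem Standing.measurable_critSample (hP : P.Standing R) (v : EuclideanSpace ℝ (Fin d)) :
    Measurable (P.critSample v) := by
  have h1 := hP.measurable_feature_next.inner_const (𝕜 := ℝ) (c := v)
  have h2 := hP.measurable_feature_fst.inner_const (𝕜 := ℝ) (c := v)
  exact ((h1.const_mul P.discount).sub h2).smul hP.measurable_feature_fst

theorem Standing.measurable_rewardSample (hP : P.Standing R) :
    Measurable fun z : (S × EuclideanSpace ℝ (Fin m)) × ℝ × (S × EuclideanSpace ℝ (Fin m)) =>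
      z.2.1 • P.feature z.1 :=
  (measurable_fst.comp measurable_snd).smul hP.measurable_feature_fst

section Critic

variable (hP : P.Standing K.Rmax) (hphi : P.FeatureAssumption K)

include hP hphi

theorem ae_norm_critSample_le (θ v : EuclideanSpace ℝ (Fin d)) :
    ∀ᵐ z ∂(P.transLaw θ), ‖P.critSample v z‖ ≤ K.CA * ‖v‖ := by
  filter_upwards [ae_transLaw hP hphi θ] with z hz
  have hc := hphi.Cphi_pos
  have b1 : |P.discount * inner ℝ (P.feature z.2.2) v| ≤ K.Cphi * ‖v‖ := by
    rw [abs_mul, abs_of_nonneg hP.discount_nonneg]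
    exact (mul_le_of_le_one_left (abs_nonneg _) hP.discount_lt_one.le).trans
      ((abs_real_inner_le_norm _ _).trans (mul_le_mul_of_nonneg_right hz.2.1 (norm_nonneg _)))
  have b2 : |inner ℝ (P.feature z.1) v| ≤ K.Cphi * ‖v‖ :=
    (abs_real_inner_le_norm _ _).trans (mul_le_mul_of_nonneg_right hz.1 (norm_nonneg _))
  rw [critSample, norm_smul, RPGConstants.CA]
  calc _ ≤ (K.Cphi * ‖v‖ + K.Cphi * ‖v‖) * K.Cphi :=
        mul_le_mul ((abs_sub _ _).trans (add_le_add b1 b2)) hz.1 (norm_nonneg _) (by positivity)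
    _ = _ := by ring

theorem ae_norm_rewardSample_le (θ : EuclideanSpace ℝ (Fin d)) :
    ∀ᵐ z ∂(P.transLaw θ), ‖z.2.1 • P.feature z.1‖ ≤ K.Cb := by
  filter_upwards [ae_transLaw hP hphi θ] with z hz
  rw [norm_smul, RPGConstants.Cb]
  exact mul_le_mul hz.2.2 hz.1 (norm_nonneg _) hP.Rmax_nonneg

theorem integrable_critSample (θ v : EuclideanSpace ℝ (Fin d)) :
    Integrable (P.critSample v) (P.transLaw θ) :=
  have := hP.isProbabilityMeasure_transLaw θ
  Integrable.of_bound (hP.measurable_critSample v).aestronglyMeasurable _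
    (ae_norm_critSample_le hP hphi θ v)

theorem integrable_rewardSample (θ : EuclideanSpace ℝ (Fin d)) :
    Integrable (fun z => z.2.1 • P.feature z.1) (P.transLaw θ) :=
  have := hP.isProbabilityMeasure_transLaw θ
  Integrable.of_bound hP.measurable_rewardSample.aestronglyMeasurable _
    (ae_norm_rewardSample_le hP hphi θ)

theorem norm_critb_le (θ : EuclideanSpace ℝ (Fin d)) : ‖P.critb θ‖ ≤ K.Cb := by
  have := hP.isProbabilityMeasure_transLaw θ
  have h := norm_integral_le_of_norm_le_const (ae_norm_rewardSample_le hP hphi θ)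
  rwa [probReal_univ, mul_one] at h

theorem integrable_critA_entry (θ : EuclideanSpace ℝ (Fin d)) (i j : Fin d) :
    Integrable (fun z => P.feature z.1 i * (P.discount * P.feature z.2.2 j - P.feature z.1 j))
      (P.transLaw θ) ∧ |P.critA θ i j| ≤ K.CA := by
  have := hP.isProbabilityMeasure_transLaw θ
  have hc := hphi.Cphi_pos
  have hap : ∀ (v : EuclideanSpace ℝ (Fin d)) (i : Fin d), |v i| ≤ ‖v‖ := fun v i => by
    rw [← Real.norm_eq_abs]; exact PiLp.norm_apply_le v i
  have hco : ∀ i : Fin d, Measurable fun v : EuclideanSpace ℝ (Fin d) => v i := fun i =>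
    (EuclideanSpace.proj (𝕜 := ℝ) i).continuous.measurable
  have hb : ∀ᵐ z ∂(P.transLaw θ),
      ‖P.feature z.1 i * (P.discount * P.feature z.2.2 j - P.feature z.1 j)‖ ≤ K.CA := by
    filter_upwards [ae_transLaw hP hphi θ] with z hz
    have b1 : |P.discount * P.feature z.2.2 j| ≤ K.Cphi := by
      rw [abs_mul, abs_of_nonneg hP.discount_nonneg]
      exact (mul_le_of_le_one_left (abs_nonneg _) hP.discount_lt_one.le).trans
        ((hap _ _).trans hz.2.1)
    have b2 : |P.feature z.1 j| ≤ K.Cphi := (hap _ _).trans hz.1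
    rw [norm_mul, RPGConstants.CA]
    calc _ ≤ K.Cphi * (K.Cphi + K.Cphi) :=
          mul_le_mul ((hap _ _).trans hz.1) ((abs_sub _ _).trans (add_le_add b1 b2))
            (abs_nonneg _) hc.le
      _ = _ := by ring
  have hm : Measurable fun z : (S × EuclideanSpace ℝ (Fin m)) × ℝ ×
      (S × EuclideanSpace ℝ (Fin m)) =>
      P.feature z.1 i * (P.discount * P.feature z.2.2 j - P.feature z.1 j) :=
    ((hco i).comp hP.measurable_feature_fst).mul
      ((((hco j).comp hP.measurable_feature_next).const_mul _).sub
        ((hco j).comp hP.measurable_feature_fst))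
  refine ⟨Integrable.of_bound hm.aestronglyMeasurable _ hb, ?_⟩
  have h := norm_integral_le_of_norm_le_const hb
  rw [probReal_univ, mul_one] at h
  exact h

theorem critA_apply (θ v : EuclideanSpace ℝ (Fin d)) :
    Matrix.toEuclideanCLM (𝕜 := ℝ) (P.critA θ) v = ∫ z, P.critSample v z ∂(P.transLaw θ) := by
  ext i
  have h1 := (EuclideanSpace.proj (𝕜 := ℝ) i).integral_comp_comm
    (integrable_critSample hP hphi θ v)
  simp only [EuclideanSpace.coe_proj] at h1
  rw [← h1, Matrix.ofLp_toEuclideanCLM, Matrix.mulVec, dotProduct]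
  have h2 : ∀ j, P.critA θ i j * v j = ∫ z, P.feature z.1 i *
      (P.discount * P.feature z.2.2 j - P.feature z.1 j) * v j ∂(P.transLaw θ) := fun j => by
    rw [integral_mul_const]; rfl
  simp_rw [h2]
  rw [← integral_finsetSum _ fun j _ =>
    (integrable_critA_entry hP hphi θ i j).1.mul_const _]
  refine integral_congr_ae (Eventually.of_forall fun z => ?_)
  simp only [critSample, PiLp.smul_apply, smul_eq_mul, PiLp.inner_apply, RCLike.inner_apply,
    conj_trivial, Finset.mul_sum, ← Finset.sum_sub_distrib, Finset.sum_mul]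
  exact Finset.sum_congr rfl fun j _ => by ring

theorem norm_critA_apply_le (θ v : EuclideanSpace ℝ (Fin d)) :
    ‖Matrix.toEuclideanCLM (𝕜 := ℝ) (P.critA θ) v‖ ≤ K.CA * ‖v‖ := by
  have := hP.isProbabilityMeasure_transLaw θ
  rw [critA_apply hP hphi]
  simpa using norm_integral_le_of_norm_le_const (ae_norm_critSample_le hP hphi θ v)

/-- The eigenvalues of `A_θ` are bounded below, and its entries are bounded by `C_A`. -/
theorem exists_isSingularValueBound : ∃ sA, 0 < sA ∧ P.IsSingularValueBound sA := by
  obtain ⟨s, hs, h⟩ := exists_singularValue_bound (n := d) K.CA hphi.lamA_pos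
  exact ⟨s, hs, fun θ v => h (P.critA θ) (fun i j => (integrable_critA_entry hP hphi θ i j).2)
    (hphi.critA_eigenvalues θ) v⟩

/-- With `X = φ(x)ᵀ v` and `X' = γ φ(x')ᵀ v`, stationarity gives `E X'² ≤ E X²`; hence
`vᵀ A_θ v ≤ -(1 - γ) E X²` by the inequality of the means, while `‖A_θ v‖² ≤ 4 C_φ² E X²`. The
singular value bound for `A_θ` thus bounds `E X²` from below uniformly in `θ`. -/
theorem exists_isDissipationConstant : ∃ lam, 0 < lam ∧ P.IsDissipationConstant lam := by
  obtain ⟨sA, hs, hsA⟩ := exists_isSingularValueBound hP hphi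
  have hc := hphi.Cphi_pos
  have hγ := hP.one_sub_pos
  have hγ0 := hP.discount_nonneg
  refine ⟨(1 - P.discount) * (sA ^ 2 / (4 * K.Cphi ^ 2)), by positivity, fun θ v => ?_⟩
  have := hP.isProbabilityMeasure_transLaw θ
  have hXm : Measurable fun p : S × EuclideanSpace ℝ (Fin m) =>
      (inner ℝ (P.feature p) v : ℝ) := hP.feature_meas.inner_const
  set X : (S × EuclideanSpace ℝ (Fin m)) × ℝ × (S × EuclideanSpace ℝ (Fin m)) → ℝ :=
    fun z => inner ℝ (P.feature z.1) v with hX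
  set Y : (S × EuclideanSpace ℝ (Fin m)) × ℝ × (S × EuclideanSpace ℝ (Fin m)) → ℝ :=
    fun z => inner ℝ (P.feature z.2.2) v with hY
  have mX : Measurable X := hXm.comp measurable_fst
  have mY : Measurable Y := hXm.comp (measurable_snd.comp measurable_snd)
  have bX : ∀ᵐ z ∂(P.transLaw θ), |X z| ≤ K.Cphi * ‖v‖ := by
    filter_upwards [ae_transLaw hP hphi θ] with z hz using
      (abs_real_inner_le_norm _ _).trans (mul_le_mul_of_nonneg_right hz.1 (norm_nonneg _))
  have bY : ∀ᵐ z ∂(P.transLaw θ), |Y z| ≤ K.Cphi * ‖v‖ := by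
    filter_upwards [ae_transLaw hP hphi θ] with z hz using
      (abs_real_inner_le_norm _ _).trans (mul_le_mul_of_nonneg_right hz.2.1 (norm_nonneg _))
  have iX2 : Integrable (fun z => X z ^ 2) (P.transLaw θ) :=
    Integrable.of_bound (mX.pow_const 2).aestronglyMeasurable ((K.Cphi * ‖v‖) ^ 2) (by
      filter_upwards [bX] with z hz
      rw [norm_pow]; exact pow_le_pow_left₀ (norm_nonneg _) hz 2)
  have iY2 : Integrable (fun z => Y z ^ 2) (P.transLaw θ) :=
    Integrable.of_bound (mY.pow_const 2).aestronglyMeasurable ((K.Cphi * ‖v‖) ^ 2) (by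
      filter_upwards [bY] with z hz
      rw [norm_pow]; exact pow_le_pow_left₀ (norm_nonneg _) hz 2)
  have hst : ∫ z, Y z ^ 2 ∂(P.transLaw θ) = ∫ z, X z ^ 2 ∂(P.transLaw θ) := by
    rw [integral_eq_lintegral_of_nonneg_ae (Eventually.of_forall fun z => sq_nonneg _)
      iY2.aestronglyMeasurable, integral_eq_lintegral_of_nonneg_ae
      (Eventually.of_forall fun z => sq_nonneg _) iX2.aestronglyMeasurable]
    congr 1
    exact hP.lintegral_transLaw_next θ
      (G := fun p => ENNReal.ofReal ((inner ℝ (P.feature p) v : ℝ) ^ 2))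
      (hXm.pow_const 2).ennreal_ofReal
  set q := ∫ z, X z ^ 2 ∂(P.transLaw θ) with hq
  have hcs := integrable_critSample hP hphi θ v
  -- the quadratic form
  have h1 : inner ℝ v (Matrix.toEuclideanCLM (𝕜 := ℝ) (P.critA θ) v) ≤ -(1 - P.discount) * q := by
    rw [critA_apply hP hphi, ← integral_inner hcs]
    have hle : ∫ z, inner ℝ v (P.critSample v z) ∂(P.transLaw θ) ≤
        ∫ z, (P.discount / 2 * Y z ^ 2 - (1 - P.discount / 2) * X z ^ 2) ∂(P.transLaw θ) := by
      refine integral_mono (hcs.const_inner v)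
        ((iY2.const_mul _).sub (iX2.const_mul _)) fun z => ?_
      have : (inner ℝ v (P.critSample v z) : ℝ) = (P.discount * Y z - X z) * X z := by
        rw [critSample, inner_smul_right, real_inner_comm (P.feature z.1) v]
      simp only [this]
      nlinarith [mul_nonneg hγ0 (sq_nonneg (Y z - X z))]
    rw [integral_sub (iY2.const_mul _) (iX2.const_mul _), integral_const_mul, integral_const_mul,
      hst] at hle
    linarith
  -- the norm
  have h2 : ‖Matrix.toEuclideanCLM (𝕜 := ℝ) (P.critA θ) v‖ ^ 2 ≤ 4 * K.Cphi ^ 2 * q := by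
    have iZ : Integrable (fun z => |P.discount * Y z - X z|) (P.transLaw θ) :=
      Integrable.of_bound ((mY.const_mul _).sub mX).norm.aestronglyMeasurable
        (K.Cphi * ‖v‖ + K.Cphi * ‖v‖) (by
        filter_upwards [bX, bY] with z hx hy
        rw [Real.norm_eq_abs, abs_abs]
        refine (abs_sub _ _).trans (add_le_add ?_ hx)
        rw [abs_mul, abs_of_nonneg hγ0]
        exact (mul_le_of_le_one_left (abs_nonneg _) hP.discount_lt_one.le).trans hy)
    have iZ2 : Integrable (fun z => |P.discount * Y z - X z| ^ 2) (P.transLaw θ) := by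
      refine ((iY2.const_mul 2).add (iX2.const_mul 2)).mono'
        (((mY.const_mul _).sub mX).norm.pow_const 2).aestronglyMeasurable
        (Eventually.of_forall fun z => ?_)
      rw [norm_pow, Real.norm_eq_abs, abs_abs, sq_abs, Pi.add_apply]
      have : P.discount ^ 2 ≤ 1 := pow_le_one₀ hγ0 hP.discount_lt_one.le
      nlinarith [sq_nonneg (P.discount * Y z + X z), mul_nonneg (sub_nonneg.2 this)
        (sq_nonneg (Y z))]
    have b1 : ‖Matrix.toEuclideanCLM (𝕜 := ℝ) (P.critA θ) v‖ ≤
        K.Cphi * ∫ z, |P.discount * Y z - X z| ∂(P.transLaw θ) := by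
      rw [critA_apply hP hphi, ← integral_const_mul]
      refine norm_integral_le_of_norm_le (iZ.const_mul _) ?_
      filter_upwards [ae_transLaw hP hphi θ] with z hz
      rw [critSample, norm_smul, mul_comm]
      exact mul_le_mul_of_nonneg_right hz.1 (norm_nonneg _)
    have b2 : (∫ z, |P.discount * Y z - X z| ∂(P.transLaw θ)) ^ 2 ≤
        ∫ z, |P.discount * Y z - X z| ^ 2 ∂(P.transLaw θ) := by
      -- the variance of `|γ Y - X|` is nonnegative
      set e := ∫ z, |P.discount * Y z - X z| ∂(P.transLaw θ) with he
      have h0 : 0 ≤ ∫ z, (|P.discount * Y z - X z| - e) ^ 2 ∂(P.transLaw θ) :=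
        integral_nonneg fun z => sq_nonneg _
      have hexp : ∫ z, (|P.discount * Y z - X z| - e) ^ 2 ∂(P.transLaw θ) =
          ∫ z, |P.discount * Y z - X z| ^ 2 ∂(P.transLaw θ) - 2 * e * e + e ^ 2 := by
        have : ∀ z, (|P.discount * Y z - X z| - e) ^ 2 =
            |P.discount * Y z - X z| ^ 2 - 2 * e * |P.discount * Y z - X z| + e ^ 2 :=
          fun z => by ring
        simp_rw [this]
        have i5 : Integrable (fun z => |P.discount * Y z - X z| ^ 2 -
            2 * e * |P.discount * Y z - X z|) (P.transLaw θ) := iZ2.sub (iZ.const_mul _)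
        rw [integral_add i5 (integrable_const _), integral_sub iZ2 (iZ.const_mul _),
          integral_const_mul, ← he]
        simp
      nlinarith
    have b3 : ∫ z, |P.discount * Y z - X z| ^ 2 ∂(P.transLaw θ) ≤ 4 * q := by
      have hle : ∫ z, |P.discount * Y z - X z| ^ 2 ∂(P.transLaw θ) ≤
          ∫ z, (2 * Y z ^ 2 + 2 * X z ^ 2) ∂(P.transLaw θ) := by
        refine integral_mono iZ2 ((iY2.const_mul 2).add (iX2.const_mul 2)) fun z => ?_
        simp only [sq_abs]
        have : P.discount ^ 2 ≤ 1 := pow_le_one₀ hγ0 hP.discount_lt_one.le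
        nlinarith [sq_nonneg (P.discount * Y z + X z), mul_nonneg (sub_nonneg.2 this)
          (sq_nonneg (Y z))]
      rw [integral_add (iY2.const_mul 2) (iX2.const_mul 2), integral_const_mul,
        integral_const_mul, hst] at hle
      linarith
    calc _ ≤ (K.Cphi * ∫ z, |P.discount * Y z - X z| ∂(P.transLaw θ)) ^ 2 :=
          pow_le_pow_left₀ (norm_nonneg _) b1 2
      _ = K.Cphi ^ 2 * (∫ z, |P.discount * Y z - X z| ∂(P.transLaw θ)) ^ 2 := by ring
      _ ≤ K.Cphi ^ 2 * (4 * q) := mul_le_mul_of_nonneg_left (b2.trans b3) (sq_nonneg _)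
      _ = _ := by ring
  have h3 : sA ^ 2 * ‖v‖ ^ 2 ≤ 4 * K.Cphi ^ 2 * q := by
    rw [← mul_pow]
    exact (pow_le_pow_left₀ (by positivity) (hsA θ v) 2).trans h2
  have h4 : sA ^ 2 / (4 * K.Cphi ^ 2) * ‖v‖ ^ 2 ≤ q := by
    rw [div_mul_eq_mul_div, div_le_iff₀ (by positivity)]; linarith
  have h5 := mul_le_mul_of_nonneg_left h4 hγ.le
  linarith

theorem critA_wTD (θ : EuclideanSpace ℝ (Fin d)) :
    Matrix.toEuclideanCLM (𝕜 := ℝ) (P.critA θ) (P.wTD θ) = -P.critb θ := by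
  rw [wTD, map_neg, ← mul_apply_eq_comp, ← map_mul,
    Matrix.mul_nonsing_inv _ (hphi.critA_nonsingular θ), map_one]
  rfl

theorem norm_wTD_le {sA : ℝ} (hs : 0 < sA) (h : P.IsSingularValueBound sA)
    (θ : EuclideanSpace ℝ (Fin d)) : ‖P.wTD θ‖ ≤ K.Cw sA := by
  have h1 := h θ (P.wTD θ)
  rw [critA_wTD hP hphi, norm_neg] at h1
  rw [RPGConstants.Cw, le_div_iff₀ hs, mul_comm]
  exact h1.trans (norm_critb_le hP hphi θ)

end Critic

/-- Nothing makes `w*_θ` continuous in `θ`, but it is measurable, by the adjugate formula for the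
inverse. -/
theorem Standing.measurable_wTD (hP : P.Standing R) : Measurable P.wTD := by
  have hpr := hP.isProbabilityMeasure_transLaw
  have hco : ∀ i : Fin d, Measurable fun v : EuclideanSpace ℝ (Fin d) => v i := fun i =>
    (EuclideanSpace.proj (𝕜 := ℝ) i).continuous.measurable
  have hA : ∀ i j, Measurable fun θ => P.critA θ i j := fun i j =>
    measurable_integral_param hP.measurable_transLaw hpr
      (f := fun p : EuclideanSpace ℝ (Fin d) × ((S × EuclideanSpace ℝ (Fin m)) × ℝ ×
        (S × EuclideanSpace ℝ (Fin m))) => P.feature p.2.1 i *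
          (P.discount * P.feature p.2.2.2 j - P.feature p.2.1 j))
      ((((hco i).comp hP.measurable_feature_fst).mul
        ((((hco j).comp hP.measurable_feature_next).const_mul _).sub
          ((hco j).comp hP.measurable_feature_fst))).comp measurable_snd)
  have hb : Measurable P.critb := by
    let k : Kernel (EuclideanSpace ℝ (Fin d)) ((S × EuclideanSpace ℝ (Fin m)) × ℝ ×
      (S × EuclideanSpace ℝ (Fin m))) := ⟨P.transLaw, hP.measurable_transLaw⟩
    have hk : IsMarkovKernel k := ⟨hpr⟩
    have hr : StronglyMeasurable fun p : EuclideanSpace ℝ (Fin d) ×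
        ((S × EuclideanSpace ℝ (Fin m)) × ℝ × (S × EuclideanSpace ℝ (Fin m))) =>
        p.2.2.1 • P.feature p.2.1 :=
      (hP.measurable_rewardSample.comp measurable_snd).stronglyMeasurable
    exact (hr.integral_kernel_prod_right' (κ := k)).measurable
  have hAm : Measurable fun θ => (fun i j => P.critA θ i j : Fin d → Fin d → ℝ) :=
    measurable_pi_iff.2 fun i => measurable_pi_iff.2 fun j => hA i j
  have hof : Continuous fun A : Fin d → Fin d → ℝ => (Matrix.of A : Matrix (Fin d) (Fin d) ℝ) :=
    continuous_id
  have hdet : Measurable fun θ => (P.critA θ).det := hof.matrix_det.measurable.comp hAm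
  have hadj : ∀ i j, Measurable fun θ => (P.critA θ).adjugate i j := fun i j =>
    (hof.matrix_adjugate.matrix_elem i j).measurable.comp hAm
  have hinv : ∀ i j, Measurable fun θ => ((P.critA θ)⁻¹ : Matrix (Fin d) (Fin d) ℝ) i j := by
    intro i j
    simp_rw [Matrix.inv_def, Matrix.smul_apply, Ring.inverse_eq_inv', smul_eq_mul]
    exact hdet.inv.mul (hadj i j)
  refine Measurable.neg ?_
  refine (MeasurableEquiv.toLp 2 (Fin d → ℝ)).measurable.comp (f := fun θ =>
    (P.critA θ)⁻¹.mulVec (P.critb θ).ofLp) (measurable_pi_iff.2 fun i => ?_)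
  simp_rw [Matrix.mulVec, dotProduct]
  exact Finset.measurable_fun_sum _ fun j _ => (hinv i j).mul ((hco j).comp hb)

end RPGProblem

/-! ### Empirical means of independent samples -/

section EmpiricalMean

variable {X F : Type*} [MeasurableSpace X] [NormedAddCommGroup F] [InnerProductSpace ℝ F]
  [FiniteDimensional ℝ F] [MeasurableSpace F] [BorelSpace F] {μ : Measure X}
  [IsProbabilityMeasure μ] {M : ℕ} {f : X → F} {α C : ℝ}

theorem ae_norm_empiricalMean_le (hα : 0 ≤ α) (hC : 0 ≤ C) (h : ∀ᵐ x ∂μ, ‖f x‖ ≤ C) :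
    ∀ᵐ ω ∂(Measure.pi fun _ : Fin M => μ), ‖(α / M) • ∑ j, f (ω j)‖ ≤ α * C := by
  filter_upwards [ae_pi_forall h] with ω hω
  rw [norm_smul]
  have h2 : ‖∑ j, f (ω j)‖ ≤ M * C :=
    (norm_sum_le _ _).trans ((Finset.sum_le_sum fun j _ => hω j).trans (by simp))
  rcases Nat.eq_zero_or_pos M with rfl | hM
  · simp only [CharP.cast_eq_zero, div_zero, norm_zero, zero_mul]; positivity
  · have hM' : (0:ℝ) < M := by exact_mod_cast hM
    rw [Real.norm_of_nonneg (by positivity)]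
    calc α / M * ‖∑ j, f (ω j)‖ ≤ α / M * (M * C) := by gcongr
      _ = _ := by field_simp

theorem measurable_empiricalMean (hm : Measurable f) :
    Measurable fun ω : Fin M → X => (α / M) • ∑ j, f (ω j) :=
  Measurable.fun_const_smul
    (Finset.measurable_fun_sum _ fun j _ => hm.comp (measurable_pi_apply j)) _

theorem integrable_empiricalMean (hm : Measurable f) (hα : 0 ≤ α) (hC : 0 ≤ C)
    (h : ∀ᵐ x ∂μ, ‖f x‖ ≤ C) :
    Integrable (fun ω : Fin M → X => (α / M) • ∑ j, f (ω j)) (Measure.pi fun _ : Fin M => μ) :=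
  have := FiniteDimensional.proper_real F
  Integrable.of_bound (measurable_empiricalMean hm).aestronglyMeasurable _
    (ae_norm_empiricalMean_le hα hC h)

theorem integrable_norm_empiricalMean_sq (hm : Measurable f) (hα : 0 ≤ α) (hC : 0 ≤ C)
    (h : ∀ᵐ x ∂μ, ‖f x‖ ≤ C) :
    Integrable (fun ω : Fin M → X => ‖(α / M) • ∑ j, f (ω j)‖ ^ 2)
      (Measure.pi fun _ : Fin M => μ) := by
  have := FiniteDimensional.proper_real F
  refine Integrable.of_bound ((measurable_empiricalMean hm).norm.pow_const 2).aestronglyMeasurable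
    ((α * C) ^ 2) ?_
  filter_upwards [ae_norm_empiricalMean_le hα hC h] with ω hω
  rw [Real.norm_of_nonneg (by positivity)]
  exact pow_le_pow_left₀ (norm_nonneg _) hω 2

/-- For `M = 0` the left-hand side would be `0`. -/
theorem integral_empiricalMean (hm : Measurable f) (hf : Integrable f μ) (hM : M ≠ 0) :
    ∫ ω, (α / M) • ∑ j, f (ω j) ∂(Measure.pi fun _ : Fin M => μ) = α • ∫ x, f x ∂μ := by
  have := FiniteDimensional.proper_real F
  have hM' : (M : ℝ) ≠ 0 := by exact_mod_cast hM
  rw [integral_smul, integral_pi_sum hm hf, smul_smul, div_mul_cancel₀ _ hM']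

/-- The second moment of an empirical mean is that of its expectation, up to a variance term that
decays with the batch size. -/
theorem integral_norm_empiricalMean_sq_le (hm : Measurable f) (hf : MemLp f 2 μ)
    (hM : M ≠ 0) (h : ∫ x, ‖f x‖ ^ 2 ∂μ ≤ C) :
    ∫ ω, ‖(α / M) • ∑ j, f (ω j)‖ ^ 2 ∂(Measure.pi fun _ : Fin M => μ) ≤
      α ^ 2 * (‖∫ x, f x ∂μ‖ ^ 2 + C / M) := by
  have := FiniteDimensional.proper_real F
  have hM' : (0:ℝ) < M := by exact_mod_cast Nat.pos_of_ne_zero hM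
  simp_rw [norm_smul, mul_pow, Real.norm_eq_abs, sq_abs]
  rw [integral_const_mul]
  have h1 := (integral_pi_norm_sum_sq_le (M := M) hm hf).trans
    (add_le_add_right (mul_le_mul_of_nonneg_left h hM'.le) _)
  calc (α / M) ^ 2 * ∫ ω, ‖∑ j, f (ω j)‖ ^ 2 ∂(Measure.pi fun _ : Fin M => μ)
      ≤ (α / M) ^ 2 * ((M:ℝ) ^ 2 * ‖∫ x, f x ∂μ‖ ^ 2 + M * C) := by gcongr
    _ = _ := by field_simp

end EmpiricalMean

/-! ### The Markov chain of the iterates -/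

namespace RPGProblem

variable {S N : Type*} [MeasurableSpace S] [MeasurableSpace N] {d m : ℕ}
  {P : RPGProblem S N d m} {K : RPGConstants} {R : ℝ}

/-- The joint law of the critic batch and the actor batch at parameter `θ`. -/
noncomputable def batchLaw (P : RPGProblem S N d m) (M : ℕ) (θ : EuclideanSpace ℝ (Fin d)) :
    Measure ((Fin M → (S × EuclideanSpace ℝ (Fin m)) × ℝ × (S × EuclideanSpace ℝ (Fin m))) ×
      (Fin M → S × N)) :=
  (Measure.pi fun _ : Fin M => P.transLaw θ).prod (Measure.pi fun _ : Fin M => P.actorLaw θ)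

theorem stepLaw_eq (αw αθ : ℝ) (M : ℕ) (x : EuclideanSpace ℝ (Fin d) × EuclideanSpace ℝ (Fin d)) :
    P.stepLaw αw αθ M x = (P.batchLaw M x.1).map fun y => P.update αw αθ M x y.1 y.2 := rfl

theorem Standing.isProbabilityMeasure_batchLaw (hP : P.Standing R) (M : ℕ)
    (θ : EuclideanSpace ℝ (Fin d)) : IsProbabilityMeasure (P.batchLaw M θ) := by
  have := hP.isProbabilityMeasure_transLaw θ
  have := hP.isProbabilityMeasure_actorLaw θ
  unfold batchLaw
  infer_instance

theorem Standing.measurable_batchLaw (hP : P.Standing R) (M : ℕ) :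
    Measurable (P.batchLaw M) := by
  have h1 := hP.isProbabilityMeasure_transLaw
  have h2 := hP.isProbabilityMeasure_actorLaw
  have h3 := hP.noise_prob
  have h4 := hP.isProbabilityMeasure_visitDist
  have h5 : Measurable P.actorLaw :=
    measurable_prod_param (ν := fun _ => P.noise) hP.measurable_visitDist measurable_const
  have h6 := measurable_prod_param (measurable_pi_param hP.measurable_transLaw M)
    (measurable_pi_param h5 M)
  exact h6

theorem Standing.measurable_gradPolicy_jac (hP : P.Standing R) :
    Measurable fun q : (EuclideanSpace ℝ (Fin d) × EuclideanSpace ℝ (Fin d)) × S × N =>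
      P.gradPolicy q.1.1 q.2.1 q.2.2 (P.jac q.1.1 q.2.1 q.2.2 q.1.2) := by
  have m0 : Measurable fun q : (EuclideanSpace ℝ (Fin d) × EuclideanSpace ℝ (Fin d)) × S × N =>
      (q.1.1, q.2.1, q.2.2) := by fun_prop
  have m1 : ∀ u, Measurable fun q : (EuclideanSpace ℝ (Fin d) × EuclideanSpace ℝ (Fin d)) ×
      S × N => P.jac q.1.1 q.2.1 q.2.2 u := fun u => (hP.measurable_jac_apply u).comp m0
  have m2 := measurable_apply_of_apply m1 (measurable_snd.comp measurable_fst)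
  refine measurable_of_inner fun v => ?_
  have h : ∀ q : (EuclideanSpace ℝ (Fin d) × EuclideanSpace ℝ (Fin d)) × S × N,
      (inner ℝ v (P.gradPolicy q.1.1 q.2.1 q.2.2 (P.jac q.1.1 q.2.1 q.2.2 q.1.2)) : ℝ) =
        inner ℝ (P.jac q.1.1 q.2.1 q.2.2 v) (P.jac q.1.1 q.2.1 q.2.2 q.1.2) := fun q =>
    ContinuousLinearMap.adjoint_inner_right _ _ _
  simp_rw [h]
  exact (m1 v).inner m2

theorem Standing.measurable_update (hP : P.Standing R) (αw αθ : ℝ) (M : ℕ) :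
    Measurable fun q : (EuclideanSpace ℝ (Fin d) × EuclideanSpace ℝ (Fin d)) ×
      ((Fin M → (S × EuclideanSpace ℝ (Fin m)) × ℝ × (S × EuclideanSpace ℝ (Fin m))) ×
        (Fin M → S × N)) => P.update αw αθ M q.1 q.2.1 q.2.2 := by
  refine Measurable.prodMk ?_ ?_
  · refine (measurable_fst.comp measurable_fst).add (Measurable.fun_const_smul
      (Finset.measurable_fun_sum _ fun j _ => ?_) _)
    have h1 : Measurable fun q : (EuclideanSpace ℝ (Fin d) × EuclideanSpace ℝ (Fin d)) ×
      ((Fin M → (S × EuclideanSpace ℝ (Fin m)) × ℝ × (S × EuclideanSpace ℝ (Fin m))) ×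
        (Fin M → S × N)) => (q.1, q.2.2 j) := by fun_prop
    have h2 := hP.measurable_gradPolicy_jac.comp h1
    exact h2
  · refine (measurable_snd.comp measurable_fst).add (Measurable.fun_const_smul
      (Finset.measurable_fun_sum _ fun j _ => ?_) _)
    have h0 : Measurable fun q : (EuclideanSpace ℝ (Fin d) × EuclideanSpace ℝ (Fin d)) ×
      ((Fin M → (S × EuclideanSpace ℝ (Fin m)) × ℝ × (S × EuclideanSpace ℝ (Fin m))) ×
        (Fin M → S × N)) => q.2.1 j := by fun_prop
    have h1 := hP.measurable_feature_fst.comp h0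
    have h2 := hP.measurable_feature_next.comp h0
    have h3 : Measurable fun q : (EuclideanSpace ℝ (Fin d) × EuclideanSpace ℝ (Fin d)) ×
      ((Fin M → (S × EuclideanSpace ℝ (Fin m)) × ℝ × (S × EuclideanSpace ℝ (Fin m))) ×
        (Fin M → S × N)) => q.1.2 := by fun_prop
    have h4 : Measurable fun q : (EuclideanSpace ℝ (Fin d) × EuclideanSpace ℝ (Fin d)) ×
      ((Fin M → (S × EuclideanSpace ℝ (Fin m)) × ℝ × (S × EuclideanSpace ℝ (Fin m))) ×
        (Fin M → S × N)) => (q.2.1 j).2.1 := by fun_prop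
    exact ((h4.add ((h2.inner h3).const_mul P.discount)).sub (h1.inner h3)).smul h1

theorem Standing.measurable_update_left (hP : P.Standing R) (αw αθ : ℝ) (M : ℕ)
    (x : EuclideanSpace ℝ (Fin d) × EuclideanSpace ℝ (Fin d)) :
    Measurable fun y : (Fin M → (S × EuclideanSpace ℝ (Fin m)) × ℝ ×
      (S × EuclideanSpace ℝ (Fin m))) × (Fin M → S × N) => P.update αw αθ M x y.1 y.2 := by
  have h := (hP.measurable_update αw αθ M).comp (measurable_prodMk_left (x := x))
  exact h

theorem Standing.measurable_stepLaw (hP : P.Standing R) (αw αθ : ℝ) (M : ℕ) :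
    Measurable (P.stepLaw αw αθ M) := by
  have h1 : ∀ x : EuclideanSpace ℝ (Fin d) × EuclideanSpace ℝ (Fin d),
      IsProbabilityMeasure (P.batchLaw M x.1) := fun x => hP.isProbabilityMeasure_batchLaw M x.1
  have h2 := measurable_map_param (μ := fun x : EuclideanSpace ℝ (Fin d) ×
    EuclideanSpace ℝ (Fin d) => P.batchLaw M x.1) ((hP.measurable_batchLaw M).comp measurable_fst)
    (hP.measurable_update αw αθ M)
  exact h2

theorem Standing.isProbabilityMeasure_stepLaw (hP : P.Standing R) (αw αθ : ℝ) (M : ℕ)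
    (x : EuclideanSpace ℝ (Fin d) × EuclideanSpace ℝ (Fin d)) :
    IsProbabilityMeasure (P.stepLaw αw αθ M x) := by
  have := hP.isProbabilityMeasure_batchLaw M x.1
  have h := hP.measurable_update_left αw αθ M x
  rw [stepLaw_eq]
  exact Measure.isProbabilityMeasure_map h.aemeasurable

theorem Standing.isProbabilityMeasure_iterateLaw (hP : P.Standing R) (αw αθ : ℝ) (M : ℕ)
    (θ₀ w₀ : EuclideanSpace ℝ (Fin d)) (t : ℕ) :
    IsProbabilityMeasure (P.iterateLaw αw αθ M θ₀ w₀ t) := by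
  induction t with
  | zero => exact inferInstanceAs (IsProbabilityMeasure (Measure.dirac (θ₀, w₀)))
  | succ t ih =>
    exact isProbabilityMeasure_bind_of_measurable (hP.measurable_stepLaw αw αθ M)
      (hP.isProbabilityMeasure_stepLaw αw αθ M)

/-- The critic weights are bounded after one step, almost surely. -/
theorem ae_norm_snd_stepLaw_le (hP : P.Standing K.Rmax) (hphi : P.FeatureAssumption K)
    {αw : ℝ} (hα : 0 ≤ αw) (αθ : ℝ) (M : ℕ)
    (x : EuclideanSpace ℝ (Fin d) × EuclideanSpace ℝ (Fin d)) {W : ℝ} (hW : ‖x.2‖ ≤ W) :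
    ∀ᵐ y ∂(P.stepLaw αw αθ M x), ‖y.2‖ ≤ W + αw * (K.CA * W + K.Cb) := by
  have hprob := hP.isProbabilityMeasure_transLaw x.1
  have hprob' := hP.isProbabilityMeasure_actorLaw x.1
  have hm := hP.measurable_update_left αw αθ M x
  have hCA : 0 ≤ K.CA := by unfold RPGConstants.CA; positivity
  have hCb : 0 ≤ K.Cb := mul_nonneg hP.Rmax_nonneg hphi.Cphi_pos.le
  have hW0 : 0 ≤ W := (norm_nonneg _).trans hW
  have key : ∀ᵐ z ∂(P.transLaw x.1), ‖P.tdError x.2 z • P.feature z.1‖ ≤ K.CA * W + K.Cb := by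
    filter_upwards [ae_norm_critSample_le hP hphi x.1 x.2, ae_norm_rewardSample_le hP hphi x.1]
      with z h1 h2
    rw [tdError_smul_eq]
    refine (norm_add_le _ _).trans (add_le_add (h1.trans ?_) h2)
    exact mul_le_mul_of_nonneg_left hW hCA
  have h1 : ∀ᵐ b ∂(P.batchLaw M x.1),
      ‖(αw / M) • ∑ j, P.tdError x.2 (b.1 j) • P.feature (b.1 j).1‖ ≤ αw * (K.CA * W + K.Cb) :=
    Measure.quasiMeasurePreserving_fst.ae (ae_norm_empiricalMean_le hα (by positivity) key)
  rw [stepLaw_eq, ae_map_iff hm.aemeasurable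
    (measurableSet_le measurable_snd.norm measurable_const)]
  filter_upwards [h1] with b hb using (norm_add_le _ _).trans (add_le_add hW hb)

/-- Along the iteration the critic weights are almost surely bounded, by a constant that may depend
on the number of steps. This gives all integrability along the iteration. -/
theorem exists_ae_norm_snd_iterateLaw_le (hP : P.Standing K.Rmax) (hphi : P.FeatureAssumption K)
    {αw : ℝ} (hα : 0 ≤ αw) (αθ : ℝ) (M : ℕ) (θ₀ w₀ : EuclideanSpace ℝ (Fin d)) (t : ℕ) :
    ∃ W, ∀ᵐ x ∂(P.iterateLaw αw αθ M θ₀ w₀ t), ‖x.2‖ ≤ W := by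
  induction t with
  | zero =>
    refine ⟨‖w₀‖, ?_⟩
    exact (ae_dirac_iff (measurableSet_le measurable_snd.norm measurable_const)).2 le_rfl
  | succ t ih =>
    obtain ⟨W, hW⟩ := ih
    refine ⟨W + αw * (K.CA * W + K.Cb), ?_⟩
    refine ae_bind_of_ae_ae (hP.measurable_stepLaw αw αθ M)
      (measurableSet_le measurable_snd.norm measurable_const) ?_
    filter_upwards [hW] with x hx using ae_norm_snd_stepLaw_le hP hphi hα αθ M x hx

theorem continuous_gradJ (hP : P.Standing K.Rmax) (hpolicy : P.PolicyAssumption K)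
    (henv : P.EnvironmentAssumption K) (hQ : P.QAssumption K) {Cν : ℝ} (h0 : 0 ≤ Cν)
    (hν : P.IsVisitationConstant Cν) : Continuous P.gradJ :=
  (LipschitzWith.of_dist_le_mul (K := ⟨K.LJ P.discount Cν, (LJ_pos hP hpolicy henv hQ h0).le⟩)
    fun x y => by
      rw [dist_eq_norm, dist_eq_norm]
      exact norm_gradJ_sub_le hP hpolicy henv hQ h0 hν x y).continuous

end RPGProblem

/-! ### One iteration of the actor and of the critic -/

namespace RPGProblem

variable {S N : Type*} [MeasurableSpace S] [MeasurableSpace N] {d m : ℕ}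
  {P : RPGProblem S N d m} {K : RPGConstants} {R : ℝ}

theorem Lh_nonneg : 0 ≤ K.Lh := sq_nonneg _

theorem CA_nonneg : 0 ≤ K.CA := by unfold RPGConstants.CA; positivity

theorem update_fst_sub (αw αθ : ℝ) (M : ℕ)
    (x : EuclideanSpace ℝ (Fin d) × EuclideanSpace ℝ (Fin d))
    (y : Fin M → (S × EuclideanSpace ℝ (Fin m)) × ℝ × (S × EuclideanSpace ℝ (Fin m)))
    (y' : Fin M → S × N) :
    (P.update αw αθ M x y y').1 - x.1 = (αθ / M) • ∑ j, P.psiSample x.1 x.2 (y' j) :=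
  add_sub_cancel_left _ _

theorem update_snd_sub (αw αθ : ℝ) (M : ℕ)
    (x : EuclideanSpace ℝ (Fin d) × EuclideanSpace ℝ (Fin d))
    (y : Fin M → (S × EuclideanSpace ℝ (Fin m)) × ℝ × (S × EuclideanSpace ℝ (Fin m)))
    (y' : Fin M → S × N) :
    (P.update αw αθ M x y y').2 - x.2 =
      (αw / M) • ∑ j, (P.critSample x.2 (y j) + (y j).2.1 • P.feature (y j).1) := by
  simp_rw [← tdError_smul_eq]
  exact add_sub_cancel_left _ _

section Actor

variable (hP : P.Standing K.Rmax) (hpolicy : P.PolicyAssumption K)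
  {αw αθ : ℝ} (hα : 0 ≤ αθ) {M : ℕ}
  (x : EuclideanSpace ℝ (Fin d) × EuclideanSpace ℝ (Fin d))

include hP hpolicy hα

theorem integrable_update_fst_sub :
    Integrable (fun b => (P.update αw αθ M x b.1 b.2).1 - x.1) (P.batchLaw M x.1) := by
  have := hP.isProbabilityMeasure_transLaw x.1
  have := hP.isProbabilityMeasure_actorLaw x.1
  simp_rw [update_fst_sub]
  have h := integrable_empiricalMean (M := M) (μ := P.actorLaw x.1)
    (hP.measurable_psiSample x.1 x.2) hα
    (by positivity) (Eventually.of_forall (norm_psiSample_le hP hpolicy x.1 x.2))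
  exact h.comp_snd _

theorem integrable_norm_update_fst_sub_sq :
    Integrable (fun b => ‖(P.update αw αθ M x b.1 b.2).1 - x.1‖ ^ 2) (P.batchLaw M x.1) := by
  have := hP.isProbabilityMeasure_transLaw x.1
  have := hP.isProbabilityMeasure_actorLaw x.1
  simp_rw [update_fst_sub]
  have h := integrable_norm_empiricalMean_sq (M := M) (μ := P.actorLaw x.1)
    (hP.measurable_psiSample x.1 x.2) hα
    (by positivity) (Eventually.of_forall (norm_psiSample_le hP hpolicy x.1 x.2))
  exact h.comp_snd _

theorem integral_inner_update_fst_sub (hM : M ≠ 0) (g : EuclideanSpace ℝ (Fin d)) :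
    ∫ b, inner ℝ g ((P.update αw αθ M x b.1 b.2).1 - x.1) ∂(P.batchLaw M x.1) =
      αθ * inner ℝ g (P.Psi x.1 x.2) := by
  have := hP.isProbabilityMeasure_transLaw x.1
  have := hP.isProbabilityMeasure_actorLaw x.1
  rw [integral_inner (integrable_update_fst_sub hP hpolicy hα x)]
  simp_rw [update_fst_sub]
  rw [batchLaw, integral_fun_snd (fun ω : Fin M → S × N => (αθ / M) •
    ∑ j, P.psiSample x.1 x.2 (ω j)), probReal_univ, one_smul,
    integral_empiricalMean (hP.measurable_psiSample x.1 x.2)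
      (integrable_psiSample hP hpolicy x.1 x.1 x.2) hM, ← Psi_apply hP hpolicy,
    real_inner_smul_right]

theorem integral_norm_update_fst_sub_sq_le (hM : M ≠ 0) :
    ∫ b, ‖(P.update αw αθ M x b.1 b.2).1 - x.1‖ ^ 2 ∂(P.batchLaw M x.1) ≤
      αθ ^ 2 * (‖P.Psi x.1 x.2‖ ^ 2 + K.Lh ^ 2 * ‖x.2‖ ^ 2 / M) := by
  have := hP.isProbabilityMeasure_transLaw x.1
  have := hP.isProbabilityMeasure_actorLaw x.1
  have hb := norm_psiSample_le hP hpolicy x.1 x.2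
  have hmem : MemLp (P.psiSample x.1 x.2) 2 (P.actorLaw x.1) :=
    MemLp.of_bound (hP.measurable_psiSample x.1 x.2).aestronglyMeasurable _
      (Eventually.of_forall hb)
  have h2 : ∫ p, ‖P.psiSample x.1 x.2 p‖ ^ 2 ∂(P.actorLaw x.1) ≤ K.Lh ^ 2 * ‖x.2‖ ^ 2 := by
    rw [← mul_pow]
    have h3 := norm_integral_le_of_norm_le_prob (μ := P.actorLaw x.1)
      (f := fun p => ‖P.psiSample x.1 x.2 p‖ ^ 2) (C := (K.Lh * ‖x.2‖) ^ 2) fun p => by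
        rw [Real.norm_of_nonneg (by positivity)]
        exact pow_le_pow_left₀ (norm_nonneg _) (hb p) 2
    exact (Real.le_norm_self _).trans h3
  simp_rw [update_fst_sub]
  rw [batchLaw, integral_fun_snd (fun ω : Fin M → S × N => ‖(αθ / M) •
    ∑ j, P.psiSample x.1 x.2 (ω j)‖ ^ 2), probReal_univ, one_smul, Psi_apply hP hpolicy]
  exact integral_norm_empiricalMean_sq_le (hP.measurable_psiSample x.1 x.2) hmem hM h2

end Actor

section CriticStep

variable (hP : P.Standing K.Rmax) (hphi : P.FeatureAssumption K)
  {αw αθ : ℝ} (hα : 0 ≤ αw) {M : ℕ}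
  (x : EuclideanSpace ℝ (Fin d) × EuclideanSpace ℝ (Fin d))

theorem Standing.measurable_criticSample (hP : P.Standing R) (v : EuclideanSpace ℝ (Fin d)) :
    Measurable fun z : (S × EuclideanSpace ℝ (Fin m)) × ℝ × (S × EuclideanSpace ℝ (Fin m)) =>
      P.critSample v z + z.2.1 • P.feature z.1 :=
  (hP.measurable_critSample v).add hP.measurable_rewardSample

include hP hphi

theorem Cb_nonneg : 0 ≤ K.Cb := mul_nonneg hP.Rmax_nonneg hphi.Cphi_pos.le

theorem ae_norm_criticSample_le (θ v : EuclideanSpace ℝ (Fin d)) :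
    ∀ᵐ z ∂(P.transLaw θ), ‖P.critSample v z + z.2.1 • P.feature z.1‖ ≤ K.CA * ‖v‖ + K.Cb := by
  filter_upwards [ae_norm_critSample_le hP hphi θ v, ae_norm_rewardSample_le hP hphi θ]
    with z h1 h2 using (norm_add_le _ _).trans (add_le_add h1 h2)

/-- The mean TD direction `A_θ v + b_θ`, rewritten with `A_θ w*_θ = -b_θ`. -/
theorem integral_criticSample (θ v : EuclideanSpace ℝ (Fin d)) :
    ∫ z, (P.critSample v z + z.2.1 • P.feature z.1) ∂(P.transLaw θ) =
      Matrix.toEuclideanCLM (𝕜 := ℝ) (P.critA θ) (v - P.wTD θ) := by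
  rw [integral_add (integrable_critSample hP hphi θ v) (integrable_rewardSample hP hphi θ),
    map_sub, critA_wTD hP hphi, critA_apply hP hphi, sub_neg_eq_add, critb]

/-- The sample is split into the parts belonging to `v - w*_θ`, to `w*_θ` and to the reward. -/
theorem integral_norm_criticSample_sq_le {sA : ℝ} (hs : 0 < sA) (hsA : P.IsSingularValueBound sA)
    (θ v : EuclideanSpace ℝ (Fin d)) :
    ∫ z, ‖P.critSample v z + z.2.1 • P.feature z.1‖ ^ 2 ∂(P.transLaw θ) ≤
      3 * (K.CA ^ 2 * ‖v - P.wTD θ‖ ^ 2 + (K.CA ^ 2 * K.Cw sA ^ 2 + K.Cb ^ 2)) := by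
  have := hP.isProbabilityMeasure_transLaw θ
  have hCA := CA_nonneg (K := K)
  have h : ∀ᵐ z ∂(P.transLaw θ), ‖‖P.critSample v z + z.2.1 • P.feature z.1‖ ^ 2‖ ≤
      3 * (K.CA ^ 2 * ‖v - P.wTD θ‖ ^ 2 + (K.CA ^ 2 * K.Cw sA ^ 2 + K.Cb ^ 2)) := by
    filter_upwards [ae_norm_critSample_le hP hphi θ (v - P.wTD θ),
      ae_norm_critSample_le hP hphi θ (P.wTD θ), ae_norm_rewardSample_le hP hphi θ] with z h1 h2 h3
    rw [Real.norm_of_nonneg (by positivity)]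
    have hsplit : P.critSample v z = P.critSample (v - P.wTD θ) z + P.critSample (P.wTD θ) z := by
      simp only [critSample, inner_sub_right, ← add_smul]
      congr 1; ring
    have h4 : K.CA * ‖P.wTD θ‖ ≤ K.CA * K.Cw sA :=
      mul_le_mul_of_nonneg_left (norm_wTD_le hP hphi hs hsA θ) hCA
    have h5 : ‖P.critSample v z + z.2.1 • P.feature z.1‖ ≤
        K.CA * ‖v - P.wTD θ‖ + K.CA * K.Cw sA + K.Cb := by
      rw [hsplit]
      exact (norm_add_le _ _).trans (add_le_add ((norm_add_le _ _).trans
        (add_le_add h1 (h2.trans h4))) h3)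
    calc ‖P.critSample v z + z.2.1 • P.feature z.1‖ ^ 2
        ≤ (K.CA * ‖v - P.wTD θ‖ + K.CA * K.Cw sA + K.Cb) ^ 2 :=
          pow_le_pow_left₀ (norm_nonneg _) h5 2
      _ ≤ 3 * ((K.CA * ‖v - P.wTD θ‖) ^ 2 + (K.CA * K.Cw sA) ^ 2 + K.Cb ^ 2) := by
          linarith [sq_nonneg (K.CA * ‖v - P.wTD θ‖ - K.CA * K.Cw sA),
            sq_nonneg (K.CA * ‖v - P.wTD θ‖ - K.Cb), sq_nonneg (K.CA * K.Cw sA - K.Cb)]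
      _ = _ := by ring
  have h6 := norm_integral_le_of_norm_le_const h
  rw [probReal_univ, mul_one] at h6
  exact (Real.le_norm_self _).trans h6

include hα

theorem integrable_update_snd_sub :
    Integrable (fun b => (P.update αw αθ M x b.1 b.2).2 - x.2) (P.batchLaw M x.1) := by
  have := hP.isProbabilityMeasure_transLaw x.1
  have := hP.isProbabilityMeasure_actorLaw x.1
  have := Cb_nonneg hP hphi
  have := CA_nonneg (K := K)
  simp_rw [update_snd_sub]
  have h := integrable_empiricalMean (M := M) (μ := P.transLaw x.1)
    (hP.measurable_criticSample x.2) hα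
    (by positivity) (ae_norm_criticSample_le hP hphi x.1 x.2)
  exact h.comp_fst _

theorem integrable_norm_update_snd_sub_sq :
    Integrable (fun b => ‖(P.update αw αθ M x b.1 b.2).2 - x.2‖ ^ 2) (P.batchLaw M x.1) := by
  have := hP.isProbabilityMeasure_transLaw x.1
  have := hP.isProbabilityMeasure_actorLaw x.1
  have := Cb_nonneg hP hphi
  have := CA_nonneg (K := K)
  simp_rw [update_snd_sub]
  have h := integrable_norm_empiricalMean_sq (M := M) (μ := P.transLaw x.1)
    (hP.measurable_criticSample x.2) hα
    (by positivity) (ae_norm_criticSample_le hP hphi x.1 x.2)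
  exact h.comp_fst _

theorem norm_update_snd_sub_sq_eq (w : EuclideanSpace ℝ (Fin d))
    (b : (Fin M → (S × EuclideanSpace ℝ (Fin m)) × ℝ × (S × EuclideanSpace ℝ (Fin m))) ×
      (Fin M → S × N)) :
    ‖(P.update αw αθ M x b.1 b.2).2 - w‖ ^ 2 = ‖x.2 - w‖ ^ 2 +
      2 * inner ℝ (x.2 - w) ((P.update αw αθ M x b.1 b.2).2 - x.2) +
        ‖(P.update αw αθ M x b.1 b.2).2 - x.2‖ ^ 2 := by
  rw [← norm_add_sq_real]
  congr 2; abel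

theorem integrable_norm_update_snd_sub_wTD_sq (w : EuclideanSpace ℝ (Fin d)) :
    Integrable (fun b => ‖(P.update αw αθ M x b.1 b.2).2 - w‖ ^ 2) (P.batchLaw M x.1) := by
  have := hP.isProbabilityMeasure_batchLaw M x.1
  simp_rw [norm_update_snd_sub_sq_eq hP hphi hα x w]
  exact ((integrable_const _).add (((integrable_update_snd_sub hP hphi hα x).const_inner
    _).const_mul 2)).add (integrable_norm_update_snd_sub_sq hP hphi hα x)

theorem integral_update_snd_sub (hM : M ≠ 0) :
    ∫ b, ((P.update αw αθ M x b.1 b.2).2 - x.2) ∂(P.batchLaw M x.1) =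
      αw • Matrix.toEuclideanCLM (𝕜 := ℝ) (P.critA x.1) (x.2 - P.wTD x.1) := by
  have := hP.isProbabilityMeasure_transLaw x.1
  have := hP.isProbabilityMeasure_actorLaw x.1
  have hm := hP.measurable_criticSample x.2
  have hb := ae_norm_criticSample_le hP hphi x.1 x.2
  have hmem : MemLp (fun z => P.critSample x.2 z + z.2.1 • P.feature z.1) 2 (P.transLaw x.1) :=
    MemLp.of_bound (p := 2) hm.aestronglyMeasurable _ hb
  simp_rw [update_snd_sub]
  rw [batchLaw, integral_fun_fst (fun ω : Fin M → (S × EuclideanSpace ℝ (Fin m)) × ℝ ×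
    (S × EuclideanSpace ℝ (Fin m)) => (αw / M) •
      ∑ j, (P.critSample x.2 (ω j) + (ω j).2.1 • P.feature (ω j).1)), probReal_univ, one_smul,
    ← integral_criticSample hP hphi]
  exact integral_empiricalMean (f := fun z => P.critSample x.2 z + z.2.1 • P.feature z.1)
    hm (hmem.integrable one_le_two) hM

theorem integral_norm_update_snd_sub_sq_le (hM : M ≠ 0) {sA : ℝ}
    (hs : 0 < sA) (hsA : P.IsSingularValueBound sA) :
    ∫ b, ‖(P.update αw αθ M x b.1 b.2).2 - x.2‖ ^ 2 ∂(P.batchLaw M x.1) ≤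
      αw ^ 2 * (‖Matrix.toEuclideanCLM (𝕜 := ℝ) (P.critA x.1) (x.2 - P.wTD x.1)‖ ^ 2 +
        3 * (K.CA ^ 2 * ‖x.2 - P.wTD x.1‖ ^ 2 + (K.CA ^ 2 * K.Cw sA ^ 2 + K.Cb ^ 2)) / M) := by
  have := hP.isProbabilityMeasure_transLaw x.1
  have := hP.isProbabilityMeasure_actorLaw x.1
  have hm := hP.measurable_criticSample x.2
  have hb := ae_norm_criticSample_le hP hphi x.1 x.2
  have hmem : MemLp (fun z => P.critSample x.2 z + z.2.1 • P.feature z.1) 2 (P.transLaw x.1) :=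
    MemLp.of_bound (p := 2) hm.aestronglyMeasurable _ hb
  simp_rw [update_snd_sub]
  rw [batchLaw, integral_fun_fst (fun ω : Fin M → (S × EuclideanSpace ℝ (Fin m)) × ℝ ×
    (S × EuclideanSpace ℝ (Fin m)) => ‖(αw / M) •
      ∑ j, (P.critSample x.2 (ω j) + (ω j).2.1 • P.feature (ω j).1)‖ ^ 2), probReal_univ,
    one_smul, ← integral_criticSample hP hphi]
  exact integral_norm_empiricalMean_sq_le (f := fun z => P.critSample x.2 z + z.2.1 • P.feature z.1)
    hm hmem hM
    (integral_norm_criticSample_sq_le hP hphi hs hsA x.1 x.2)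

/-- One TD step with frozen actor: dissipativity of `A_θ` contracts the critic error, up to the
second moment of the mini-batch. -/
theorem integral_norm_update_snd_sub_wTD_sq_le (hM : M ≠ 0) {lam sA : ℝ}
    (hlam : P.IsDissipationConstant lam) (hs : 0 < sA) (hsA : P.IsSingularValueBound sA) :
    ∫ b, ‖(P.update αw αθ M x b.1 b.2).2 - P.wTD x.1‖ ^ 2 ∂(P.batchLaw M x.1) ≤
      (1 - 2 * (lam * αw) + αw ^ 2 * K.CA ^ 2 + 3 * αw ^ 2 * K.CA ^ 2 / M) *
        ‖x.2 - P.wTD x.1‖ ^ 2 + 3 * αw ^ 2 * (K.CA ^ 2 * K.Cw sA ^ 2 + K.Cb ^ 2) / M := by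
  have := hP.isProbabilityMeasure_batchLaw M x.1
  have := hP.isProbabilityMeasure_transLaw x.1
  have := hP.isProbabilityMeasure_actorLaw x.1
  have i1 := integrable_update_snd_sub hP hphi (αθ := αθ) (M := M) hα x
  have i2 := integrable_norm_update_snd_sub_sq hP hphi (αθ := αθ) (M := M) hα x
  have i3 : Integrable (fun b => 2 * inner ℝ (x.2 - P.wTD x.1)
      ((P.update αw αθ M x b.1 b.2).2 - x.2)) (P.batchLaw M x.1) :=
    (i1.const_inner _).const_mul 2
  have hmean := integral_update_snd_sub hP hphi (αθ := αθ) hα x hM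
  have hsq := integral_norm_update_snd_sub_sq_le hP hphi (αθ := αθ) hα x hM hs hsA
  have hA : ‖Matrix.toEuclideanCLM (𝕜 := ℝ) (P.critA x.1) (x.2 - P.wTD x.1)‖ ^ 2 ≤
      K.CA ^ 2 * ‖x.2 - P.wTD x.1‖ ^ 2 := by
    rw [← mul_pow]
    exact pow_le_pow_left₀ (norm_nonneg _) (norm_critA_apply_le hP hphi x.1 _) 2
  have hd := mul_le_mul_of_nonneg_left (hlam x.1 (x.2 - P.wTD x.1)) hα
  simp_rw [norm_update_snd_sub_sq_eq hP hphi hα x (P.wTD x.1)]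
  have i4 : Integrable (fun b => ‖x.2 - P.wTD x.1‖ ^ 2 + 2 * inner ℝ (x.2 - P.wTD x.1)
      ((P.update αw αθ M x b.1 b.2).2 - x.2)) (P.batchLaw M x.1) := (integrable_const _).add i3
  rw [integral_add i4 i2, integral_add (integrable_const _) i3,
    integral_const, probReal_univ, one_smul, integral_const_mul, integral_inner i1, hmean,
    real_inner_smul_right]
  have hA' := mul_le_mul_of_nonneg_left hA (sq_nonneg αw)
  calc _ ≤ ‖x.2 - P.wTD x.1‖ ^ 2 + 2 * (αw * (-lam * ‖x.2 - P.wTD x.1‖ ^ 2)) +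
      αw ^ 2 * (K.CA ^ 2 * ‖x.2 - P.wTD x.1‖ ^ 2 +
        3 * (K.CA ^ 2 * ‖x.2 - P.wTD x.1‖ ^ 2 + (K.CA ^ 2 * K.Cw sA ^ 2 + K.Cb ^ 2)) / M) := by
        linarith
    _ = _ := by ring

end CriticStep

end RPGProblem

/-! ### The Lyapunov inequality -/

/-- The numerical part of the Lyapunov inequality. Here `e` is the squared critic error before the
step and `E` its mean after the critic update, `q = ‖w‖²`, `Δ` is the mean of `‖θ' - θ‖²`, and
`G`, `H`, `D` are the squared norms of `∇J`, of the mean actor direction and of their difference. -/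
theorem lyapunov_step_arith {e G H D q C κ Lh LJ Lw X a B M E Δ p : ℝ}
    (hX : 0 < X) (hX' : X ≤ 1 / 2) (ha : 0 < a) (hLJ : 0 ≤ LJ) (haJ : 4 * LJ * a ≤ 1)
    (haw : 3456 * (a * Lw * Lh) ^ 2 ≤ X ^ 2) (hM : 1 ≤ M) (hB : 0 ≤ B)
    (he : 0 ≤ e) (hH : 0 ≤ H) (hE : E ≤ (1 - 23 / 16 * X) * e + 3 * B / M)
    (hΔ : Δ ≤ a ^ 2 * (H + Lh ^ 2 * q / M)) (hq0 : 0 ≤ q) (hq : q ≤ 3 * (e + κ ^ 2 + C ^ 2))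
    (hp : p = (G + H - D) / 2) (hD : D ≤ 2 * Lh ^ 2 * (e + κ ^ 2)) :
    4 * Lh ^ 2 / X * (1 + 2 / X) * (8 * κ ^ 2) - 2 * p +
      (2 * LJ / a + 2 * (4 * Lh ^ 2 / X) * (1 + 2 / X) * Lw ^ 2) * Δ +
        4 * Lh ^ 2 / X * (1 + X / 2) * E ≤
      4 * Lh ^ 2 / X * e - G + (15 * Lh ^ 2 * B / X + 2 * Lh ^ 2 * C ^ 2) / M +
        (4 * Lh ^ 2 + 80 * Lh ^ 2 / X ^ 2) * κ ^ 2 := by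
  have hM0 : 0 < M := by linarith
  have h0 : 1 + 2 / X ≤ 5 / (2 * X) := by
    rw [le_div_iff₀ (by positivity), add_mul, div_mul_eq_mul_div, one_mul,
      show 2 * (2 * X) / X = 4 by field_simp; norm_num]
    linarith
  have h0' : 0 ≤ 1 + 2 / X := by positivity
  -- the total weight of the squared actor displacement
  have hc : 2 * (4 * Lh ^ 2 / X) * (1 + 2 / X) * (Lw ^ 2 * a ^ 2) ≤ 1 / 100 := by
    calc 2 * (4 * Lh ^ 2 / X) * (1 + 2 / X) * (Lw ^ 2 * a ^ 2)
        ≤ 2 * (4 * Lh ^ 2 / X) * (5 / (2 * X)) * (Lw ^ 2 * a ^ 2) := by gcongr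
      _ = 20 * (a * Lw * Lh) ^ 2 / X ^ 2 := by field_simp; ring
      _ ≤ 1 / 100 := by
          rw [div_le_iff₀ (by positivity)]
          nlinarith [sq_nonneg X]
  have hMq : 0 ≤ H + Lh ^ 2 * q / M := by positivity
  -- the squared displacement of the actor costs at most `51 / 100` of its mean direction and batch
  -- noise; the former is then cancelled by the polarization identity for `p`
  have s1 : (2 * LJ / a + 2 * (4 * Lh ^ 2 / X) * (1 + 2 / X) * Lw ^ 2) * Δ ≤
      51 / 100 * (H + Lh ^ 2 * q / M) := by
    calc (2 * LJ / a + 2 * (4 * Lh ^ 2 / X) * (1 + 2 / X) * Lw ^ 2) * Δ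
        ≤ (2 * LJ / a + 2 * (4 * Lh ^ 2 / X) * (1 + 2 / X) * Lw ^ 2) *
          (a ^ 2 * (H + Lh ^ 2 * q / M)) := by gcongr
      _ = (2 * LJ * a + 2 * (4 * Lh ^ 2 / X) * (1 + 2 / X) * (Lw ^ 2 * a ^ 2)) *
          (H + Lh ^ 2 * q / M) := by field_simp
      _ ≤ _ := by
          refine mul_le_mul_of_nonneg_right ?_ hMq
          linarith
  -- `1 / M` is kept only in the part of the batch noise that does not involve `e` and `κ`
  have s2 : Lh ^ 2 * q / M ≤ 3 * Lh ^ 2 * (e + κ ^ 2) + 3 * Lh ^ 2 * C ^ 2 / M := by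
    calc Lh ^ 2 * q / M ≤ Lh ^ 2 * (3 * (e + κ ^ 2 + C ^ 2)) / M := by gcongr
      _ = 3 * Lh ^ 2 * (e + κ ^ 2) / M + 3 * Lh ^ 2 * C ^ 2 / M := by ring
      _ ≤ _ := add_le_add_left (div_le_self (by positivity) hM) _
  -- the contraction of the critic releases `15 / 4 * Lh ^ 2 * e`, which pays for `s2` and `hD`
  have s3 : 4 * Lh ^ 2 / X * (1 + X / 2) * E ≤
      4 * Lh ^ 2 / X * e - 15 / 4 * Lh ^ 2 * e + 15 * Lh ^ 2 * B / X / M := by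
    calc 4 * Lh ^ 2 / X * (1 + X / 2) * E
        ≤ 4 * Lh ^ 2 / X * (1 + X / 2) * ((1 - 23 / 16 * X) * e + 3 * B / M) := by gcongr
      _ = 4 * Lh ^ 2 / X * ((1 + X / 2) * (1 - 23 / 16 * X)) * e +
          4 * Lh ^ 2 / X * (1 + X / 2) * (3 * B / M) := by ring
      _ ≤ 4 * Lh ^ 2 / X * (1 - 15 / 16 * X) * e + 4 * Lh ^ 2 / X * (5 / 4) * (3 * B / M) := by
          gcongr
          · nlinarith
          · linarith
      _ = _ := by field_simp; ring
  -- the drift of the TD fixed point that is not controlled by the displacement of `θ`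
  have s4 : 4 * Lh ^ 2 / X * (1 + 2 / X) * (8 * κ ^ 2) ≤ 80 * Lh ^ 2 / X ^ 2 * κ ^ 2 := by
    calc 4 * Lh ^ 2 / X * (1 + 2 / X) * (8 * κ ^ 2)
        ≤ 4 * Lh ^ 2 / X * (5 / (2 * X)) * (8 * κ ^ 2) := by gcongr
      _ = _ := by field_simp; ring
  have s5 : 0 ≤ Lh ^ 2 * C ^ 2 / M := by positivity
  have s6 : 0 ≤ Lh ^ 2 * e := by positivity
  have s7 : 0 ≤ Lh ^ 2 * κ ^ 2 := by positivity
  have s8 : (15 * Lh ^ 2 * B / X + 2 * Lh ^ 2 * C ^ 2) / M =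
      15 * Lh ^ 2 * B / X / M + 2 * (Lh ^ 2 * C ^ 2 / M) := by ring
  have s9 : 3 * Lh ^ 2 * C ^ 2 / M = 3 * (Lh ^ 2 * C ^ 2 / M) := by ring
  subst hp
  rw [s8]
  rw [s9] at s2
  linarith

namespace RPGProblem

variable {S N : Type*} [MeasurableSpace S] [MeasurableSpace N] {d m : ℕ}
  {P : RPGProblem S N d m} {K : RPGConstants} {R : ℝ}

section Drift

variable (hP : P.Standing K.Rmax) (hpolicy : P.PolicyAssumption K)
  (henv : P.EnvironmentAssumption K) (hphi : P.FeatureAssumption K)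

include hP hpolicy henv hphi

theorem bddAbove_norm_wTD_sub_wCompat :
    BddAbove (Set.range fun θ => ‖P.wTD θ - P.wCompat θ‖) := by
  obtain ⟨sA, hs, hsA⟩ := exists_isSingularValueBound hP hphi
  refine ⟨K.Cw sA + K.CwXi P.discount, ?_⟩
  rintro _ ⟨θ, rfl⟩
  exact (norm_sub_le _ _).trans (add_le_add (norm_wTD_le hP hphi hs hsA θ)
    (norm_wCompat_le hP hpolicy henv θ))

theorem norm_wTD_sub_wCompat_le (θ : EuclideanSpace ℝ (Fin d)) :
    ‖P.wTD θ - P.wCompat θ‖ ≤ P.kappa :=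
  le_ciSup (bddAbove_norm_wTD_sub_wCompat hP hpolicy henv hphi) θ

/-- The TD fixed point itself need not depend continuously on `θ`; its variation is controlled by
that of the compatible weights, at the price of twice `κ`. -/
theorem norm_wTD_sub_wTD_le (hQ : P.QAssumption K) {Cν : ℝ} (h0 : 0 ≤ Cν)
    (hν : P.IsVisitationConstant Cν) (θ θ' : EuclideanSpace ℝ (Fin d)) :
    ‖P.wTD θ - P.wTD θ'‖ ≤ 2 * P.kappa + K.Lw P.discount Cν * ‖θ' - θ‖ := by
  have h1 := norm_wTD_sub_wCompat_le hP hpolicy henv hphi θ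
  have h2 := norm_wTD_sub_wCompat_le hP hpolicy henv hphi θ'
  have h3 := norm_wCompat_sub_le hP hpolicy henv hQ h0 hν θ θ'
  rw [norm_sub_rev θ θ'] at h3
  have h4 : P.wTD θ - P.wTD θ' =
      (P.wTD θ - P.wCompat θ) + (P.wCompat θ - P.wCompat θ') - (P.wTD θ' - P.wCompat θ') := by abel
  rw [h4]
  have h5 := norm_sub_le (P.wTD θ - P.wCompat θ + (P.wCompat θ - P.wCompat θ'))
    (P.wTD θ' - P.wCompat θ')
  have h6 := norm_add_le (P.wTD θ - P.wCompat θ) (P.wCompat θ - P.wCompat θ')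
  linarith

/-- Young's inequality with weight `X / 2`, chosen so small that the contraction of the critic step
survives the drift of its target. -/
theorem norm_sub_wTD_sq_le (hQ : P.QAssumption K) {Cν : ℝ} (h0 : 0 ≤ Cν)
    (hν : P.IsVisitationConstant Cν) {X : ℝ} (hX : 0 < X)
    (θ θ' w' : EuclideanSpace ℝ (Fin d)) :
    ‖w' - P.wTD θ'‖ ^ 2 ≤ (1 + X / 2) * ‖w' - P.wTD θ‖ ^ 2 +
      (1 + 2 / X) * (8 * P.kappa ^ 2 + 2 * K.Lw P.discount Cν ^ 2 * ‖θ' - θ‖ ^ 2) := by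
  have h1 := norm_wTD_sub_wTD_le hP hpolicy henv hphi hQ h0 hν θ θ'
  have h2 : ‖w' - P.wTD θ'‖ ≤ ‖w' - P.wTD θ‖ + ‖P.wTD θ - P.wTD θ'‖ :=
    norm_sub_le_norm_sub_add_norm_sub _ _ _
  have h3 : ‖P.wTD θ - P.wTD θ'‖ ^ 2 ≤
      8 * P.kappa ^ 2 + 2 * K.Lw P.discount Cν ^ 2 * ‖θ' - θ‖ ^ 2 := by
    refine (pow_le_pow_left₀ (norm_nonneg _) h1 2).trans ?_
    linarith [sq_nonneg (2 * P.kappa - K.Lw P.discount Cν * ‖θ' - θ‖)]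
  set a := ‖w' - P.wTD θ‖
  set b := ‖P.wTD θ - P.wTD θ'‖
  have h4 : (a + b) ^ 2 ≤ (1 + X / 2) * a ^ 2 + (1 + 2 / X) * b ^ 2 := by
    have h5 : (1 + X / 2) * a ^ 2 + (1 + 2 / X) * b ^ 2 - (a + b) ^ 2 =
        (X * a - 2 * b) ^ 2 / (2 * X) := by field_simp; ring
    have h6 : 0 ≤ (X * a - 2 * b) ^ 2 / (2 * X) := by positivity
    linarith
  refine (pow_le_pow_left₀ (norm_nonneg _) h2 2).trans (h4.trans ?_)
  gcongr

end Drift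

end RPGProblem

namespace RPGProblem

variable {S N : Type*} [MeasurableSpace S] [MeasurableSpace N] {d m : ℕ}
  {P : RPGProblem S N d m} {K : RPGConstants} {R : ℝ}

/-- The Lyapunov function `c ‖w - w*_θ‖² - (2 / α_θ) J(θ)` of the iteration. -/
noncomputable def lyapunov (P : RPGProblem S N d m) (c αθ : ℝ)
    (x : EuclideanSpace ℝ (Fin d) × EuclideanSpace ℝ (Fin d)) : ℝ :=
  c * ‖x.2 - P.wTD x.1‖ ^ 2 - 2 / αθ * P.objective x.1

/-- With `α_w ≤ λ / (2 C_A²)` this yields `λ α_w ≤ 1 / 2`. In dimension `0` every `λ` is a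
dissipation constant, so some vector `v ≠ 0` is needed. -/
theorem dissipationConstant_le_CA [Nontrivial (EuclideanSpace ℝ (Fin d))]
    (hP : P.Standing K.Rmax) (hphi : P.FeatureAssumption K) {lam : ℝ}
    (hlam : P.IsDissipationConstant lam) : lam ≤ K.CA := by
  obtain ⟨v, hv⟩ := exists_ne (0 : EuclideanSpace ℝ (Fin d))
  have hv' : 0 < ‖v‖ ^ 2 := by positivity
  have h1 := hlam 0 v
  have h2 := neg_le_of_abs_le (abs_real_inner_le_norm v
    (Matrix.toEuclideanCLM (𝕜 := ℝ) (P.critA 0) v))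
  have h3 := mul_le_mul_of_nonneg_left (norm_critA_apply_le hP hphi 0 v) (norm_nonneg v)
  refine le_of_mul_le_mul_right ?_ hv'
  linarith

section Lyapunov

variable (hP : P.Standing K.Rmax) (hpolicy : P.PolicyAssumption K)
  (henv : P.EnvironmentAssumption K) (hQ : P.QAssumption K) (hphi : P.FeatureAssumption K)

include hP hpolicy henv hQ

theorem measurable_objective : Measurable P.objective :=
  (continuous_iff_continuousAt.2 fun θ =>
    (hasGradientAt_objective hP hpolicy henv hQ θ).continuousAt).measurable

theorem measurable_lyapunov (c αθ : ℝ) : Measurable (P.lyapunov c αθ) :=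
  (((measurable_snd.sub (hP.measurable_wTD.comp measurable_fst)).norm.pow_const 2).const_mul c).sub
    (((measurable_objective hP hpolicy henv hQ).comp measurable_fst).const_mul _)

include hphi

theorem integrable_lyapunov {sA : ℝ} (hs : 0 < sA) (hsA : P.IsSingularValueBound sA)
    (c αθ : ℝ) {μ : Measure (EuclideanSpace ℝ (Fin d) × EuclideanSpace ℝ (Fin d))}
    [IsProbabilityMeasure μ] {W : ℝ} (hW : ∀ᵐ x ∂μ, ‖x.2‖ ≤ W) :
    Integrable (P.lyapunov c αθ) μ := by
  refine Integrable.of_bound (measurable_lyapunov hP hpolicy henv hQ c αθ).aestronglyMeasurable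
    (|c| * (W + K.Cw sA) ^ 2 + |2 / αθ| * K.Rmax) ?_
  filter_upwards [hW] with x hx
  have h1 : ‖x.2 - P.wTD x.1‖ ^ 2 ≤ (W + K.Cw sA) ^ 2 :=
    pow_le_pow_left₀ (norm_nonneg _) ((norm_sub_le _ _).trans
      (add_le_add hx (norm_wTD_le hP hphi hs hsA x.1))) 2
  rw [lyapunov, Real.norm_eq_abs]
  refine (abs_sub _ _).trans (add_le_add ?_ ?_)
  · rw [abs_mul, abs_of_nonneg (sq_nonneg ‖x.2 - P.wTD x.1‖)]
    exact mul_le_mul_of_nonneg_left h1 (abs_nonneg _)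
  · rw [abs_mul]
    exact mul_le_mul_of_nonneg_left (hP.abs_objective_le x.1) (abs_nonneg _)

/-- Pointwise estimate of the Lyapunov function after an update: smoothness of `J` and the drift of
the TD fixed point are used, but not the randomness of the batches. -/
theorem lyapunov_update_le {Cν : ℝ} (h0 : 0 ≤ Cν) (hν : P.IsVisitationConstant Cν) {X c αθ : ℝ}
    (hX : 0 < X) (hc : 0 ≤ c) (hα : 0 < αθ)
    (x y : EuclideanSpace ℝ (Fin d) × EuclideanSpace ℝ (Fin d)) :
    P.lyapunov c αθ y ≤ (c * (1 + 2 / X) * (8 * P.kappa ^ 2) - 2 / αθ * P.objective x.1) -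
      2 / αθ * inner ℝ (P.gradJ x.1) (y.1 - x.1) +
      (2 * K.LJ P.discount Cν / αθ + 2 * c * (1 + 2 / X) * K.Lw P.discount Cν ^ 2) *
        ‖y.1 - x.1‖ ^ 2 + c * (1 + X / 2) * ‖y.2 - P.wTD x.1‖ ^ 2 := by
  have h1 := mul_le_mul_of_nonneg_left
    (norm_sub_wTD_sq_le hP hpolicy henv hphi hQ h0 hν hX x.1 y.1 y.2) hc
  have h2 := (abs_le.1 (abs_objective_sub_inner_le hP hpolicy henv hQ h0 hν x.1 y.1)).1
  have h3 := mul_le_mul_of_nonneg_left h2 (show 0 ≤ 2 / αθ by positivity)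
  rw [lyapunov]
  have h4 : 2 * K.LJ P.discount Cν / αθ = 2 / αθ * K.LJ P.discount Cν := by ring
  rw [h4]
  linarith

/-- One iteration decreases the Lyapunov function by the squared gradient, up to a batch error and a
multiple of `κ²`. -/
theorem integral_lyapunov_stepLaw_le {Cν lam sA : ℝ} (h0 : 0 ≤ Cν)
    (hν : P.IsVisitationConstant Cν) (hlam0 : 0 < lam) (hlam : P.IsDissipationConstant lam)
    (hs : 0 < sA) (hsA : P.IsSingularValueBound sA) {αw αθ : ℝ} {M : ℕ} (hαw : 0 < αw)
    (hαθ : 0 < αθ) (hM : M ≠ 0) (hX : lam * αw ≤ 1 / 2) (hw : αw * K.CA ^ 2 ≤ lam / 2)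
    (hMw : 48 * αw * K.CA ^ 2 ≤ lam * M) (hJ : 4 * K.LJ P.discount Cν * αθ ≤ 1)
    (hθ : 3456 * (αθ * K.Lw P.discount Cν * K.Lh) ^ 2 ≤ (lam * αw) ^ 2)
    (x : EuclideanSpace ℝ (Fin d) × EuclideanSpace ℝ (Fin d)) :
    ∫ y, P.lyapunov (4 * K.Lh ^ 2 / (lam * αw)) αθ y ∂(P.stepLaw αw αθ M x) ≤
      P.lyapunov (4 * K.Lh ^ 2 / (lam * αw)) αθ x - ‖P.gradJ x.1‖ ^ 2 +
        ((15 * K.Lh ^ 2 * (αw ^ 2 * (K.CA ^ 2 * K.Cw sA ^ 2 + K.Cb ^ 2)) / (lam * αw) +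
          2 * K.Lh ^ 2 * K.CwXi P.discount ^ 2) / M +
          (4 * K.Lh ^ 2 + 80 * K.Lh ^ 2 / (lam * αw) ^ 2) * P.kappa ^ 2) := by
  have := hP.isProbabilityMeasure_batchLaw M x.1
  have := hP.isProbabilityMeasure_stepLaw αw αθ M x
  have hX0 : 0 < lam * αw := by positivity
  have hM1 : (1:ℝ) ≤ M := by exact_mod_cast Nat.one_le_iff_ne_zero.2 hM
  have hM0 : (0:ℝ) < M := by linarith
  set c : ℝ := 4 * K.Lh ^ 2 / (lam * αw) with hc_def
  have hc : 0 ≤ c := by positivity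
  have hmu := hP.measurable_update_left αw αθ M x
  have hml := measurable_lyapunov hP hpolicy henv hQ c αθ
  have hil : Integrable (fun b => P.lyapunov c αθ (P.update αw αθ M x b.1 b.2))
      (P.batchLaw M x.1) := by
    have h := integrable_lyapunov hP hpolicy henv hQ hphi hs hsA c αθ
      (ae_norm_snd_stepLaw_le hP hphi hαw.le αθ M x le_rfl)
    rw [stepLaw_eq] at h
    exact (integrable_map_measure hml.aestronglyMeasurable hmu.aemeasurable).1 h
  have i1 : Integrable (fun b => 2 / αθ * inner ℝ (P.gradJ x.1)
      ((P.update αw αθ M x b.1 b.2).1 - x.1)) (P.batchLaw M x.1) :=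
    ((integrable_update_fst_sub hP hpolicy hαθ.le x).const_inner _).const_mul _
  have i2 := (integrable_norm_update_fst_sub_sq hP hpolicy (αw := αw) (M := M) hαθ.le x).const_mul
    (2 * K.LJ P.discount Cν / αθ + 2 * c * (1 + 2 / (lam * αw)) * K.Lw P.discount Cν ^ 2)
  have i3 := (integrable_norm_update_snd_sub_wTD_sq hP hphi (αθ := αθ) (M := M) hαw.le x
    (P.wTD x.1)).const_mul (c * (1 + lam * αw / 2))
  set k0 : ℝ := c * (1 + 2 / (lam * αw)) * (8 * P.kappa ^ 2) - 2 / αθ * P.objective x.1 with hk0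
  have i4 : Integrable (fun b => k0 - 2 / αθ * inner ℝ (P.gradJ x.1)
      ((P.update αw αθ M x b.1 b.2).1 - x.1)) (P.batchLaw M x.1) := (integrable_const _).sub i1
  have i5 := i4.add i2
  have h1 := integral_mono hil (i5.add i3) fun b =>
    lyapunov_update_le hP hpolicy henv hQ hphi h0 hν hX0 hc hαθ x (P.update αw αθ M x b.1 b.2)
  have h2 : ∫ y, P.lyapunov c αθ y ∂(P.stepLaw αw αθ M x) =
      ∫ b, P.lyapunov c αθ (P.update αw αθ M x b.1 b.2) ∂(P.batchLaw M x.1) := by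
    rw [stepLaw_eq]
    exact integral_map hmu.aemeasurable hml.aestronglyMeasurable
  rw [h2]
  refine h1.trans ?_
  rw [integral_add' i5 i3, integral_add' i4 i2, integral_sub (integrable_const _) i1,
    integral_const, probReal_univ, one_smul, integral_const_mul, integral_const_mul,
    integral_const_mul, integral_inner_update_fst_sub hP hpolicy hαθ.le x hM]
  have hE := integral_norm_update_snd_sub_wTD_sq_le hP hphi (αθ := αθ) hαw.le x hM hlam hs hsA
  have hΔ := integral_norm_update_fst_sub_sq_le hP hpolicy (αw := αw) hαθ.le x hM
  set E := ∫ b, ‖(P.update αw αθ M x b.1 b.2).2 - P.wTD x.1‖ ^ 2 ∂(P.batchLaw M x.1)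
  set Δ := ∫ b, ‖(P.update αw αθ M x b.1 b.2).1 - x.1‖ ^ 2 ∂(P.batchLaw M x.1)
  set e := ‖x.2 - P.wTD x.1‖ ^ 2 with he
  have he0 : 0 ≤ e := by positivity
  -- each second-moment term takes a small part of the contraction rate: `1 / 2` and `1 / 16`
  have hE' : E ≤ (1 - 23 / 16 * (lam * αw)) * e +
      3 * (αw ^ 2 * (K.CA ^ 2 * K.Cw sA ^ 2 + K.Cb ^ 2)) / M := by
    have b1 : αw ^ 2 * K.CA ^ 2 ≤ lam * αw / 2 := by
      calc αw ^ 2 * K.CA ^ 2 = αw * (αw * K.CA ^ 2) := by ring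
        _ ≤ αw * (lam / 2) := by gcongr
        _ = _ := by ring
    have b2 : 3 * αw ^ 2 * K.CA ^ 2 / M ≤ lam * αw / 16 := by
      rw [div_le_iff₀ hM0]
      have := mul_le_mul_of_nonneg_left hMw hαw.le
      linarith
    have b3 : (1 - 2 * (lam * αw) + αw ^ 2 * K.CA ^ 2 + 3 * αw ^ 2 * K.CA ^ 2 / M) * e ≤
        (1 - 23 / 16 * (lam * αw)) * e := by gcongr; linarith
    have b4 : 3 * αw ^ 2 * (K.CA ^ 2 * K.Cw sA ^ 2 + K.Cb ^ 2) / M =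
      3 * (αw ^ 2 * (K.CA ^ 2 * K.Cw sA ^ 2 + K.Cb ^ 2)) / M := by ring
    linarith
  have n1 := norm_wTD_sub_wCompat_le hP hpolicy henv hphi x.1
  have n2 := norm_wCompat_le hP hpolicy henv x.1
  -- `‖w‖` through the distances `w` to `w*_θ` to `w*_{ξ_θ}` to `0`
  have hq : ‖x.2‖ ^ 2 ≤ 3 * (e + P.kappa ^ 2 + K.CwXi P.discount ^ 2) := by
    have n3 : ‖x.2‖ ≤ ‖x.2 - P.wTD x.1‖ + P.kappa + K.CwXi P.discount := by
      have n4 : x.2 = (x.2 - P.wTD x.1) + (P.wTD x.1 - P.wCompat x.1) + P.wCompat x.1 := by abel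
      calc ‖x.2‖ = ‖(x.2 - P.wTD x.1) + (P.wTD x.1 - P.wCompat x.1) + P.wCompat x.1‖ := by
            rw [← n4]
        _ ≤ _ := norm_add₃_le
        _ ≤ _ := by linarith
    refine (pow_le_pow_left₀ (norm_nonneg _) n3 2).trans ?_
    rw [he]
    linarith [sq_nonneg (‖x.2 - P.wTD x.1‖ - P.kappa),
      sq_nonneg (‖x.2 - P.wTD x.1‖ - K.CwXi P.discount),
      sq_nonneg (P.kappa - K.CwXi P.discount)]
  -- the mean actor direction is off by `Ψ_θ (w*_{ξ_θ} - w)`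
  have hD : ‖P.gradJ x.1 - P.Psi x.1 x.2‖ ^ 2 ≤ 2 * K.Lh ^ 2 * (e + P.kappa ^ 2) := by
    rw [← Psi_wCompat hP hpolicy henv, ← map_sub]
    have n3 : ‖P.wCompat x.1 - x.2‖ ≤ ‖x.2 - P.wTD x.1‖ + P.kappa := by
      rw [norm_sub_rev]
      exact (norm_sub_le_norm_sub_add_norm_sub _ (P.wTD x.1) _).trans (add_le_add le_rfl n1)
    have n4 := (norm_Psi_apply_le hP hpolicy x.1 (P.wCompat x.1 - x.2)).trans
      (mul_le_mul_of_nonneg_left n3 Lh_nonneg)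
    refine (pow_le_pow_left₀ (norm_nonneg _) n4 2).trans ?_
    rw [mul_pow, mul_comm 2, mul_assoc]
    refine mul_le_mul_of_nonneg_left ?_ (sq_nonneg _)
    linarith [sq_nonneg (‖x.2 - P.wTD x.1‖ - P.kappa)]
  have hp : (inner ℝ (P.gradJ x.1) (P.Psi x.1 x.2) : ℝ) = (‖P.gradJ x.1‖ ^ 2 +
      ‖P.Psi x.1 x.2‖ ^ 2 - ‖P.gradJ x.1 - P.Psi x.1 x.2‖ ^ 2) / 2 := by
    rw [norm_sub_sq_real]; ring
  have key := lyapunov_step_arith hX0 hX hαθ (LJ_pos hP hpolicy henv hQ h0).le hJ hθ hM1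
    (B := αw ^ 2 * (K.CA ^ 2 * K.Cw sA ^ 2 + K.Cb ^ 2)) (by positivity) he0 (by positivity) hE' hΔ
    (by positivity) hq hp hD
  rw [← hc_def] at key
  have hin : 2 / αθ * (αθ * inner ℝ (P.gradJ x.1) (P.Psi x.1 x.2)) =
      2 * inner ℝ (P.gradJ x.1) (P.Psi x.1 x.2) := by field_simp
  rw [hin, hk0, lyapunov]
  linarith

end Lyapunov

end RPGProblem

/-! ### Convergence of the iteration -/

namespace RPGProblem

variable {S N : Type*} [MeasurableSpace S] [MeasurableSpace N] {d m : ℕ}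
  {P : RPGProblem S N d m} {K : RPGConstants} {R : ℝ}

section Convergence

variable (hP : P.Standing K.Rmax) (hpolicy : P.PolicyAssumption K)
  (henv : P.EnvironmentAssumption K) (hQ : P.QAssumption K) (hphi : P.FeatureAssumption K)

include hP hpolicy henv hQ

theorem integrable_norm_gradJ_sq {Cν : ℝ} (h0 : 0 ≤ Cν) (hν : P.IsVisitationConstant Cν)
    (μ : Measure (EuclideanSpace ℝ (Fin d) × EuclideanSpace ℝ (Fin d))) [IsProbabilityMeasure μ] :
    Integrable (fun x => ‖P.gradJ x.1‖ ^ 2) μ := by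
  have hm := (continuous_gradJ hP hpolicy henv hQ h0 hν).measurable
  refine integrable_of_norm_le (C := (K.Lf * K.CQ P.discount) ^ 2)
    ((hm.comp measurable_fst).norm.pow_const 2) fun x => ?_
  rw [Real.norm_of_nonneg (by positivity)]
  exact pow_le_pow_left₀ (norm_nonneg _) (norm_gradJ_le hP hpolicy henv x.1) 2

include hphi

/-- Telescoping a one-step decrease of the Lyapunov function along the iteration. -/
theorem sum_integral_norm_gradJ_sq_le {Cν sA : ℝ} (h0 : 0 ≤ Cν) (hν : P.IsVisitationConstant Cν)
    (hs : 0 < sA) (hsA : P.IsSingularValueBound sA) {αw αθ c B : ℝ} {M : ℕ} (hαw : 0 ≤ αw)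
    (hαθ : 0 < αθ) (hc : 0 ≤ c)
    (hstep : ∀ x, ∫ y, P.lyapunov c αθ y ∂(P.stepLaw αw αθ M x) ≤
      P.lyapunov c αθ x - ‖P.gradJ x.1‖ ^ 2 + B)
    (θ₀ w₀ : EuclideanSpace ℝ (Fin d)) (T : ℕ) :
    ∑ t ∈ Finset.range T, ∫ x, ‖P.gradJ x.1‖ ^ 2 ∂(P.iterateLaw αw αθ M θ₀ w₀ t) ≤
      c * ‖w₀ - P.wTD θ₀‖ ^ 2 + 4 * K.Rmax / αθ + T * B := by
  have hpr := hP.isProbabilityMeasure_iterateLaw αw αθ M θ₀ w₀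
  have hps := hP.isProbabilityMeasure_stepLaw αw αθ M
  have hms := hP.measurable_stepLaw αw αθ M
  have hil : ∀ t, Integrable (P.lyapunov c αθ) (P.iterateLaw αw αθ M θ₀ w₀ t) := fun t => by
    obtain ⟨W, hW⟩ := exists_ae_norm_snd_iterateLaw_le hP hphi hαw αθ M θ₀ w₀ t
    exact integrable_lyapunov hP hpolicy henv hQ hphi hs hsA c αθ hW
  have hig := fun t => integrable_norm_gradJ_sq hP hpolicy henv hQ h0 hν
    (P.iterateLaw αw αθ M θ₀ w₀ t)
  have hone : ∀ t, ∫ x, P.lyapunov c αθ x ∂(P.iterateLaw αw αθ M θ₀ w₀ (t + 1)) ≤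
      ∫ x, P.lyapunov c αθ x ∂(P.iterateLaw αw αθ M θ₀ w₀ t) -
        ∫ x, ‖P.gradJ x.1‖ ^ 2 ∂(P.iterateLaw αw αθ M θ₀ w₀ t) + B := by
    intro t
    have h1 : Integrable (P.lyapunov c αθ)
        ((P.iterateLaw αw αθ M θ₀ w₀ t).bind (P.stepLaw αw αθ M)) := hil (t + 1)
    have h2 : ∫ x, P.lyapunov c αθ x ∂(P.iterateLaw αw αθ M θ₀ w₀ (t + 1)) =
        ∫ x, ∫ y, P.lyapunov c αθ y ∂(P.stepLaw αw αθ M x) ∂(P.iterateLaw αw αθ M θ₀ w₀ t) :=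
      integral_bind_of_integrable hms hps h1
    have i1 : Integrable (fun x => P.lyapunov c αθ x - ‖P.gradJ x.1‖ ^ 2)
        (P.iterateLaw αw αθ M θ₀ w₀ t) := (hil t).sub (hig t)
    have h3 := integral_mono (integrable_integral_of_integrable_bind hms h1)
      (i1.add (integrable_const B)) hstep
    rw [integral_add' i1 (integrable_const B), integral_sub (hil t) (hig t), integral_const,
      probReal_univ, one_smul] at h3
    exact h2.trans_le h3
  have htel : ∀ T : ℕ, ∑ t ∈ Finset.range T,
      ∫ x, ‖P.gradJ x.1‖ ^ 2 ∂(P.iterateLaw αw αθ M θ₀ w₀ t) ≤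
      ∫ x, P.lyapunov c αθ x ∂(P.iterateLaw αw αθ M θ₀ w₀ 0) -
        ∫ x, P.lyapunov c αθ x ∂(P.iterateLaw αw αθ M θ₀ w₀ T) + T * B := by
    intro T
    induction T with
    | zero => simp
    | succ T ih =>
      rw [Finset.sum_range_succ]
      push_cast
      linarith [hone T]
  have hR : ∀ θ, 2 / αθ * |P.objective θ| ≤ 2 * K.Rmax / αθ := fun θ => by
    rw [mul_comm 2 K.Rmax, mul_div_assoc, mul_comm K.Rmax]
    exact mul_le_mul_of_nonneg_left (hP.abs_objective_le θ) (by positivity)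
  have hinit : ∫ x, P.lyapunov c αθ x ∂(P.iterateLaw αw αθ M θ₀ w₀ 0) ≤
      c * ‖w₀ - P.wTD θ₀‖ ^ 2 + 2 * K.Rmax / αθ := by
    have h1 : ∫ x, P.lyapunov c αθ x ∂(P.iterateLaw αw αθ M θ₀ w₀ 0) =
        P.lyapunov c αθ (θ₀, w₀) :=
      integral_dirac' _ _ (measurable_lyapunov hP hpolicy henv hQ c αθ).stronglyMeasurable
    have h2 := mul_le_mul_of_nonneg_left (neg_abs_le (P.objective θ₀))
      (show 0 ≤ 2 / αθ by positivity)
    rw [h1, lyapunov]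
    linarith [hR θ₀]
  have hlast : -(2 * K.Rmax / αθ) ≤ ∫ x, P.lyapunov c αθ x ∂(P.iterateLaw αw αθ M θ₀ w₀ T) := by
    have h1 : ∀ x, -(2 * K.Rmax / αθ) ≤ P.lyapunov c αθ x := fun x => by
      have h2 := mul_le_mul_of_nonneg_left (le_abs_self (P.objective x.1))
        (show 0 ≤ 2 / αθ by positivity)
      have h3 : 0 ≤ c * ‖x.2 - P.wTD x.1‖ ^ 2 := by positivity
      rw [lyapunov]
      linarith [hR x.1]
    have h4 := integral_mono (integrable_const (-(2 * K.Rmax / αθ))) (hil T) h1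
    rwa [integral_const, probReal_univ, one_smul] at h4
  have h5 : 4 * K.Rmax / αθ = 2 * K.Rmax / αθ + 2 * K.Rmax / αθ := by ring
  linarith [htel T]

end Convergence

/-- The Lyapunov analysis yields constants that are smaller than the announced ones. -/
theorem lyapunov_bound_le (hP : P.Standing K.Rmax) {Cν lam sA αw αθ e₀ M T κ : ℝ} (hlam : 0 < lam)
    (hαw : 0 < αw) (hαθ : 0 < αθ) (hM : 0 < M) (hT : 0 < T) :
    (4 * K.Lh ^ 2 / (lam * αw) * e₀ ^ 2 + 4 * K.Rmax / αθ) / T +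
        ((15 * K.Lh ^ 2 * (αw ^ 2 * (K.CA ^ 2 * K.Cw sA ^ 2 + K.Cb ^ 2)) / (lam * αw) +
          2 * K.Lh ^ 2 * K.CwXi P.discount ^ 2) / M +
          (4 * K.Lh ^ 2 + 80 * K.Lh ^ 2 / (lam * αw) ^ 2) * κ ^ 2) ≤
      K.c₁ P.discount lam αw αθ e₀ / T + K.c₂ P.discount Cν lam sA αw αθ / M +
        K.c₃ P.discount Cν lam αw αθ * κ ^ 2 := by
  have hR := hP.Rmax_nonneg
  have hγ := hP.one_sub_pos
  have hγ0 := hP.discount_nonneg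
  have hX : 0 < lam * αw := by positivity
  set B := K.CA ^ 2 * K.Cw sA ^ 2 + K.Cb ^ 2 with hB
  have hB0 : 0 ≤ B := by positivity
  have a1 : 4 * K.Lh ^ 2 / (lam * αw) * e₀ ^ 2 + 4 * K.Rmax / αθ ≤
      K.c₁ P.discount lam αw αθ e₀ := by
    rw [RPGConstants.c₁, add_comm]
    refine add_le_add ?_ ?_
    · refine div_le_div₀ (by positivity) (by linarith) (by positivity) ?_
      exact mul_le_of_le_one_right hαθ.le (by linarith)
    · gcongr; norm_num
  have a2 : 15 * K.Lh ^ 2 * (αw ^ 2 * B) / (lam * αw) + 2 * K.Lh ^ 2 * K.CwXi P.discount ^ 2 ≤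
      K.c₂ P.discount Cν lam sA αw αθ := by
    rw [RPGConstants.c₂, ← hB]
    have b1 : 15 * K.Lh ^ 2 * (αw ^ 2 * B) / (lam * αw) ≤
        (48 * αw ^ 2 * B) * (144 * K.Lh ^ 2 / (lam * αw)) := by
      have b2 : 15 * K.Lh ^ 2 * (αw ^ 2 * B) / (lam * αw) =
        15 * (K.Lh ^ 2 * (αw ^ 2 * B) / (lam * αw)) := by ring
      have b3 : (48 * αw ^ 2 * B) * (144 * K.Lh ^ 2 / (lam * αw)) =
        6912 * (K.Lh ^ 2 * (αw ^ 2 * B) / (lam * αw)) := by ring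
      rw [b2, b3]; gcongr; norm_num
    have b4 : 0 ≤ 96 * K.Lw P.discount Cν ^ 2 * K.Lf ^ 4 * K.CwXi P.discount ^ 2 * αθ ^ 2 /
      (lam * αw) * (144 * K.Lh ^ 2 / (lam * αw)) := by positivity
    have b5 : K.Lf ^ 4 = K.Lh ^ 2 := by rw [RPGConstants.Lh]; ring
    have b6 : 0 ≤ K.Lh ^ 2 * K.CwXi P.discount ^ 2 := by positivity
    rw [add_mul, b5]
    rw [b5] at b4
    linarith
  have a3 : 4 * K.Lh ^ 2 + 80 * K.Lh ^ 2 / (lam * αw) ^ 2 ≤ K.c₃ P.discount Cν lam αw αθ := by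
    rw [RPGConstants.c₃]
    have b1 : 0 ≤ 24 * K.Lw P.discount Cν ^ 2 * K.Lh ^ 2 * αθ ^ 2 / (lam * αw) *
      (144 * K.Lh ^ 2 / (lam * αw)) := by positivity
    have b2 : 24 / (lam * αw) * (144 * K.Lh ^ 2 / (lam * αw)) =
      3456 * (K.Lh ^ 2 / (lam * αw) ^ 2) := by ring
    have b3 : 80 * K.Lh ^ 2 / (lam * αw) ^ 2 = 80 * (K.Lh ^ 2 / (lam * αw) ^ 2) := by ring
    have b4 : 0 ≤ K.Lh ^ 2 / (lam * αw) ^ 2 := by positivity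
    rw [add_mul, b2, b3]
    linarith [sq_nonneg K.Lh]
  have c1 := div_le_div_of_nonneg_right a1 hT.le
  have c2 := div_le_div_of_nonneg_right a2 hM.le
  have c3 := mul_le_mul_of_nonneg_right a3 (sq_nonneg κ)
  linarith

end RPGProblem

theorem mainTheorem1 {S N : Type*} [MeasurableSpace S] [MeasurableSpace N] {d m : ℕ}
    (P : RPGProblem S N d m) (K : RPGConstants)
    (hP : P.Standing K.Rmax) (hpolicy : P.PolicyAssumption K) (henv : P.EnvironmentAssumption K)
    (hQ : P.QAssumption K) (hphi : P.FeatureAssumption K) :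
    -- the quantities in the bound are well defined, and suitable constants exist
    (∀ θ, HasGradientAt P.objective (P.gradJ θ) θ) ∧
    (∀ θ, ∃! w, P.IsCompatible θ w) ∧
    BddAbove (Set.range fun θ => ‖P.wTD θ - P.wCompat θ‖) ∧
    (∃ Cν, 1 < Cν ∧ P.IsVisitationConstant Cν) ∧
    (∃ lam, 0 < lam ∧ P.IsDissipationConstant lam) ∧
    (∃ sA, 0 < sA ∧ P.IsSingularValueBound sA) ∧
    -- the convergence bound
    ∀ Cν lam sA : ℝ, 1 < Cν → P.IsVisitationConstant Cν →
      0 < lam → P.IsDissipationConstant lam → 0 < sA → P.IsSingularValueBound sA →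
      ∀ (θ₀ w₀ : EuclideanSpace ℝ (Fin d)) (αw αθ : ℝ) (M : ℕ),
        0 < αw → αw ≤ lam / (2 * K.CA ^ 2) →
        48 * αw * K.CA ^ 2 / lam ≤ (M : ℝ) →
        0 < αθ →
        αθ ≤ min (1 / (4 * K.LJ P.discount Cν))
          (lam * αw / (24 * Real.sqrt 6 * K.Lh * K.Lw P.discount Cν)) →
        (∀ t, IsProbabilityMeasure (P.iterateLaw αw αθ M θ₀ w₀ t) ∧
          Integrable (fun x => ‖P.gradJ x.1‖ ^ 2) (P.iterateLaw αw αθ M θ₀ w₀ t)) ∧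
        ∀ T : ℕ, 1 ≤ T → ∃ t < T,
          ∫ x, ‖P.gradJ x.1‖ ^ 2 ∂(P.iterateLaw αw αθ M θ₀ w₀ t) ≤
            K.c₁ P.discount lam αw αθ ‖w₀ - P.wTD θ₀‖ / T +
              K.c₂ P.discount Cν lam sA αw αθ / M +
              K.c₃ P.discount Cν lam αw αθ * P.kappa ^ 2 := by
  refine ⟨fun θ => RPGProblem.hasGradientAt_objective hP hpolicy henv hQ θ,
    fun θ => RPGProblem.existsUnique_isCompatible hP hpolicy henv θ,
    RPGProblem.bddAbove_norm_wTD_sub_wCompat hP hpolicy henv hphi,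
    hP.exists_isVisitationConstant, RPGProblem.exists_isDissipationConstant hP hphi,
    RPGProblem.exists_isSingularValueBound hP hphi, ?_⟩
  intro Cν lam sA hCν hν hlam0 hlam hs hsA θ₀ w₀ αw αθ M hαw hαw' hM hαθ hαθ'
  have h0 : 0 ≤ Cν := zero_le_one.trans hCν.le
  have hpr := hP.isProbabilityMeasure_iterateLaw αw αθ M θ₀ w₀
  refine ⟨fun t => ⟨hpr t, RPGProblem.integrable_norm_gradJ_sq hP hpolicy henv hQ h0 hν _⟩, ?_⟩
  intro T hT
  have hT0 : (0:ℝ) < T := by exact_mod_cast hT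
  have hCA : 0 < K.CA := by
    have := hphi.Cphi_pos
    unfold RPGConstants.CA
    positivity
  -- the lower bound on `M` is positive, so the batches are not empty
  have hM0 : (0:ℝ) < M := lt_of_lt_of_le (by positivity) hM
  have hMne : M ≠ 0 := by
    rintro rfl
    simp at hM0
  have hbound := fun e₀ => RPGProblem.lyapunov_bound_le hP (Cν := Cν) (sA := sA) (e₀ := e₀)
    (κ := P.kappa) hlam0 hαw hαθ hM0 hT0
  rcases subsingleton_or_nontrivial (EuclideanSpace ℝ (Fin d)) with hsub | hnt
  · -- in dimension `0` the gradient vanishes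
    refine ⟨0, hT, ?_⟩
    have hz : ∀ x : EuclideanSpace ℝ (Fin d) × EuclideanSpace ℝ (Fin d),
        ‖P.gradJ x.1‖ ^ 2 = 0 := fun x => by simp [Subsingleton.elim (P.gradJ x.1) 0]
    have hR := hP.Rmax_nonneg
    simp_rw [hz, integral_zero]
    exact le_trans (by positivity) (hbound _)
  have hLJ := RPGProblem.LJ_pos hP hpolicy henv hQ h0
  have hLw := RPGProblem.Lw_pos hP hpolicy henv hQ h0
  have hLh : 0 < K.Lh := pow_pos hpolicy.Lf_pos 2
  have hw : αw * K.CA ^ 2 ≤ lam / 2 := by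
    rw [le_div_iff₀ (by positivity)] at hαw'
    linarith
  -- since `λ ≤ C_A`, the step size condition `α_w ≤ λ / (2 C_A²)` gives `λ α_w ≤ 1 / 2`
  have hX : lam * αw ≤ 1 / 2 := by
    have h1 := RPGProblem.dissipationConstant_le_CA hP hphi hlam
    have h2 : lam * αw * lam ≤ 1 / 2 * lam := by
      have h3 : lam * lam ≤ K.CA ^ 2 := by
        rw [sq]
        exact mul_le_mul h1 h1 hlam0.le hCA.le
      have h4 := mul_le_mul_of_nonneg_left h3 hαw.le
      linarith
    exact le_of_mul_le_mul_right h2 hlam0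
  have hMw : 48 * αw * K.CA ^ 2 ≤ lam * M := by
    rw [div_le_iff₀ hlam0] at hM
    linarith
  have hJ : 4 * K.LJ P.discount Cν * αθ ≤ 1 := by
    have h1 := hαθ'.trans (min_le_left _ _)
    rw [le_div_iff₀ (by positivity)] at h1
    linarith
  -- `3456 = (24 √6)²`
  have hθ : 3456 * (αθ * K.Lw P.discount Cν * K.Lh) ^ 2 ≤ (lam * αw) ^ 2 := by
    have h1 := hαθ'.trans (min_le_right _ _)
    have h6 : (0:ℝ) < Real.sqrt 6 := Real.sqrt_pos.2 (by norm_num)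
    rw [le_div_iff₀ (by positivity)] at h1
    have h2 := pow_le_pow_left₀ (by positivity) h1 2
    have h3 : Real.sqrt 6 ^ 2 = 6 := Real.sq_sqrt (by norm_num)
    calc 3456 * (αθ * K.Lw P.discount Cν * K.Lh) ^ 2
        = 576 * Real.sqrt 6 ^ 2 * (αθ * K.Lw P.discount Cν * K.Lh) ^ 2 := by rw [h3]; norm_num
      _ = (αθ * (24 * Real.sqrt 6 * K.Lh * K.Lw P.discount Cν)) ^ 2 := by ring
      _ ≤ _ := h2
  have hsum := RPGProblem.sum_integral_norm_gradJ_sq_le hP hpolicy henv hQ hphi h0 hν hs hsA hαw.le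
    hαθ (by positivity) (RPGProblem.integral_lyapunov_stepLaw_le hP hpolicy henv hQ hphi h0 hν hlam0
      hlam hs hsA hαw hαθ hMne hX hw hMw hJ hθ) θ₀ w₀ T
  have hb := hbound ‖w₀ - P.wTD θ₀‖
  -- the smallest term of the sum is at most the average
  obtain ⟨t, ht, hle⟩ := Finset.exists_le_of_sum_le (s := Finset.range T)
    (f := fun t => ∫ x, ‖P.gradJ x.1‖ ^ 2 ∂(P.iterateLaw αw αθ M θ₀ w₀ t))
    (g := fun _ => K.c₁ P.discount lam αw αθ ‖w₀ - P.wTD θ₀‖ / T +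
      K.c₂ P.discount Cν lam sA αw αθ / M + K.c₃ P.discount Cν lam αw αθ * P.kappa ^ 2)
    (Finset.nonempty_range_iff.2 (by omega)) (by
      rw [Finset.sum_const, Finset.card_range, nsmul_eq_mul]
      have hav : ∀ a b : ℝ, a + T * b = T * (a / T + b) := fun a b => by field_simp
      exact (hsum.trans_eq (hav _ _)).trans (mul_le_mul_of_nonneg_left hb hT0.le))
  exact ⟨t, Finset.mem_range.1 ht, hle⟩
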